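/- Let $\beta>0$, $\kappa=\beta/2$, $h=\sqrt{\kappa}-1/\sqrt{\kappa}$ and let $\alpha_1>-1$ be fixed. For $N\ge1$ let $\langle\,\cdot\,\rangle_N$ denote the average over the Laguerre $\beta$-ensemble, i.e. with respect to the probability density on $(0,\infty)^N$ proportional to $$\prod_{l=1}^N\lambda_l^{\alpha_1}e^{-\lambda_l}\prod_{1\le j<k\le N}|\lambda_k-\lambda_j|^{\beta},$$ and let $W_1(s)=N\kappa\,\Big\langle\sum_{j=1}^N\frac{1}{N\kappa s-\lambda_j}\Big\rangle_N$ for $s\in\mathbb{C}\setminus[0,\infty)$ be the globally scaled resolvent. Then $W_1$ has a large $N$ expansion with coefficients $W_1^0,W_1^1,W_1^2$ independent of $N$: for every $s\in\mathbb{C}\setminus[0,\infty)$, $$W_1(s)=N\left(W_1^0(s)+\frac{W_1^1(s)}{N\sqrt{\kappa}}+\frac{W_1^2(s)}{(N\sqrt{\kappa})^2}\right)+o(N^{-1}),\qquad N\to\infty.$$ Let $$\tilde\rho_1^l(x)=\frac{1}{2\pi\mathrm{i}}\lim_{\epsilon\to0^+}\left(W_1^l(x-\mathrm{i}\epsilon)-W_1^l(x+\mathrm{i}\epsilon)\right),\qquad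 l=0,1,2,$$ be the corresponding coefficients in the expansion $\tilde\rho_{(1)}(x;N)=\sum_l\tilde\rho_1^l(x)/(N\sqrt\kappa)^l$ of the smoothed global density. The limits exist in the sense of distributions on $\mathbb{R}$ (tested against complex-valued functions in $C_c^\infty(\mathbb{R})$), and \begin{align*} \tilde\rho_1^0(x)&=\frac{1}{2\pi}\sqrt{\tfrac4x-1}\;\chi_{x\in(0,4)},\\ \tilde\rho_1^1(x)&=\frac h4\left[\delta(x)-\delta(x-4)\right]+\frac{\alpha_1}{2\sqrt\kappa}\left[\frac{1}{\pi x}\left(\tfrac4x-1\right)^{-1/2}\chi_{x\in(0,4)}-\delta(x)\right],\\ \tilde\rho_1^2(x)&=\frac{1}{\pi x^4}\left(\tfrac4x-1\right)^{-5/2}\chi_{x\in(0,4)}-\frac{\alpha_1^2}{\pi x^3\kappa}\left(\tfrac4x-1\right)^{-3/2}\chi_{x\in(0,4)}\\ &\quad+h^2\left[\frac{5}{\pi x^4}\left(\tfrac4x-1\right)^{-5/2}\chi_{x\in(0,4)}-\frac{2}{\pi x^3}\left(\tfrac4x-1\right)^{-3/2}\chi_{x\in(0,4)}\right]\\ &\quad+\frac{h\alpha_1}{2\sqrt\kappa}\left[\frac{1}{\pi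 x^2}\left(\tfrac4x-1\right)^{-1/2}\chi_{x\in(0,4)}+\delta'(x-4)\right]. \end{align*} Here the functions in $\tilde\rho_1^0$ and $\tilde\rho_1^1$ are locally integrable, and each function in $\tilde\rho_1^2$, which may be non-integrable at $x=0$ and $x=4$, acts on a test function through the Hadamard finite part of the integral over $(0,4)$, that is, the constant term as $\eta\to0^+$ of the integral over $(\eta,4-\eta)$ after removal of the negative powers of $\eta$ (equivalently, by analytic continuation in the exponents). Moreover, for each real $x\notin\{0,4\}$ the limits also exist pointwise and equal the above formulas with the $\delta$ and $\delta'$ terms omitted. -/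

import Mathlib

open MeasureTheory Filter Topology Asymptotics
open scoped ContDiff

noncomputable section

namespace LaguerreBeta

/-- The Laguerre weight `x ^ α * exp (-x)` on `x > 0`, and `0` elsewhere. -/
def weight (α : ℝ) : ℝ → ℝ :=
  (Set.Ioi (0 : ℝ)).indicator fun x => x ^ α * Real.exp (-x)

/-- The unnormalised joint eigenvalue density
`∏ₗ w(λₗ) ∏_{j<k} |λₖ - λⱼ| ^ β` of the Laguerre `β`-ensemble with `N` eigenvalues. -/
def jointWeight (β α : ℝ) (N : ℕ) (lam : Fin N → ℝ) : ℝ :=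
  (∏ l, weight α (lam l)) * ∏ j, ∏ k ∈ Finset.Ioi j, |lam k - lam j| ^ β

/-- The measure with density `jointWeight` with respect to Lebesgue measure. -/
def unnormalizedEnsemble (β α : ℝ) (N : ℕ) : Measure (Fin N → ℝ) :=
  volume.withDensity fun lam => ENNReal.ofReal (jointWeight β α N lam)

/-- The Laguerre `β`-ensemble: the law of the `N` eigenvalues. -/
def ensemble (β α : ℝ) (N : ℕ) : Measure (Fin N → ℝ) :=
  (unnormalizedEnsemble β α N Set.univ)⁻¹ • unnormalizedEnsemble β α N

/-- The resolvent `⟨∑ⱼ 1 / (x - λⱼ)⟩`, i.e. the Stieltjes transform of the eigenvalue density. -/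
def resolvent (β α : ℝ) (N : ℕ) (x : ℂ) : ℂ :=
  ∫ lam, ∑ j, 1 / (x - (lam j : ℂ)) ∂(ensemble β α N)

/-- The globally scaled resolvent `W₁(s) = N κ * resolvent (N κ s)` with `κ = β / 2`. -/
def scaledResolvent (β α : ℝ) (N : ℕ) (s : ℂ) : ℂ :=
  ((N * (β / 2) : ℝ) : ℂ) * resolvent β α N (((N * (β / 2) : ℝ) : ℂ) * s)

/-- `W 0, …, W m` are the coefficients, up to order `m`, of the large `N` asymptotic expansion
`W₁(s) = N ∑ₗ W l s / (N √κ) ^ l` for `s` in `ℂ \ [0, ∞)`, where `κ = β / 2`. -/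
def HasResolventExpansion (β α : ℝ) (m : ℕ) (W : ℕ → ℂ → ℂ) : Prop :=
  ∀ s : ℂ, (s.im ≠ 0 ∨ s.re < 0) →
    (fun N : ℕ => scaledResolvent β α N s -
        (N : ℂ) * ∑ l ∈ Finset.range (m + 1), W l s / (((N * √(β / 2) : ℝ) : ℂ)) ^ l)
      =o[atTop] fun N : ℕ => (N : ℝ) / (N * √(β / 2)) ^ m

/-- The difference quotient `(W(x - iε) - W(x + iε)) / (2πi)` whose limit as `ε → 0⁺` is the
inverse Stieltjes transform of `W`. -/
def jump (W : ℂ → ℂ) (ε x : ℝ) : ℂ :=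
  (W ((x : ℂ) - Complex.I * (ε : ℂ)) - W ((x : ℂ) + Complex.I * (ε : ℂ)))
    / (2 * (Real.pi : ℂ) * Complex.I)

/-- The pairing of `jump W ε` with a test function. -/
def jumpPairing (W : ℂ → ℂ) (φ : ℝ → ℂ) (ε : ℝ) : ℂ :=
  ∫ x : ℝ, jump W ε x * φ x

/-- `I` is the Hadamard finite part of `∫ x in a..b, f x`: the constant term left after removing
from the truncated integral over `(a + η, b - η)` a finite combination of negative powers of `η`
and of `log η`. -/
def IsFinitePart (f : ℝ → ℂ) (a b : ℝ) (I : ℂ) : Prop :=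
  (∀ η : ℝ, 0 < η → a + η ≤ b - η → IntervalIntegrable f volume (a + η) (b - η)) ∧
  ∃ (S : Finset ℝ) (c : ℝ → ℂ) (d : ℂ), (∀ r ∈ S, 0 < r) ∧
    Tendsto (fun η : ℝ => (∫ x in (a + η)..(b - η), f x)
        - ∑ r ∈ S, c r * ((η ^ (-r) : ℝ) : ℂ) - d * (Real.log η : ℂ))
      (𝓝[>] 0) (𝓝 I)

/-- The function `(1 / 2π) √(4/x - 1)` on `(0, 4)`, and `0` elsewhere. -/
def mpDensity : ℝ → ℝ :=
  (Set.Ioo (0 : ℝ) 4).indicator fun x => 1 / (2 * Real.pi) * √(4 / x - 1)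

/-- The function `(1 / (π x ^ k)) (4/x - 1) ^ p` on `(0, 4)`, and `0` elsewhere. -/
def edge (k : ℕ) (p : ℝ) : ℝ → ℝ :=
  (Set.Ioo (0 : ℝ) 4).indicator fun x => 1 / (Real.pi * x ^ k) * (4 / x - 1) ^ p

end LaguerreBeta

end

/-!
The expansion of the resolvent follows from loop equations, once the fluctuations of the resolvent
are known to be small; the densities then follow from explicit formulas for the coefficients.

*Integration by parts.* Moving every eigenvalue along the same vector field on the half-line
multiplies the joint density by a factor that involves only divided differences of the field.
Differentiating this change of variables (`IsField.integral_divergence`) gives integration by parts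
for every `β > 0` and `α > -1`, without boundary terms and without singular integrals over the
diagonals.

*Fluctuations.* For the field `x ^ k` it shows that the generator of the Laguerre diffusion acts
triangularly on symmetric polynomials, with eigenvalue `-n` in degree `n`. Hence the Dirichlet form
`∫ ∑ⱼ λⱼ (∂ⱼF)²` dominates the variance of symmetric polynomials (`poincare_symPoly`). Since a
measure with exponential moments is determined by its moments (`measure_ext_of_moments`), products
of two linear statistics are limits of symmetric polynomials, and the inequality extends to them
(`poincare_linearStat_mul`). Applied to a linear statistic and to its square it bounds the second
and fourth central moments (`moments_linearStat_complex_le`), with no loss in `N` after scaling.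

*Loop equations.* For the field `x / (z - x)` integration by parts gives a quadratic equation for
the mean resolvent, perturbed by its variance (`loop_equation_one`), and an equation for the
variance perturbed by a third moment and a covariance (`loop_equation_two`). The limiting equation
`s w² - s w + 1 = 0` has the solution `w₀ = (1 - r) / 2` with `r = √(1 - 4 / s)`. Subtracting the
two equations leaves the factor `s (w + w₀ - 1)` in front of `w - w₀`, where `w` is the mean
resolvent. It is bounded below uniformly in `N` (`stab_le`), because the mean resolvent is a
Stieltjes transform of a positive measure on the half-line, so that `√(-s) w` has non-positive real
part. This bounds the first remainder locally uniformly. Cauchy's formula then turns pointwise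
convergence into convergence of derivatives (`tendsto_deriv_of_tendsto`), and inserting the limits into the loop
equations gives the first and second coefficients as rational functions of `s` and `r`
(`hasResolventExpansion_coef`). An asymptotic expansion determines its coefficients
(`HasResolventExpansion.eq`), so any family with this property has the explicit coefficients.

*Densities.* On the cut `r` has the boundary values `± i √(4 / x - 1)` (`exists_tendsto_rt`), which
gives all pointwise limits. In the sense of distributions, terms with integrable edge singularities
converge by domination (`hasJump_of_edgeBdd`), the poles give Dirac masses (`hasJump_inv_sub`), and
the remaining terms are sums of first and second derivatives of integrable ones, with which the inverse Stieltjes transform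
commutes (`HasJump.deriv`). The same antiderivatives compute the Hadamard finite parts: boundary
terms at the edges contain half-integer powers of the cut-off only, so they have no constant term
(`HasFinPart.by_parts`).
-/

noncomputable section

namespace LaguerreBeta

/-! ### Functions of polynomial growth -/

section

/-- `f` is bounded on `S` by a polynomial in the weight `ρ`. -/
def PolyBdd {X E : Type*} [Norm E] (S : Set X) (ρ : X → ℝ) (f : X → E) : Prop :=
  ∃ (C : ℝ) (m : ℕ), 0 ≤ C ∧ ∀ x ∈ S, ‖f x‖ ≤ C * (1 + ρ x) ^ m

namespace PolyBdd

variable {X E : Type*} {S : Set X} {ρ : X → ℝ}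

lemma const [NormedAddCommGroup E] (c : E) :
    PolyBdd S ρ fun _ => c :=
  ⟨‖c‖, 0, norm_nonneg c, fun x _ => by simp⟩

lemma of_le {E' : Type*} [Norm E] [Norm E'] {f : X → E} {g : X → E'} (hg : PolyBdd S ρ g)
    (h : ∀ x ∈ S, ‖f x‖ ≤ ‖g x‖) : PolyBdd S ρ f := by
  obtain ⟨C, m, hC, hm⟩ := hg
  exact ⟨C, m, hC, fun x hx => (h x hx).trans (hm x hx)⟩

lemma add [NormedAddCommGroup E] (hρ : ∀ x ∈ S, 0 ≤ ρ x) {f g : X → E} (hf : PolyBdd S ρ f)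
    (hg : PolyBdd S ρ g) : PolyBdd S ρ fun x => f x + g x := by
  obtain ⟨C, m, hC, hm⟩ := hf
  obtain ⟨C', m', hC', hm'⟩ := hg
  refine ⟨C + C', m + m', by positivity, fun x hx => ?_⟩
  have h1 : 1 ≤ 1 + ρ x := by linarith [hρ x hx]
  calc ‖f x + g x‖ ≤ ‖f x‖ + ‖g x‖ := norm_add_le _ _
    _ ≤ C * (1 + ρ x) ^ m + C' * (1 + ρ x) ^ m' := add_le_add (hm x hx) (hm' x hx)
    _ ≤ C * (1 + ρ x) ^ (m + m') + C' * (1 + ρ x) ^ (m + m') := by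
        gcongr <;> omega
    _ = _ := by ring

lemma smul {𝕜 : Type*} [NormedField 𝕜] [NormedAddCommGroup E] [NormedSpace 𝕜 E]
    {f : X → 𝕜} {g : X → E} (hf : PolyBdd S ρ f)
    (hg : PolyBdd S ρ g) : PolyBdd S ρ fun x => f x • g x := by
  obtain ⟨C, m, hC, hm⟩ := hf
  obtain ⟨C', m', hC', hm'⟩ := hg
  refine ⟨C * C', m + m', by positivity, fun x hx => ?_⟩
  rw [norm_smul]
  calc ‖f x‖ * ‖g x‖ ≤ (C * (1 + ρ x) ^ m) * (C' * (1 + ρ x) ^ m') :=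
        mul_le_mul (hm x hx) (hm' x hx) (norm_nonneg _) ((norm_nonneg _).trans (hm x hx))
    _ = _ := by ring

lemma mul [NormedField E] {f g : X → E} (hf : PolyBdd S ρ f)
    (hg : PolyBdd S ρ g) : PolyBdd S ρ fun x => f x * g x := smul hf hg

lemma sum [NormedAddCommGroup E] (hρ : ∀ x ∈ S, 0 ≤ ρ x) {ι : Type*} (s : Finset ι)
    {f : ι → X → E} (hf : ∀ i ∈ s, PolyBdd S ρ (f i)) : PolyBdd S ρ fun x => ∑ i ∈ s, f i x := by
  classical
  induction s using Finset.induction_on with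
  | empty => simpa using const (0 : E)
  | insert a s ha ih =>
    simp only [Finset.sum_insert ha]
    exact add hρ (hf a (by simp)) (ih fun i hi => hf i (by simp [hi]))

lemma prod [NormedField E] {ι : Type*} (s : Finset ι)
    {f : ι → X → E} (hf : ∀ i ∈ s, PolyBdd S ρ (f i)) : PolyBdd S ρ fun x => ∏ i ∈ s, f i x := by
  classical
  induction s using Finset.induction_on with
  | empty => simpa using const (1 : E)
  | insert a s ha ih =>
    simp only [Finset.prod_insert ha]
    exact mul (hf a (by simp)) (ih fun i hi => hf i (by simp [hi]))

lemma pow [NormedField E] {f : X → E} (hf : PolyBdd S ρ f) (n : ℕ) :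
    PolyBdd S ρ fun x => f x ^ n := by
  simpa using prod (Finset.range n) fun _ _ => hf

/-- Real powers of a function that is bounded below by a positive constant. -/
lemma rpow {f : X → ℝ} (hf : PolyBdd S ρ f) {c : ℝ} (hc : 0 < c)
    (hfc : ∀ x ∈ S, c ≤ f x) (p : ℝ) : PolyBdd S ρ fun x => f x ^ p := by
  have h1 : PolyBdd S ρ fun x => f x / c := by
    simpa [div_eq_mul_inv] using mul hf (const c⁻¹)
  refine (smul (const (c ^ p)) (pow h1 ⌈|p|⌉₊)).of_le fun x hx => ?_
  have h2 : 1 ≤ f x / c := (one_le_div hc).2 (hfc x hx)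
  have h3 : f x ^ p = c ^ p * (f x / c) ^ p := by
    rw [← Real.mul_rpow hc.le (by positivity), mul_div_cancel₀ _ hc.ne']
  rw [h3, smul_eq_mul, norm_mul, norm_mul]
  gcongr
  rw [Real.norm_of_nonneg (by positivity), Real.norm_of_nonneg (by positivity),
    ← Real.rpow_natCast]
  exact Real.rpow_le_rpow_of_exponent_le h2 ((le_abs_self p).trans (Nat.le_ceil _))

end PolyBdd

/-! ### The ensemble as a probability measure -/

variable {N : ℕ} {α β : ℝ}

/-- The open positive orthant, which carries the ensemble. -/
def orthant (N : ℕ) : Set (Fin N → ℝ) := {lam | ∀ j, 0 < lam j}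

/-- The sum of the coordinates, the weight used to measure growth on the orthant. -/
def total {N : ℕ} (lam : Fin N → ℝ) : ℝ := ∑ j, lam j

lemma isOpen_orthant : IsOpen (orthant N) := by
  simp only [orthant, Set.ofPred_forall]
  exact isOpen_iInter_of_finite fun j => isOpen_lt continuous_const (continuous_apply j)

lemma total_nonneg : ∀ lam ∈ orthant N, 0 ≤ total lam :=
  fun _ h => Finset.sum_nonneg fun j _ => (h j).le

lemma coord_le_total {lam : Fin N → ℝ} (h : lam ∈ orthant N) (j : Fin N) : lam j ≤ total lam :=
  Finset.single_le_sum (f := lam) (fun i _ => (h i).le) (Finset.mem_univ j)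

lemma continuous_total : Continuous (total (N := N)) := by
  unfold total; fun_prop

lemma weight_nonneg (x : ℝ) : 0 ≤ weight α x := by
  unfold weight
  refine Set.indicator_nonneg (fun x hx => ?_) x
  have : (0 : ℝ) < x := hx
  positivity

lemma measurable_weight : Measurable (weight α) := by
  unfold weight
  refine Measurable.indicator ?_ measurableSet_Ioi
  fun_prop

lemma jointWeight_nonneg (lam : Fin N → ℝ) : 0 ≤ jointWeight β α N lam :=
  mul_nonneg (Finset.prod_nonneg fun _ _ => weight_nonneg _)
    (Finset.prod_nonneg fun _ _ => Finset.prod_nonneg fun _ _ => by positivity)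

lemma measurable_jointWeight : Measurable (jointWeight β α N) := by
  unfold jointWeight
  have := measurable_weight (α := α)
  fun_prop

lemma jointWeight_eq_zero {lam : Fin N → ℝ} (h : lam ∉ orthant N) :
    jointWeight β α N lam = 0 := by
  simp only [orthant, Set.mem_ofPred_eq, not_forall] at h
  obtain ⟨j, hj⟩ := h
  have : weight α (lam j) = 0 := by
    unfold weight
    exact Set.indicator_of_notMem (by simpa using hj) _
  unfold jointWeight
  rw [Finset.prod_eq_zero (Finset.mem_univ j) this, zero_mul]

lemma one_add_pow_le_exp (m : ℕ) {c : ℝ} (hc : 0 < c) :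
    ∃ C : ℝ, 0 ≤ C ∧ ∀ x : ℝ, 0 ≤ x → (1 + x) ^ m ≤ C * Real.exp (c * x) := by
  refine ⟨(m.factorial / c ^ m) * Real.exp c, by positivity, fun x hx => ?_⟩
  have h := Real.pow_div_factorial_le_exp (c * (1 + x)) (by positivity) m
  rw [mul_add, mul_one, Real.exp_add, div_le_iff₀ (by positivity), ← mul_one_add, mul_pow] at h
  rw [div_mul_eq_mul_div, div_mul_eq_mul_div, le_div_iff₀ (by positivity)]
  linarith

/-- Up to a factor exponential in `total`, the interaction is bounded. -/
lemma jointWeight_le (hβ : 0 ≤ β) : ∃ C : ℝ, 0 ≤ C ∧ ∀ lam : Fin N → ℝ,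
    jointWeight β α N lam ≤ C * ∏ l, (weight α (lam l) * Real.exp (lam l / 4)) := by
  have hρ := total_nonneg (N := N)
  have h1 : PolyBdd (orthant N) total
      (fun lam : Fin N → ℝ => ∏ j, ∏ k ∈ Finset.Ioi j, |lam k - lam j| ^ β) := by
    refine PolyBdd.prod _ fun j _ => PolyBdd.prod _ fun k _ => ?_
    have h2 : PolyBdd (orthant N) total fun lam : Fin N → ℝ => 1 + total lam :=
      ⟨1, 1, by norm_num, fun x hx => by
        rw [Real.norm_of_nonneg (by linarith [hρ x hx])]; simp⟩
    refine (PolyBdd.rpow h2 one_pos (fun x hx => by linarith [hρ x hx]) β).of_le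
      fun x hx => ?_
    have := hρ x hx
    rw [Real.norm_of_nonneg (by positivity), Real.norm_of_nonneg (by positivity)]
    refine Real.rpow_le_rpow (abs_nonneg _) ?_ hβ
    rw [abs_le]
    constructor <;> linarith [coord_le_total hx j, coord_le_total hx k, hx j, hx k]
  obtain ⟨C, m, hC, hm⟩ := h1
  obtain ⟨C', hC', h'⟩ := one_add_pow_le_exp m (c := 1 / 4) (by norm_num)
  refine ⟨C * C', by positivity, fun lam => ?_⟩
  by_cases hl : lam ∈ orthant N
  · unfold jointWeight
    rw [Finset.prod_mul_distrib, ← Real.exp_sum, mul_comm, mul_left_comm]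
    have h3 : (0 : ℝ) ≤ ∏ l, weight α (lam l) := Finset.prod_nonneg fun _ _ => weight_nonneg _
    rw [mul_comm]
    gcongr
    refine (le_abs_self _).trans ((hm lam hl).trans ?_)
    rw [mul_assoc]
    gcongr
    refine (h' _ (hρ lam hl)).trans (le_of_eq ?_)
    unfold total
    rw [Finset.mul_sum]
    congr 2
    exact Finset.sum_congr rfl fun i _ => by ring
  · rw [jointWeight_eq_zero hl]
    have : 0 ≤ ∏ l, (weight α (lam l) * Real.exp (lam l / 4)) :=
      Finset.prod_nonneg fun _ _ => mul_nonneg (weight_nonneg _) (Real.exp_pos _).le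
    positivity

lemma integrable_exp_mul_jointWeight (hβ : 0 ≤ β) (hα : -1 < α) :
    Integrable fun lam : Fin N → ℝ => Real.exp (total lam / 4) * jointWeight β α N lam := by
  obtain ⟨C, hC, h⟩ := jointWeight_le (N := N) (α := α) hβ
  have h1 : Integrable fun x : ℝ => weight α x * Real.exp (x / 2) := by
    have h2 := integrableOn_rpow_mul_exp_neg_mul_rpow (p := 1) (s := α) (b := 1 / 2) hα
      (by norm_num) (by norm_num)
    rw [← integrable_indicator_iff measurableSet_Ioi] at h2
    refine h2.congr (Eventually.of_forall fun x => ?_)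
    unfold weight
    by_cases hx : x ∈ Set.Ioi (0 : ℝ)
    · simp only [Set.indicator_of_mem hx, Real.rpow_one]
      rw [mul_assoc, ← Real.exp_add]
      ring_nf
    · simp only [Set.indicator_of_notMem hx, zero_mul]
  have h2 : Integrable fun lam : Fin N → ℝ =>
      C * ∏ l, (weight α (lam l) * Real.exp (lam l / 2)) :=
    (Integrable.fintype_prod (f := fun _ x => weight α x * Real.exp (x / 2))
      (μ := fun _ => volume) fun _ => h1).const_mul C
  refine h2.mono' ?_ (Eventually.of_forall fun lam => ?_)
  · exact ((Real.measurable_exp.comp (continuous_total.measurable.div_const 4)).mul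
      measurable_jointWeight).aestronglyMeasurable
  · rw [Real.norm_of_nonneg (mul_nonneg (Real.exp_pos _).le (jointWeight_nonneg _))]
    calc Real.exp (total lam / 4) * jointWeight β α N lam
        ≤ Real.exp (total lam / 4) * (C * ∏ l, (weight α (lam l) * Real.exp (lam l / 4))) := by
          gcongr; exact h lam
      _ = C * ∏ l, (weight α (lam l) * Real.exp (lam l / 2)) := by
          unfold total
          rw [mul_left_comm, Finset.sum_div, Real.exp_sum, ← Finset.prod_mul_distrib]
          congr 1
          refine Finset.prod_congr rfl fun l _ => ?_
          rw [mul_left_comm, ← Real.exp_add]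
          ring_nf

lemma integrable_jointWeight (hβ : 0 ≤ β) (hα : -1 < α) : Integrable (jointWeight β α N) := by
  refine (integrable_exp_mul_jointWeight (N := N) hβ hα).mono'
    measurable_jointWeight.aestronglyMeasurable (Eventually.of_forall fun lam => ?_)
  rw [Real.norm_of_nonneg (jointWeight_nonneg _)]
  by_cases hl : lam ∈ orthant N
  · exact le_mul_of_one_le_left (jointWeight_nonneg _)
      (Real.one_le_exp (by linarith [total_nonneg lam hl]))
  · simp [jointWeight_eq_zero hl]

lemma unnormalizedEnsemble_univ :
    unnormalizedEnsemble β α N Set.univ = ∫⁻ lam, ENNReal.ofReal (jointWeight β α N lam) := by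
  simp [unnormalizedEnsemble]

lemma unnormalizedEnsemble_univ_ne_top (hβ : 0 ≤ β) (hα : -1 < α) :
    unnormalizedEnsemble β α N Set.univ ≠ ⊤ := by
  rw [unnormalizedEnsemble_univ]
  exact (integrable_jointWeight hβ hα).lintegral_lt_top.ne

lemma unnormalizedEnsemble_univ_ne_zero :
    unnormalizedEnsemble β α N Set.univ ≠ 0 := by
  rw [unnormalizedEnsemble_univ, ← pos_iff_ne_zero,
    lintegral_pos_iff_support (measurable_jointWeight.ennreal_ofReal)]
  -- the chamber of increasing positive sequences is open, non-empty, and has positive density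
  set U : Set (Fin N → ℝ) := orthant N ∩ ⋂ j, ⋂ k, {lam | j < k → lam j < lam k} with hU
  have hUo : IsOpen U := by
    refine isOpen_orthant.inter (isOpen_iInter_of_finite fun j => isOpen_iInter_of_finite
      fun k => ?_)
    by_cases hjk : j < k
    · simpa [hjk] using isOpen_lt (continuous_apply j) (continuous_apply k)
    · simp [hjk]
  have hUn : U.Nonempty := by
    refine ⟨fun j => (j : ℝ) + 1, fun j => by positivity, ?_⟩
    simp only [Set.mem_iInter, Set.mem_ofPred_eq]
    intro j k hjk
    have : (j : ℝ) < (k : ℝ) := by exact_mod_cast hjk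
    linarith
  refine (hUo.measure_pos volume hUn).trans_le (measure_mono fun lam hlam => ?_)
  simp only [Function.mem_support, ne_eq, ENNReal.ofReal_eq_zero, not_le]
  refine mul_pos (Finset.prod_pos fun l _ => ?_)
    (Finset.prod_pos fun j _ => Finset.prod_pos fun k hk => ?_)
  · have hl : 0 < lam l := hlam.1 l
    unfold weight
    rw [Set.indicator_of_mem (show lam l ∈ Set.Ioi 0 from hl)]
    positivity
  · have h1 := hlam.2
    simp only [Set.mem_iInter, Set.mem_ofPred_eq] at h1
    have := h1 j k (by simpa using hk)
    have : 0 < |lam k - lam j| := abs_pos.2 (by linarith)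
    positivity

lemma isProbabilityMeasure_ensemble (hβ : 0 ≤ β) (hα : -1 < α) :
    IsProbabilityMeasure (ensemble β α N) := by
  refine ⟨?_⟩
  simp only [ensemble, Measure.smul_apply, smul_eq_mul]
  exact ENNReal.inv_mul_cancel unnormalizedEnsemble_univ_ne_zero
    (unnormalizedEnsemble_univ_ne_top hβ hα)

lemma integral_ensemble {E : Type*} [NormedAddCommGroup E] [NormedSpace ℝ E]
    (F : (Fin N → ℝ) → E) :
    ∫ lam, F lam ∂ensemble β α N = (unnormalizedEnsemble β α N Set.univ)⁻¹.toReal •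
      ∫ lam in orthant N, jointWeight β α N lam • F lam := by
  rw [ensemble, integral_smul_measure, unnormalizedEnsemble,
    integral_withDensity_eq_integral_toReal_smul measurable_jointWeight.ennreal_ofReal
      (by simp)]
  congr 1
  rw [setIntegral_eq_integral_of_forall_compl_eq_zero fun x hx => by
    simp [jointWeight_eq_zero hx]]
  exact integral_congr_ae (Eventually.of_forall fun x => by
    simp [ENNReal.toReal_ofReal (jointWeight_nonneg x)])

lemma ensemble_ae_mem_orthant : ∀ᵐ lam ∂ensemble β α N, lam ∈ orthant N := by
  have hac : ensemble β α N ≪ unnormalizedEnsemble β α N := Measure.smul_absolutelyContinuous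
  refine hac.ae_le (?_ : ∀ᵐ lam ∂unnormalizedEnsemble β α N, lam ∈ orthant N)
  rw [unnormalizedEnsemble, ae_withDensity_iff measurable_jointWeight.ennreal_ofReal]
  refine Eventually.of_forall fun lam h => ?_
  by_contra hl
  simp [jointWeight_eq_zero hl] at h

lemma integrable_exp_total (hβ : 0 ≤ β) (hα : -1 < α) :
    Integrable (fun lam => Real.exp (total lam / 4)) (ensemble β α N) := by
  refine Integrable.smul_measure ?_ (ENNReal.inv_ne_top.2 unnormalizedEnsemble_univ_ne_zero)
  rw [unnormalizedEnsemble, integrable_withDensity_iff_integrable_smul'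
    measurable_jointWeight.ennreal_ofReal (by simp)]
  refine (integrable_exp_mul_jointWeight (N := N) hβ hα).congr (Eventually.of_forall fun x => ?_)
  simp [ENNReal.toReal_ofReal (jointWeight_nonneg x), mul_comm]

lemma integrable_of_polyBdd {E : Type*} [NormedAddCommGroup E] (hβ : 0 ≤ β) (hα : -1 < α)
    {F : (Fin N → ℝ) → E} (hF : AEStronglyMeasurable F (ensemble β α N))
    (h : PolyBdd (orthant N) total F) : Integrable F (ensemble β α N) := by
  obtain ⟨C, m, hC, hm⟩ := h
  obtain ⟨C', hC', h'⟩ := one_add_pow_le_exp m (c := 1 / 4) (by norm_num)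
  refine ((integrable_exp_total hβ hα).const_mul (C * C')).mono' hF ?_
  filter_upwards [ensemble_ae_mem_orthant] with lam hl
  refine (hm lam hl).trans ?_
  rw [mul_assoc]
  gcongr
  refine (h' _ (total_nonneg lam hl)).trans (le_of_eq ?_)
  ring_nf

end

/-! ### Integration by parts along a coordinatewise flow -/

section

variable {N : ℕ} {α β : ℝ} {E : Type*} [NormedAddCommGroup E] [NormedSpace ℝ E]

/-- A differentiable function on the orthant such that it and its derivative have polynomial
growth. -/
structure IsTest (F : (Fin N → ℝ) → E) : Prop where
  diff : ∀ lam ∈ orthant N, DifferentiableAt ℝ F lam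
  bdd : PolyBdd (orthant N) total F
  bdd_fderiv : PolyBdd (orthant N) total (fderiv ℝ F)

/-- `D` is the divided difference of the vector field `φ x = x * D x 0` on the half-line, with
polynomial growth, and `D` and `φ` are bounded below. The lower bounds make
`x ↦ x + t φ x` a diffeomorphism of `(0, ∞)` for small `t ≥ 0`. -/
structure IsField (D : ℝ → ℝ → ℝ) : Prop where
  cont : ContinuousOn (fun p : ℝ × ℝ => D p.1 p.2) (Set.Ici 0 ×ˢ Set.Ici 0)
  diff : ∀ x y, 0 ≤ x → 0 ≤ y → x * D x 0 - y * D y 0 = (x - y) * D x y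
  bdd : ∃ (C : ℝ) (m : ℕ), 0 ≤ C ∧ ∀ x y, 0 ≤ x → 0 ≤ y → |D x y| ≤ C * (1 + (x + y)) ^ m
  lower : ∃ c : ℝ, 0 ≤ c ∧ ∀ x y, 0 ≤ x → 0 ≤ y → -c ≤ D x y ∧ -c ≤ x * D x 0

/-- The Euler step `λ ↦ λ + t φ(λ)` of the flow of the field with divided difference `D`. -/
def step (D : ℝ → ℝ → ℝ) (t : ℝ) (lam : Fin N → ℝ) : Fin N → ℝ :=
  fun j => lam j + t * (lam j * D (lam j) 0)

/-- The divergence of the field with divided difference `D` with respect to the ensemble. -/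
def divergence (β α : ℝ) (D : ℝ → ℝ → ℝ) (lam : Fin N → ℝ) : ℝ :=
  ∑ l, (α * D (lam l) 0 - lam l * D (lam l) 0 + D (lam l) (lam l)) +
    β * ∑ j, ∑ k ∈ Finset.Ioi j, D (lam k) (lam j)

/-- The logarithm of the density ratio produced by the change of variables `step D t`. -/
def logRatio (β α : ℝ) (D : ℝ → ℝ → ℝ) (t : ℝ) (lam : Fin N → ℝ) : ℝ :=
  ∑ l, (α * Real.log (1 + t * D (lam l) 0) - t * (lam l * D (lam l) 0)
      + Real.log (1 + t * D (lam l) (lam l))) +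
    β * ∑ j, ∑ k ∈ Finset.Ioi j, Real.log (1 + t * D (lam k) (lam j))

section

variable {D : ℝ → ℝ → ℝ}

/-- A range of step sizes for which every factor `1 + t D` is at least `1 / 2` and the exponential
weight grows at most by the factor `e`, which makes the dominations uniform. -/
lemma IsField.exists_step (hD : IsField D) : ∃ t₀ : ℝ, 0 < t₀ ∧ ∀ t ∈ Set.Icc 0 t₀,
    ∀ x y, 0 ≤ x → 0 ≤ y → 1 / 2 ≤ 1 + t * D x y ∧ -1 ≤ t * (x * D x 0) := by
  obtain ⟨c, hc, h⟩ := hD.lower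
  refine ⟨1 / (2 * (c + 1)), by positivity, fun t ht x y hx hy => ?_⟩
  obtain ⟨h1, h2⟩ := h x y hx hy
  have h3 : t * (c + 1) ≤ 1 / 2 := by
    calc t * (c + 1) ≤ 1 / (2 * (c + 1)) * (c + 1) := by gcongr; exact ht.2
      _ = 1 / 2 := by field_simp
  have h4 : t * -c ≤ t * D x y := mul_le_mul_of_nonneg_left h1 ht.1
  have h5 : t * -c ≤ t * (x * D x 0) := mul_le_mul_of_nonneg_left h2 ht.1
  have := ht.1
  constructor <;> nlinarith

lemma IsField.continuousOn_comp (hD : IsField D) {X : Type*} [TopologicalSpace X] {S : Set X}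
    {f g : X → ℝ} (hf : ContinuousOn f S) (hg : ContinuousOn g S) (hf0 : ∀ x ∈ S, 0 ≤ f x)
    (hg0 : ∀ x ∈ S, 0 ≤ g x) : ContinuousOn (fun x => D (f x) (g x)) S :=
  hD.cont.comp (hf.prodMk hg) fun x hx => ⟨hf0 x hx, hg0 x hx⟩

lemma IsField.hasDerivAt (hD : IsField D) {x : ℝ} (hx : 0 < x) :
    HasDerivAt (fun x => x * D x 0) (D x x) x := by
  rw [hasDerivAt_iff_tendsto_slope]
  have h1 : Tendsto (fun y => D y x) (𝓝[≠] x) (𝓝 (D x x)) := by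
    have h2 : ContinuousAt (fun y => D y x) x :=
      (hD.continuousOn_comp (S := Set.Ioi 0) (f := fun y => y) (g := fun _ => x)
        continuousOn_id continuousOn_const (fun y hy => le_of_lt hy)
        (fun _ _ => hx.le)).continuousAt (Ioi_mem_nhds hx)
    exact h2.tendsto.mono_left nhdsWithin_le_nhds
  refine h1.congr' ?_
  filter_upwards [self_mem_nhdsWithin, mem_nhdsWithin_of_mem_nhds (Ioi_mem_nhds hx)] with y hy hy0
  have hne : y - x ≠ 0 := sub_ne_zero.2 hy
  rw [slope_def_field, hD.diff y x (le_of_lt hy0) hx.le, mul_div_cancel_left₀ _ hne]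

lemma step_apply (t : ℝ) (lam : Fin N → ℝ) (j : Fin N) :
    step D t lam j = lam j * (1 + t * D (lam j) 0) := by
  simp only [step]; ring

variable {t : ℝ}

lemma step_mem_orthant (ht : ∀ x y, 0 ≤ x → 0 ≤ y → 1 / 2 ≤ 1 + t * D x y ∧ -1 ≤ t * (x * D x 0))
    {lam : Fin N → ℝ} (h : lam ∈ orthant N) : step D t lam ∈ orthant N := fun j => by
  rw [step_apply]
  have := (ht (lam j) 0 (h j).le le_rfl).1
  exact mul_pos (h j) (by linarith)

/-- The divided difference is exactly the factor by which a step scales the distance of two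
eigenvalues, so powers of the interaction transform without differentiating them. -/
lemma IsField.step_sub (hD : IsField D) {lam : Fin N → ℝ} (h : lam ∈ orthant N) (j k : Fin N) :
    step D t lam k - step D t lam j = (lam k - lam j) * (1 + t * D (lam k) (lam j)) := by
  have := hD.diff (lam k) (lam j) (h k).le (h j).le
  simp only [step]
  linear_combination t * this

/-- The Euler step is a bijection of the open half-line. -/
lemma IsField.image_step (hD : IsField D)
    (ht : ∀ x y, 0 ≤ x → 0 ≤ y → 1 / 2 ≤ 1 + t * D x y ∧ -1 ≤ t * (x * D x 0)) :
    step D t '' orthant N = orthant N := by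
  refine Set.Subset.antisymm ?_ fun mu hmu => ?_
  · rintro _ ⟨lam, h, rfl⟩
    exact step_mem_orthant ht h
  · have key : ∀ y : ℝ, 0 < y → ∃ x : ℝ, 0 < x ∧ x + t * (x * D x 0) = y := by
      intro y hy
      have hc : ContinuousOn (fun x => x + t * (x * D x 0)) (Set.Icc 0 (2 * y)) := by
        have := hD.continuousOn_comp (S := Set.Icc 0 (2 * y)) (f := fun x => x)
          (g := fun _ => (0 : ℝ)) continuousOn_id continuousOn_const (fun x hx => hx.1)
          (fun _ _ => le_rfl)
        fun_prop
      have h1 := intermediate_value_Icc (by linarith : (0 : ℝ) ≤ 2 * y) hc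
      have h2 : y ∈ Set.Icc (0 + t * (0 * D 0 0)) (2 * y + t * (2 * y * D (2 * y) 0)) := by
        have := (ht (2 * y) 0 (by linarith) le_rfl).1
        constructor <;> nlinarith
      obtain ⟨x, hx, hxy⟩ := h1 h2
      refine ⟨x, lt_of_le_of_ne hx.1 fun h0 => ?_, hxy⟩
      rw [← h0] at hxy
      simp at hxy
      linarith
    choose f hf0 hf using key
    exact ⟨fun j => f (mu j) (hmu j), fun j => hf0 _ _, funext fun j => hf _ _⟩

lemma IsField.injOn_step (hD : IsField D)
    (ht : ∀ x y, 0 ≤ x → 0 ≤ y → 1 / 2 ≤ 1 + t * D x y ∧ -1 ≤ t * (x * D x 0)) :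
    Set.InjOn (step D t) (orthant N) := by
  intro lam hl mu hm h
  funext j
  have h1 := congrFun h j
  have h2 := hD.diff (lam j) (mu j) (hl j).le (hm j).le
  have h3 := (ht (lam j) (mu j) (hl j).le (hm j).le).1
  simp only [step] at h1
  have h4 : (lam j - mu j) * (1 + t * D (lam j) (mu j)) = 0 := by
    linear_combination h1 - t * h2
  rcases mul_eq_zero.1 h4 with h5 | h5
  · linarith
  · linarith

lemma IsField.hasFDerivAt_step (hD : IsField D) {lam : Fin N → ℝ} (h : lam ∈ orthant N) :
    HasFDerivAt (step D t) (ContinuousLinearMap.pi fun j =>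
      (ContinuousLinearMap.toSpanSingleton ℝ (1 + t * D (lam j) (lam j))).comp
        (ContinuousLinearMap.proj (R := ℝ) (φ := fun _ : Fin N => ℝ) j)) lam := by
  rw [hasFDerivAt_pi]
  intro j
  have h1 : HasDerivAt (fun x => x + t * (x * D x 0)) (1 + t * D (lam j) (lam j)) (lam j) :=
    (hasDerivAt_id _).add ((hD.hasDerivAt (h j)).const_mul t)
  exact HasFDerivAt.comp (g := fun x : ℝ => x + t * (x * D x 0)) (f := fun mu : Fin N → ℝ => mu j)
    lam h1.hasFDerivAt (hasFDerivAt_apply j lam)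

/-- The change of variables `step D t`. Its Jacobian is diagonal because the flow acts on each
coordinate separately. -/
lemma IsField.setIntegral_step (hD : IsField D)
    (ht : ∀ x y, 0 ≤ x → 0 ≤ y → 1 / 2 ≤ 1 + t * D x y ∧ -1 ≤ t * (x * D x 0))
    (G : (Fin N → ℝ) → E) :
    ∫ lam in orthant N, G lam =
      ∫ lam in orthant N, (∏ l, (1 + t * D (lam l) (lam l))) • G (step D t lam) := by
  conv_lhs => rw [← hD.image_step ht]
  rw [integral_image_eq_integral_abs_det_fderiv_smul volume isOpen_orthant.measurableSet
    (fun lam h => (hD.hasFDerivAt_step h).hasFDerivWithinAt) (hD.injOn_step ht)]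
  refine setIntegral_congr_fun isOpen_orthant.measurableSet fun lam h => ?_
  simp only [ContinuousLinearMap.det_pi]
  congr 1
  rw [Finset.abs_prod]
  refine Finset.prod_congr rfl fun l _ => ?_
  have := (ht (lam l) (lam l) (h l).le (h l).le).1
  have h2 : (ContinuousLinearMap.toSpanSingleton ℝ (1 + t * D (lam l) (lam l))).det
      = 1 + t * D (lam l) (lam l) := by
    simp [ContinuousLinearMap.det]
  rw [h2, abs_of_nonneg (by linarith)]

lemma exp_logRatio (ht : ∀ x y, 0 ≤ x → 0 ≤ y → 1 / 2 ≤ 1 + t * D x y ∧ -1 ≤ t * (x * D x 0))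
    {lam : Fin N → ℝ} (h : lam ∈ orthant N) :
    Real.exp (logRatio β α D t lam) = (∏ l, ((1 + t * D (lam l) 0) ^ α *
      Real.exp (-(t * (lam l * D (lam l) 0))) * (1 + t * D (lam l) (lam l)))) *
      ∏ j, ∏ k ∈ Finset.Ioi j, (1 + t * D (lam k) (lam j)) ^ β := by
  have hp : ∀ x y, 0 ≤ x → 0 ≤ y → 0 < 1 + t * D x y := fun x y hx hy => by
    linarith [(ht x y hx hy).1]
  rw [logRatio, Real.exp_add, Real.exp_sum, Finset.mul_sum, Real.exp_sum]
  congr 1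
  · refine Finset.prod_congr rfl fun l _ => ?_
    rw [Real.exp_add, sub_eq_add_neg, Real.exp_add, Real.exp_log (hp _ _ (h l).le (h l).le),
      Real.rpow_def_of_pos (hp _ _ (h l).le le_rfl), mul_comm α]
  · refine Finset.prod_congr rfl fun j _ => ?_
    rw [Finset.mul_sum, Real.exp_sum]
    refine Finset.prod_congr rfl fun k _ => ?_
    rw [Real.rpow_def_of_pos (hp _ _ (h k).le (h j).le), mul_comm β]

lemma IsField.jointWeight_step (hD : IsField D)
    (ht : ∀ x y, 0 ≤ x → 0 ≤ y → 1 / 2 ≤ 1 + t * D x y ∧ -1 ≤ t * (x * D x 0))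
    {lam : Fin N → ℝ} (h : lam ∈ orthant N) :
    (∏ l, (1 + t * D (lam l) (lam l))) * jointWeight β α N (step D t lam) =
      jointWeight β α N lam * Real.exp (logRatio β α D t lam) := by
  have hp : ∀ x y, 0 ≤ x → 0 ≤ y → 0 < 1 + t * D x y := fun x y hx hy => by
    linarith [(ht x y hx hy).1]
  rw [exp_logRatio ht h]
  have hW : (∏ l, (1 + t * D (lam l) (lam l))) * ∏ l, weight α (step D t lam l) =
      (∏ l, weight α (lam l)) * ∏ l, ((1 + t * D (lam l) 0) ^ α *
      Real.exp (-(t * (lam l * D (lam l) 0))) * (1 + t * D (lam l) (lam l))) := by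
    rw [← Finset.prod_mul_distrib, ← Finset.prod_mul_distrib]
    refine Finset.prod_congr rfl fun l _ => ?_
    have hs := step_mem_orthant ht h l
    unfold weight
    rw [Set.indicator_of_mem (show step D t lam l ∈ Set.Ioi 0 from hs),
      Set.indicator_of_mem (show lam l ∈ Set.Ioi 0 from h l), step_apply,
      Real.mul_rpow (h l).le (hp _ _ (h l).le le_rfl).le]
    have : Real.exp (-(lam l * (1 + t * D (lam l) 0))) =
        Real.exp (-lam l) * Real.exp (-(t * (lam l * D (lam l) 0))) := by
      rw [← Real.exp_add]; ring_nf
    rw [this]; ring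
  have hI : ∏ j, ∏ k ∈ Finset.Ioi j, |step D t lam k - step D t lam j| ^ β =
      (∏ j, ∏ k ∈ Finset.Ioi j, |lam k - lam j| ^ β) *
      ∏ j, ∏ k ∈ Finset.Ioi j, (1 + t * D (lam k) (lam j)) ^ β := by
    rw [← Finset.prod_mul_distrib]
    refine Finset.prod_congr rfl fun j _ => ?_
    rw [← Finset.prod_mul_distrib]
    refine Finset.prod_congr rfl fun k _ => ?_
    rw [hD.step_sub h, abs_mul, abs_of_pos (hp _ _ (h k).le (h j).le),
      Real.mul_rpow (abs_nonneg _) (hp _ _ (h k).le (h j).le).le]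
  unfold jointWeight
  rw [← mul_assoc, hW, hI]
  ring

/-- The derivative in `t` of `logRatio`. -/
def logRatioDeriv (β α : ℝ) (D : ℝ → ℝ → ℝ) (t : ℝ) (lam : Fin N → ℝ) : ℝ :=
  ∑ l, (α * (D (lam l) 0 / (1 + t * D (lam l) 0)) - lam l * D (lam l) 0
      + D (lam l) (lam l) / (1 + t * D (lam l) (lam l))) +
    β * ∑ j, ∑ k ∈ Finset.Ioi j, D (lam k) (lam j) / (1 + t * D (lam k) (lam j))

lemma hasDerivAt_logRatio
    (ht : ∀ x y, 0 ≤ x → 0 ≤ y → 1 / 2 ≤ 1 + t * D x y ∧ -1 ≤ t * (x * D x 0))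
    {lam : Fin N → ℝ} (h : lam ∈ orthant N) :
    HasDerivAt (fun t => logRatio β α D t lam) (logRatioDeriv β α D t lam) t := by
  have hl : ∀ x y, 0 ≤ x → 0 ≤ y →
      HasDerivAt (fun t => Real.log (1 + t * D x y)) (D x y / (1 + t * D x y)) t := by
    intro x y hx hy
    have h1 : HasDerivAt (fun t => 1 + t * D x y) (D x y) t := by
      simpa using ((hasDerivAt_id t).mul_const (D x y)).const_add 1
    exact h1.log (by linarith [(ht x y hx hy).1])
  unfold logRatio logRatioDeriv
  refine HasDerivAt.add (HasDerivAt.fun_sum fun l _ => ?_)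
    (HasDerivAt.const_mul _ (HasDerivAt.fun_sum fun j _ => HasDerivAt.fun_sum fun k _ =>
      hl _ _ (h k).le (h j).le))
  refine HasDerivAt.add (HasDerivAt.sub ((hl _ _ (h l).le le_rfl).const_mul α) ?_)
    (hl _ _ (h l).le (h l).le)
  simpa using (hasDerivAt_id t).mul_const (lam l * D (lam l) 0)

lemma logRatioDeriv_zero (lam : Fin N → ℝ) :
    logRatioDeriv β α D 0 lam = divergence β α D lam := by
  simp [logRatioDeriv, divergence]

lemma logRatio_zero (lam : Fin N → ℝ) : logRatio β α D 0 lam = 0 := by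
  simp [logRatio]

lemma step_zero (lam : Fin N → ℝ) : step D 0 lam = lam := by
  ext j; simp [step]

end

end

section

variable {N : ℕ} {α β : ℝ} {E : Type*} [NormedAddCommGroup E] [NormedSpace ℝ E]
  {D : ℝ → ℝ → ℝ}

/-- The pull-back of `F` times the density under the Euler step, relative to the density. -/
def pullback (β α : ℝ) (D : ℝ → ℝ → ℝ) (F : (Fin N → ℝ) → E) (t : ℝ) (lam : Fin N → ℝ) : E :=
  Real.exp (logRatio β α D t lam) • F (step D t lam)

/-- The derivative of `pullback` in `t`. -/
def pullbackDeriv (β α : ℝ) (D : ℝ → ℝ → ℝ) (F : (Fin N → ℝ) → E) (t : ℝ)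
    (lam : Fin N → ℝ) : E :=
  Real.exp (logRatio β α D t lam) • (fderiv ℝ F (step D t lam) (fun j => lam j * D (lam j) 0)
    + logRatioDeriv β α D t lam • F (step D t lam))

lemma hasDerivAt_pullback {t : ℝ}
    (ht : ∀ x y, 0 ≤ x → 0 ≤ y → 1 / 2 ≤ 1 + t * D x y ∧ -1 ≤ t * (x * D x 0))
    {F : (Fin N → ℝ) → E} (hF : IsTest F) {lam : Fin N → ℝ} (h : lam ∈ orthant N) :
    HasDerivAt (fun t => pullback β α D F t lam) (pullbackDeriv β α D F t lam) t := by
  have h1 : HasDerivAt (fun t => step D t lam) (fun j => lam j * D (lam j) 0) t := by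
    rw [hasDerivAt_pi]
    intro j
    exact (((hasDerivAt_id t).mul_const (lam j * D (lam j) 0)).const_add (lam j)).congr_deriv
      (by simp)
  have h2 := (hF.diff _ (step_mem_orthant ht h)).hasFDerivAt.comp_hasDerivAt t h1
  have h3 := (hasDerivAt_logRatio (β := β) (α := α) ht h).exp.smul h2
  refine h3.congr_deriv ?_
  simp only [pullbackDeriv, smul_add, smul_smul, Function.comp_def]

section bounds

variable {t₀ : ℝ}

lemma PolyBdd.comp_step {E : Type*} [NormedAddCommGroup E] {F : (Fin N → ℝ) → E}
    (hF : PolyBdd (orthant N) total F)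
    (hD : PolyBdd (Set.Icc 0 t₀ ×ˢ orthant N) (fun p => total p.2)
      (fun p : ℝ × (Fin N → ℝ) => total (step D p.1 p.2)))
    (ht₀ : ∀ t ∈ Set.Icc 0 t₀,
      ∀ x y, 0 ≤ x → 0 ≤ y → 1 / 2 ≤ 1 + t * D x y ∧ -1 ≤ t * (x * D x 0)) :
    PolyBdd (Set.Icc 0 t₀ ×ˢ orthant N) (fun p => total p.2)
      (fun p : ℝ × (Fin N → ℝ) => F (step D p.1 p.2)) := by
  obtain ⟨C, m, hC, hm⟩ := hF
  refine ((PolyBdd.const C).mul (((PolyBdd.const (1 : ℝ)).add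
    (fun p hp => total_nonneg _ hp.2) hD).pow m)).of_le fun p hp => ?_
  have hs := step_mem_orthant (ht₀ p.1 hp.1) hp.2
  have := total_nonneg _ hs
  rw [Real.norm_of_nonneg (by positivity)]
  exact hm _ hs

lemma IsField.polyBdd_pullbackDeriv (hD : IsField D)
    (ht₀ : ∀ t ∈ Set.Icc 0 t₀,
      ∀ x y, 0 ≤ x → 0 ≤ y → 1 / 2 ≤ 1 + t * D x y ∧ -1 ≤ t * (x * D x 0))
    {F : (Fin N → ℝ) → E} (hF : IsTest F) :
    PolyBdd (Set.Icc 0 t₀ ×ˢ orthant N) (fun p => total p.2)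
      (fun p : ℝ × (Fin N → ℝ) => pullbackDeriv β α D F p.1 p.2) := by
  set S : Set (ℝ × (Fin N → ℝ)) := Set.Icc 0 t₀ ×ˢ orthant N with hS
  set ρ : ℝ × (Fin N → ℝ) → ℝ := fun p => total p.2 with hρdef
  have hρ : ∀ p ∈ S, 0 ≤ ρ p := fun p hp => total_nonneg _ hp.2
  have hcoord : ∀ l, PolyBdd S ρ fun p => p.2 l := fun l =>
    ⟨1, 1, by norm_num, fun p hp => by
      rw [Real.norm_of_nonneg (hp.2 l).le]
      have : p.2 l ≤ ρ p := coord_le_total hp.2 l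
      linarith⟩
  have htime : PolyBdd S ρ fun p => p.1 :=
    ⟨|t₀|, 0, abs_nonneg _, fun p hp => by
      rw [Real.norm_of_nonneg hp.1.1]
      simpa using hp.1.2.trans (le_abs_self t₀)⟩
  obtain ⟨C, m, hC, hm⟩ := hD.bdd
  have hDf : ∀ f g : ℝ × (Fin N → ℝ) → ℝ, PolyBdd S ρ f → PolyBdd S ρ g →
      (∀ p ∈ S, 0 ≤ f p) → (∀ p ∈ S, 0 ≤ g p) → PolyBdd S ρ fun p => D (f p) (g p) := by
    intro f g hf hg hf0 hg0
    refine ((PolyBdd.const C).mul (((PolyBdd.const (1 : ℝ)).add hρ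
      (hf.add hρ hg)).pow m)).of_le fun p hp => ?_
    exact (hm _ _ (hf0 p hp) (hg0 p hp)).trans (le_abs_self _)
  have hD2 : ∀ l k, PolyBdd S ρ fun p => D (p.2 l) (p.2 k) := fun l k =>
    hDf _ _ (hcoord l) (hcoord k) (fun p hp => (hp.2 l).le) fun p hp => (hp.2 k).le
  have hD0 : ∀ l, PolyBdd S ρ fun p => D (p.2 l) 0 := fun l =>
    hDf _ _ (hcoord l) (PolyBdd.const 0) (fun p hp => (hp.2 l).le) fun p hp => le_rfl
  have hlow2 : ∀ l k, ∀ p ∈ S, 1 / 2 ≤ 1 + p.1 * D (p.2 l) (p.2 k) := fun l k p hp =>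
    (ht₀ p.1 hp.1 _ _ (hp.2 l).le (hp.2 k).le).1
  have hlow0 : ∀ l, ∀ p ∈ S, 1 / 2 ≤ 1 + p.1 * D (p.2 l) 0 := fun l p hp =>
    (ht₀ p.1 hp.1 _ _ (hp.2 l).le le_rfl).1
  have hf2 : ∀ l k, PolyBdd S ρ fun p => 1 + p.1 * D (p.2 l) (p.2 k) := fun l k =>
    (PolyBdd.const (1 : ℝ)).add hρ (htime.mul (hD2 l k))
  have hf0 : ∀ l, PolyBdd S ρ fun p => 1 + p.1 * D (p.2 l) 0 := fun l =>
    (PolyBdd.const (1 : ℝ)).add hρ (htime.mul (hD0 l))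
  have hφ : ∀ l, PolyBdd S ρ fun p => p.2 l * D (p.2 l) 0 := fun l => (hcoord l).mul (hD0 l)
  -- division by a factor bounded below is harmless
  have hdiv : ∀ f g : ℝ × (Fin N → ℝ) → ℝ, PolyBdd S ρ f → PolyBdd S ρ g →
      (∀ p ∈ S, 1 / 2 ≤ g p) → PolyBdd S ρ fun p => f p / g p := by
    intro f g hf hg hg0
    have h := hf.mul (hg.rpow (by norm_num : (0 : ℝ) < 1 / 2) hg0 (-1))
    refine h.of_le fun p hp => ?_
    rw [Real.rpow_neg_one, div_eq_mul_inv]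
  have hexp : PolyBdd S ρ fun p => Real.exp (logRatio β α D p.1 p.2) := by
    have h : PolyBdd S ρ fun p => (∏ l, ((1 + p.1 * D (p.2 l) 0) ^ α *
      Real.exp (-(p.1 * (p.2 l * D (p.2 l) 0))) * (1 + p.1 * D (p.2 l) (p.2 l)))) *
      ∏ j, ∏ k ∈ Finset.Ioi j, (1 + p.1 * D (p.2 k) (p.2 j)) ^ β := by
      refine PolyBdd.mul (PolyBdd.prod _ fun l _ => ?_) (PolyBdd.prod _ fun j _ =>
        PolyBdd.prod _ fun k _ => (hf2 k j).rpow (by norm_num) (hlow2 k j) β)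
      refine PolyBdd.mul (PolyBdd.mul ((hf0 l).rpow (by norm_num) (hlow0 l) α) ?_) (hf2 l l)
      refine (PolyBdd.const (Real.exp 1)).of_le fun p hp => ?_
      rw [Real.norm_of_nonneg (Real.exp_pos _).le, Real.norm_of_nonneg (Real.exp_pos _).le]
      refine Real.exp_le_exp.2 ?_
      linarith [(ht₀ p.1 hp.1 (p.2 l) 0 (hp.2 l).le le_rfl).2]
    exact h.of_le fun p hp => by rw [exp_logRatio (ht₀ p.1 hp.1) hp.2]
  have hlog : PolyBdd S ρ fun p => logRatioDeriv β α D p.1 p.2 := by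
    unfold logRatioDeriv
    refine PolyBdd.add hρ (PolyBdd.sum hρ _ fun l _ => ?_) (PolyBdd.mul (PolyBdd.const _)
      (PolyBdd.sum hρ _ fun j _ => PolyBdd.sum hρ _ fun k _ =>
        hdiv _ _ (hD2 k j) (hf2 k j) (hlow2 k j)))
    refine PolyBdd.add hρ ?_ (hdiv _ _ (hD2 l l) (hf2 l l) (hlow2 l l))
    have h1 := (PolyBdd.mul (PolyBdd.const α) (hdiv _ _ (hD0 l) (hf0 l) (hlow0 l))).add hρ
      ((PolyBdd.const (-1 : ℝ)).mul (hφ l))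
    refine h1.of_le fun p _ => le_of_eq ?_
    congr 1; ring
  have htot : PolyBdd S ρ fun p => total (step D p.1 p.2) := by
    unfold total step
    exact PolyBdd.sum hρ _ fun l _ => (hcoord l).add hρ (htime.mul (hφ l))
  have hF0 := hF.bdd.comp_step htot ht₀
  have hF1 := hF.bdd_fderiv.comp_step htot ht₀
  unfold pullbackDeriv
  refine hexp.smul (PolyBdd.add hρ ?_ (hlog.smul hF0))
  have hvec : PolyBdd S ρ fun p => (fun j => p.2 j * D (p.2 j) 0 : Fin N → ℝ) := by
    have h := PolyBdd.sum hρ Finset.univ fun l (_ : l ∈ Finset.univ) =>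
      (hφ l).of_le (f := fun p => |p.2 l * D (p.2 l) 0|) fun p _ => by simp
    refine h.of_le fun p hp => ?_
    rw [Real.norm_of_nonneg (Finset.sum_nonneg fun _ _ => abs_nonneg _)]
    refine (pi_norm_le_iff_of_nonneg (Finset.sum_nonneg fun _ _ => abs_nonneg _)).2 fun j => ?_
    exact Finset.single_le_sum (f := fun l => |p.2 l * D (p.2 l) 0|)
      (fun _ _ => abs_nonneg _) (Finset.mem_univ j)
  have h1 : PolyBdd S ρ fun p => ‖fderiv ℝ F (step D p.1 p.2)‖ *
      ‖(fun j => p.2 j * D (p.2 j) 0 : Fin N → ℝ)‖ :=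
    PolyBdd.mul (hF1.of_le fun _ _ => by simp) (hvec.of_le fun _ _ => by simp)
  refine h1.of_le fun p _ => ?_
  rw [Real.norm_of_nonneg (by positivity)]
  exact ContinuousLinearMap.le_opNorm _ _

end bounds

lemma IsTest.continuousOn {F : (Fin N → ℝ) → E} (hF : IsTest F) : ContinuousOn F (orthant N) :=
  fun x hx => (hF.diff x hx).continuousAt.continuousWithinAt

lemma IsField.continuousOn_pullback (hD : IsField D) {t : ℝ}
    (ht : ∀ x y, 0 ≤ x → 0 ≤ y → 1 / 2 ≤ 1 + t * D x y ∧ -1 ≤ t * (x * D x 0))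
    {F : (Fin N → ℝ) → E} (hF : IsTest F) :
    ContinuousOn (pullback β α D F t) (orthant N) := by
  have hD2 : ∀ l k, ContinuousOn (fun lam : Fin N → ℝ => D (lam l) (lam k)) (orthant N) :=
    fun l k => hD.continuousOn_comp (by fun_prop) (by fun_prop) (fun x hx => (hx l).le)
      fun x hx => (hx k).le
  have hD0 : ∀ l, ContinuousOn (fun lam : Fin N → ℝ => D (lam l) 0) (orthant N) :=
    fun l => hD.continuousOn_comp (by fun_prop) (by fun_prop) (fun x hx => (hx l).le)
      fun x hx => le_rfl
  have hL2 : ∀ l k, ContinuousOn (fun lam : Fin N → ℝ => Real.log (1 + t * D (lam l) (lam k)))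
      (orthant N) := fun l k => ContinuousOn.log (continuousOn_const.add
      (continuousOn_const.mul (hD2 l k))) fun x hx => by
    have := (ht _ _ (hx l).le (hx k).le).1
    linarith
  have hL0 : ∀ l, ContinuousOn (fun lam : Fin N → ℝ => Real.log (1 + t * D (lam l) 0))
      (orthant N) := fun l => ContinuousOn.log (continuousOn_const.add
      (continuousOn_const.mul (hD0 l))) fun x hx => by
    have := (ht _ 0 (hx l).le le_rfl).1
    linarith
  have hφ : ∀ l, ContinuousOn (fun lam : Fin N → ℝ => t * (lam l * D (lam l) 0)) (orthant N) :=
    fun l => continuousOn_const.mul ((by fun_prop : ContinuousOn (fun lam : Fin N → ℝ => lam l)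
      (orthant N)).mul (hD0 l))
  unfold pullback
  refine ContinuousOn.smul (ContinuousOn.rexp ?_) (hF.continuousOn.comp ?_
    fun x hx => step_mem_orthant ht hx)
  · unfold logRatio
    exact (continuousOn_finsetSum _ fun l _ => ((continuousOn_const.mul (hL0 l)).sub
      (hφ l)).add (hL2 l l)).add (continuousOn_const.mul (continuousOn_finsetSum _ fun j _ =>
        continuousOn_finsetSum _ fun k _ => hL2 k j))
  · exact continuousOn_pi.2 fun l =>
      (by fun_prop : ContinuousOn (fun lam : Fin N → ℝ => lam l) (orthant N)).add (hφ l)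

/-- Integration by parts for the ensemble, in the form obtained by differentiating the change of
variables `λ ↦ λ + t φ(λ)` at `t = 0⁺`. Only divided differences of the field occur, so no
singular integral over the diagonals `λ_j = λ_k` appears, whatever the value of `β`. -/
theorem IsField.integral_divergence [CompleteSpace E] (hD : IsField D) (hβ : 0 ≤ β) (hα : -1 < α)
    {F : (Fin N → ℝ) → E} (hF : IsTest F) :
    ∫ lam, (fderiv ℝ F lam (fun j => lam j * D (lam j) 0) + divergence β α D lam • F lam)
      ∂ensemble β α N = 0 := by
  obtain ⟨t₀, ht₀pos, ht₀⟩ := hD.exists_step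
  obtain ⟨C, m, hC, hm⟩ := hD.polyBdd_pullbackDeriv (β := β) (α := α) ht₀ hF
  -- by the change of variables the pulled-back integral does not depend on `t`
  have hinv : ∀ t ∈ Set.Icc 0 t₀, ∫ lam in orthant N, jointWeight β α N lam •
      pullback β α D F t lam = ∫ lam in orthant N, jointWeight β α N lam • F lam := by
    intro t ht
    conv_rhs => rw [hD.setIntegral_step (ht₀ t ht)]
    refine setIntegral_congr_fun isOpen_orthant.measurableSet fun lam h => ?_
    simp only [pullback, smul_smul]
    rw [← hD.jointWeight_step (ht₀ t ht) h]
  set τ : ℕ → ℝ := fun n => t₀ / (n + 1) with hτ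
  have hτ0 : ∀ n, 0 < τ n := fun n => by positivity
  have hτm : ∀ n, τ n ∈ Set.Icc 0 t₀ := fun n =>
    ⟨(hτ0 n).le, div_le_self ht₀pos.le (by linarith [n.cast_nonneg (α := ℝ)])⟩
  have hτlim : Tendsto τ atTop (𝓝[>] 0) := by
    refine tendsto_nhdsWithin_iff.2 ⟨?_, Eventually.of_forall hτ0⟩
    simpa [hτ, div_eq_mul_inv] using (tendsto_one_div_add_atTop_nhds_zero_nat (𝕜 := ℝ)).const_mul t₀
  have hmw := (integrable_jointWeight (N := N) hβ hα)
  have hzero : ∀ lam : Fin N → ℝ, pullback β α D F 0 lam = F lam := fun lam => by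
    simp [pullback, logRatio_zero, step_zero]
  have h0 : (0 : ℝ) ∈ Set.Icc 0 t₀ := ⟨le_rfl, ht₀pos.le⟩
  have hgrow : ∀ f : (Fin N → ℝ) → E, AEStronglyMeasurable f (volume.restrict (orthant N)) →
      PolyBdd (orthant N) total f →
      IntegrableOn (fun lam => jointWeight β α N lam • f lam) (orthant N) := by
    intro f hf hfb
    obtain ⟨C, m, hC, hm⟩ := hfb
    obtain ⟨C', hC', h'⟩ := one_add_pow_le_exp m (c := 1 / 4) (by norm_num)
    refine ((integrable_exp_mul_jointWeight (N := N) hβ hα).const_mul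
      (C * C')).integrableOn.mono' (measurable_jointWeight.aestronglyMeasurable.smul hf) ?_
    filter_upwards [ae_restrict_mem isOpen_orthant.measurableSet] with lam hl
    rw [norm_smul, Real.norm_of_nonneg (jointWeight_nonneg _), ← mul_assoc, mul_comm]
    refine mul_le_mul_of_nonneg_right ?_ (jointWeight_nonneg _)
    refine (hm lam hl).trans ?_
    rw [mul_assoc]
    gcongr
    refine (h' _ (total_nonneg lam hl)).trans (le_of_eq ?_)
    ring_nf
  -- difference quotients in `t` are dominated by the uniform bound on the derivative
  have hquot : ∀ n, ∀ lam ∈ orthant N,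
      ‖(τ n)⁻¹ • (pullback β α D F (τ n) lam - F lam)‖ ≤ C * (1 + total lam) ^ m := by
    intro n lam hl
    have h1 := norm_image_sub_le_of_norm_deriv_le_segment' (f := fun t => pullback β α D F t lam)
      (a := 0) (b := t₀) (C := C * (1 + total lam) ^ m)
      (fun t ht => (hasDerivAt_pullback (ht₀ t ht) hF hl).hasDerivWithinAt)
      (fun t ht => hm (t, lam) ⟨⟨ht.1, ht.2.le⟩, hl⟩) (τ n) (hτm n)
    rw [hzero, sub_zero] at h1
    rw [norm_smul, norm_inv, Real.norm_of_nonneg (hτ0 n).le, inv_mul_le_iff₀ (hτ0 n)]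
    linarith
  have hmeas : ∀ n, AEStronglyMeasurable (fun lam => (τ n)⁻¹ • (pullback β α D F (τ n) lam - F lam))
      (volume.restrict (orthant N)) := fun n =>
    (((hD.continuousOn_pullback (ht₀ _ (hτm n)) hF).sub hF.continuousOn).const_smul
      _).aestronglyMeasurable isOpen_orthant.measurableSet
  have hlim := tendsto_integral_of_dominated_convergence
    (F := fun n lam => jointWeight β α N lam • ((τ n)⁻¹ • (pullback β α D F (τ n) lam - F lam)))
    (f := fun lam => jointWeight β α N lam • pullbackDeriv β α D F 0 lam)
    (μ := volume.restrict (orthant N))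
    (fun lam => ‖jointWeight β α N lam • (C * (1 + total lam) ^ m)‖)
    (fun n => measurable_jointWeight.aestronglyMeasurable.smul (hmeas n)) ?_ ?_ ?_
  · have hconst : ∀ n, ∫ lam in orthant N,
        jointWeight β α N lam • ((τ n)⁻¹ • (pullback β α D F (τ n) lam - F lam)) = 0 := by
      intro n
      have hF1 := hgrow F (hF.continuousOn.aestronglyMeasurable isOpen_orthant.measurableSet)
        hF.bdd
      have hF2 : IntegrableOn (fun lam => jointWeight β α N lam • pullback β α D F (τ n) lam)
          (orthant N) := by
        have h2 := hgrow (fun lam => (τ n)⁻¹ • (pullback β α D F (τ n) lam - F lam)) (hmeas n)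
          ⟨C, m, hC, hquot n⟩
        have h3 := (h2.smul (τ n)).add hF1
        refine h3.congr (Eventually.of_forall fun lam => ?_)
        simp only [Pi.add_apply, Pi.smul_apply]
        rw [smul_comm (τ n), smul_inv_smul₀ (hτ0 n).ne', ← smul_add, sub_add_cancel]
      have h4 : ∀ lam, jointWeight β α N lam • ((τ n)⁻¹ • (pullback β α D F (τ n) lam - F lam))
          = (τ n)⁻¹ • (jointWeight β α N lam • pullback β α D F (τ n) lam
            - jointWeight β α N lam • F lam) := fun lam => by
        rw [smul_comm, smul_sub]
      simp only [h4]
      rw [integral_smul, integral_sub hF2 hF1, hinv _ (hτm n), sub_self, smul_zero]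
    simp only [hconst] at hlim
    have h5 := tendsto_nhds_unique hlim tendsto_const_nhds
    rw [integral_ensemble]
    have h6 : ∀ lam : Fin N → ℝ, pullbackDeriv β α D F 0 lam =
        fderiv ℝ F lam (fun j => lam j * D (lam j) 0) + divergence β α D lam • F lam :=
        fun lam => by
      simp [pullbackDeriv, logRatio_zero, step_zero, logRatioDeriv_zero]
    simp only [h6] at h5
    rw [h5, smul_zero]
  · obtain ⟨C', hC', h'⟩ := one_add_pow_le_exp m (c := 1 / 4) (by norm_num)
    refine Integrable.norm (((integrable_exp_mul_jointWeight (N := N) hβ hα).const_mul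
      (C * C')).integrableOn.mono' ?_ ?_)
    · exact (measurable_jointWeight.smul ((((continuous_const.add continuous_total).pow
        m).const_smul C).measurable)).aestronglyMeasurable
    · filter_upwards [ae_restrict_mem isOpen_orthant.measurableSet] with lam hl
      have := total_nonneg lam hl
      rw [norm_smul, Real.norm_of_nonneg (jointWeight_nonneg _), ← mul_assoc, mul_comm,
        Real.norm_of_nonneg (by positivity)]
      refine mul_le_mul_of_nonneg_right ?_ (jointWeight_nonneg _)
      rw [mul_assoc]
      gcongr
      refine (h' _ (total_nonneg lam hl)).trans (le_of_eq ?_)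
      ring_nf
  · intro n
    filter_upwards [ae_restrict_mem isOpen_orthant.measurableSet] with lam hl
    have := total_nonneg lam hl
    rw [norm_smul, norm_smul (jointWeight β α N lam) (C * (1 + total lam) ^ m)]
    gcongr
    exact (hquot n lam hl).trans (le_abs_self _)
  · filter_upwards [ae_restrict_mem isOpen_orthant.measurableSet] with lam hl
    refine Tendsto.const_smul ?_ _
    have h1 := (hasDerivAt_pullback (β := β) (α := α) (ht₀ 0 h0) hF hl).tendsto_slope
    have h2 : Tendsto τ atTop (𝓝[≠] 0) :=
      hτlim.mono_right (nhdsWithin_mono _ fun x (hx : 0 < x) => hx.ne')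
    refine (h1.comp h2).congr fun n => ?_
    simp only [Function.comp_def, slope_def_module, sub_zero, hzero]

end

/-! ### The Dirichlet form and symmetric polynomials -/

section

variable {N : ℕ} {α β : ℝ}

lemma polyBdd_coord (l : Fin N) : PolyBdd (orthant N) total fun lam => lam l :=
  ⟨1, 1, by norm_num, fun lam h => by
    rw [Real.norm_of_nonneg (h l).le]
    linarith [coord_le_total h l]⟩

namespace IsTest

variable {E : Type*} [NormedAddCommGroup E] [NormedSpace ℝ E]

lemma const (c : E) : IsTest (N := N) fun _ => c where
  diff _ _ := differentiableAt_const _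
  bdd := PolyBdd.const c
  bdd_fderiv := (PolyBdd.const (0 : (Fin N → ℝ) →L[ℝ] E)).of_le fun lam _ => by
    rw [fderiv_const_apply]

lemma add {F G : (Fin N → ℝ) → E} (hF : IsTest F) (hG : IsTest G) :
    IsTest fun lam => F lam + G lam where
  diff lam h := (hF.diff lam h).add (hG.diff lam h)
  bdd := hF.bdd.add total_nonneg hG.bdd
  bdd_fderiv := (hF.bdd_fderiv.add total_nonneg hG.bdd_fderiv).of_le fun lam h => by
    rw [fderiv_fun_add (hF.diff lam h) (hG.diff lam h)]

lemma mul {F G : (Fin N → ℝ) → ℝ} (hF : IsTest F) (hG : IsTest G) :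
    IsTest fun lam => F lam * G lam where
  diff lam h := (hF.diff lam h).mul (hG.diff lam h)
  bdd := hF.bdd.mul hG.bdd
  bdd_fderiv := ((hF.bdd.smul hG.bdd_fderiv).add total_nonneg
    (hG.bdd.smul hF.bdd_fderiv)).of_le fun lam h => by
      rw [fderiv_fun_mul (hF.diff lam h) (hG.diff lam h)]

lemma const_mul {F : (Fin N → ℝ) → ℝ} (c : ℝ) (hF : IsTest F) : IsTest fun lam => c * F lam :=
  (const c).mul hF

lemma sub {F G : (Fin N → ℝ) → ℝ} (hF : IsTest F) (hG : IsTest G) :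
    IsTest fun lam => F lam - G lam := by
  simpa [sub_eq_add_neg] using hF.add (hG.const_mul (-1))

lemma sum {ι : Type*} (s : Finset ι) {F : ι → (Fin N → ℝ) → E} (hF : ∀ i ∈ s, IsTest (F i)) :
    IsTest fun lam => ∑ i ∈ s, F i lam := by
  classical
  induction s using Finset.induction_on with
  | empty => simpa using const (N := N) (0 : E)
  | insert a s ha ih =>
    simp only [Finset.sum_insert ha]
    exact (hF a (by simp)).add (ih fun i hi => hF i (by simp [hi]))

lemma aestronglyMeasurable {F : (Fin N → ℝ) → E} (hF : IsTest F) :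
    AEStronglyMeasurable F (ensemble β α N) := by
  rw [← Measure.restrict_eq_self_of_ae_mem (ensemble_ae_mem_orthant (β := β) (α := α))]
  exact hF.continuousOn.aestronglyMeasurable isOpen_orthant.measurableSet

lemma integrable (hβ : 0 ≤ β) (hα : -1 < α) {F : (Fin N → ℝ) → E} (hF : IsTest F) :
    Integrable F (ensemble β α N) :=
  integrable_of_polyBdd hβ hα hF.aestronglyMeasurable hF.bdd

lemma memLp (hβ : 0 ≤ β) (hα : -1 < α) {F : (Fin N → ℝ) → ℝ} (hF : IsTest F) :
    MemLp F 2 (ensemble β α N) := by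
  rw [memLp_two_iff_integrable_sq hF.aestronglyMeasurable]
  simpa [sq] using (hF.mul hF).integrable hβ hα

/-- A differentiable function of one coordinate. -/
lemma comp_coord {f f' : ℝ → E} (hf : ∀ x, 0 < x → HasDerivAt f (f' x) x) (l : Fin N)
    (h0 : PolyBdd (orthant N) total fun lam => f (lam l))
    (h1 : PolyBdd (orthant N) total fun lam => f' (lam l)) :
    IsTest fun lam : Fin N → ℝ => f (lam l) where
  diff lam h := (hf _ (h l)).differentiableAt.comp lam (differentiableAt_apply l lam)
  bdd := h0
  bdd_fderiv := h1.of_le fun lam h => by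
    have h2 := ((hf _ (h l)).hasFDerivAt.comp lam (hasFDerivAt_apply (𝕜 := ℝ) l lam)).fderiv
    have h3 : fderiv ℝ (fun lam : Fin N → ℝ => f (lam l)) lam = _ := h2
    rw [h3]
    refine ContinuousLinearMap.opNorm_le_bound _ (norm_nonneg _) fun v => ?_
    simp only [ContinuousLinearMap.comp_apply, ContinuousLinearMap.proj_apply,
      ContinuousLinearMap.toSpanSingleton_apply, norm_smul]
    rw [mul_comm]
    gcongr
    exact norm_le_pi_norm v l

end IsTest

/-- The carré du champ `∑ⱼ λⱼ ∂ⱼF ∂ⱼG` of the Laguerre diffusion. -/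
def carre (F G : (Fin N → ℝ) → ℝ) (lam : Fin N → ℝ) : ℝ :=
  ∑ j, lam j * (fderiv ℝ F lam (Pi.single j 1) * fderiv ℝ G lam (Pi.single j 1))

lemma carre_comm (F G : (Fin N → ℝ) → ℝ) (lam : Fin N → ℝ) : carre F G lam = carre G F lam := by
  simp only [carre, mul_comm (fderiv ℝ F lam _)]

lemma carre_self_nonneg (F : (Fin N → ℝ) → ℝ) {lam : Fin N → ℝ} (h : lam ∈ orthant N) :
    0 ≤ carre F F lam :=
  Finset.sum_nonneg fun j _ => mul_nonneg (h j).le (mul_self_nonneg _)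

lemma carre_add_right (H : (Fin N → ℝ) → ℝ) {F G : (Fin N → ℝ) → ℝ} {lam : Fin N → ℝ}
    (hF : DifferentiableAt ℝ F lam) (hG : DifferentiableAt ℝ G lam) :
    carre H (fun x => F x + G x) lam = carre H F lam + carre H G lam := by
  simp only [carre, fderiv_fun_add hF hG, ← Finset.sum_add_distrib]
  exact Finset.sum_congr rfl fun j _ => by simp; ring

lemma carre_const_mul_right (H : (Fin N → ℝ) → ℝ) {F : (Fin N → ℝ) → ℝ} (c : ℝ)
    {lam : Fin N → ℝ} (hF : DifferentiableAt ℝ F lam) :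
    carre H (fun x => c * F x) lam = c * carre H F lam := by
  simp only [carre, fderiv_const_mul hF, Finset.mul_sum]
  exact Finset.sum_congr rfl fun j _ => by simp; ring

lemma carre_mul_right (H : (Fin N → ℝ) → ℝ) {F G : (Fin N → ℝ) → ℝ} {lam : Fin N → ℝ}
    (hF : DifferentiableAt ℝ F lam) (hG : DifferentiableAt ℝ G lam) :
    carre H (fun x => F x * G x) lam = F lam * carre H G lam + G lam * carre H F lam := by
  simp only [carre, fderiv_fun_mul hF hG, Finset.mul_sum, ← Finset.sum_add_distrib]
  exact Finset.sum_congr rfl fun j _ => by simp; ring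

lemma carre_mul_left (H : (Fin N → ℝ) → ℝ) {F G : (Fin N → ℝ) → ℝ} {lam : Fin N → ℝ}
    (hF : DifferentiableAt ℝ F lam) (hG : DifferentiableAt ℝ G lam) :
    carre (fun x => F x * G x) H lam = F lam * carre G H lam + G lam * carre F H lam := by
  rw [carre_comm, carre_mul_right H hF hG, carre_comm H G, carre_comm H F]

lemma carre_const_right (H : (Fin N → ℝ) → ℝ) (c : ℝ) (lam : Fin N → ℝ) :
    carre H (fun _ => c) lam = 0 := by
  simp [carre]

lemma IsTest.polyBdd_carre {F G : (Fin N → ℝ) → ℝ} (hF : IsTest F) (hG : IsTest G) :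
    PolyBdd (orthant N) total (carre F G) := by
  have h : ∀ {H : (Fin N → ℝ) → ℝ}, IsTest H → ∀ j : Fin N,
      PolyBdd (orthant N) total fun lam => fderiv ℝ H lam (Pi.single j 1) := by
    intro H hH j
    have h1 : PolyBdd (orthant N) total fun lam =>
        ‖fderiv ℝ H lam‖ * ‖(Pi.single j (1 : ℝ) : Fin N → ℝ)‖ :=
      PolyBdd.mul (hH.bdd_fderiv.of_le fun _ _ => by simp) (PolyBdd.const _)
    refine h1.of_le fun lam _ => ?_
    rw [Real.norm_of_nonneg (by positivity : 0 ≤ ‖fderiv ℝ H lam‖ * _)]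
    exact ContinuousLinearMap.le_opNorm _ _
  unfold carre
  exact PolyBdd.sum total_nonneg _ fun j _ => (polyBdd_coord j).mul ((h hF j).mul (h hG j))

lemma measurable_carre (F G : (Fin N → ℝ) → ℝ) : Measurable (carre F G) := by
  unfold carre
  exact Finset.measurable_fun_sum _ fun j _ => (measurable_pi_apply j).mul
      ((measurable_fderiv_apply_const ℝ F _).mul (measurable_fderiv_apply_const ℝ G _))

lemma IsTest.integrable_carre (hβ : 0 ≤ β) (hα : -1 < α) {F G : (Fin N → ℝ) → ℝ}
    (hF : IsTest F) (hG : IsTest G) : Integrable (carre F G) (ensemble β α N) :=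
  integrable_of_polyBdd hβ hα (measurable_carre F G).aestronglyMeasurable (hF.polyBdd_carre hG)

/-- The power sum `∑ⱼ λⱼ ^ k`. -/
def psum (k : ℕ) (lam : Fin N → ℝ) : ℝ := ∑ j, lam j ^ k

lemma differentiable_psum (k : ℕ) : Differentiable ℝ (psum (N := N) k) := by
  unfold psum; fun_prop

lemma fderiv_psum (k : ℕ) (lam : Fin N → ℝ) (j : Fin N) :
    fderiv ℝ (psum k) lam (Pi.single j 1) = k * lam j ^ (k - 1) := by
  have h : HasFDerivAt (psum (N := N) k) (∑ i, (k * lam i ^ (k - 1)) •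
      (ContinuousLinearMap.proj (R := ℝ) (φ := fun _ : Fin N => ℝ) i)) lam := by
    unfold psum
    refine HasFDerivAt.fun_sum fun i _ => ?_
    simpa using (hasFDerivAt_apply (𝕜 := ℝ) i lam).pow k
  rw [h.fderiv]
  simp [Pi.single_apply]

lemma isTest_psum (k : ℕ) : IsTest (psum (N := N) k) := by
  unfold psum
  refine IsTest.sum _ fun l _ => IsTest.comp_coord (f := fun x => x ^ k)
    (f' := fun x => k * x ^ (k - 1)) (fun x _ => hasDerivAt_pow k x) l
    ((polyBdd_coord l).pow k) ((PolyBdd.const _).mul ((polyBdd_coord l).pow _))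

lemma carre_psum_psum {k l : ℕ} (hk : 0 < k) (hl : 0 < l) (lam : Fin N → ℝ) :
    carre (psum k) (psum l) lam = (k * l : ℝ) * psum (k + l - 1) lam := by
  simp only [carre, fderiv_psum, psum, Finset.mul_sum]
  refine Finset.sum_congr rfl fun j _ => ?_
  obtain ⟨k, rfl⟩ := Nat.exists_eq_succ_of_ne_zero hk.ne'
  obtain ⟨l, rfl⟩ := Nat.exists_eq_succ_of_ne_zero hl.ne'
  have : k.succ + l.succ - 1 = k + l + 1 := by omega
  rw [this, Nat.succ_sub_one, Nat.succ_sub_one]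
  ring

/-- The divided difference of the field `x ↦ x ^ k`. -/
def powField (k : ℕ) (x y : ℝ) : ℝ := ∑ i ∈ Finset.range k, x ^ i * y ^ (k - 1 - i)

lemma powField_zero {k : ℕ} (hk : 0 < k) (x : ℝ) : powField k x 0 = x ^ (k - 1) := by
  unfold powField
  rw [Finset.sum_eq_single (k - 1)]
  · simp
  · intro i hi hne
    have : k - 1 - i ≠ 0 := by have := Finset.mem_range.1 hi; omega
    simp [this]
  · intro h
    exact absurd (Finset.mem_range.2 (by omega)) h

lemma powField_self (k : ℕ) (x : ℝ) : powField k x x = k * x ^ (k - 1) := by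
  unfold powField
  rw [Finset.sum_congr rfl fun i hi => by
    rw [← pow_add, show i + (k - 1 - i) = k - 1 by have := Finset.mem_range.1 hi; omega]]
  simp

lemma isField_powField {k : ℕ} (hk : 0 < k) : IsField (powField k) where
  cont := by unfold powField; fun_prop
  diff x y _ _ := by
    have h : ∀ x : ℝ, x * x ^ (k - 1) = x ^ k := fun x => by
      rw [← pow_succ', Nat.sub_add_cancel hk]
    rw [powField_zero hk, powField_zero hk, h, h, powField, mul_comm,
      (Commute.all x y).geom_sum₂_mul]
  bdd := by
    refine ⟨k, k - 1, by positivity, fun x y hx hy => ?_⟩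
    unfold powField
    refine (Finset.abs_sum_le_sum_abs _ _).trans ?_
    have : ∀ i ∈ Finset.range k, |x ^ i * y ^ (k - 1 - i)| ≤ (1 + (x + y)) ^ (k - 1) := by
      intro i hi
      have hi' : i + (k - 1 - i) = k - 1 := by have := Finset.mem_range.1 hi; omega
      rw [abs_of_nonneg (by positivity), ← hi', pow_add]
      rw [hi']
      gcongr <;> linarith
    refine (Finset.sum_le_sum this).trans (by simp)
  lower := by
    refine ⟨0, le_rfl, fun x y hx hy => ⟨?_, ?_⟩⟩
    · unfold powField
      simp only [neg_zero]
      exact Finset.sum_nonneg fun i _ => by positivity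
    · rw [powField_zero hk]
      simp only [neg_zero]
      positivity

/-- Integration by parts says that `u` is the image of `f` under the generator of the Laguerre
diffusion: the Dirichlet form of `F` and `f` is `-∫ F u`. -/
def IsGen (β α : ℝ) (f u : (Fin N → ℝ) → ℝ) : Prop :=
  ∀ F : (Fin N → ℝ) → ℝ, IsTest F →
    ∫ lam, carre F f lam ∂ensemble β α N = -∫ lam, F lam * u lam ∂ensemble β α N

lemma fderiv_eq_sum {E : Type*} [NormedAddCommGroup E] [NormedSpace ℝ E] (F : (Fin N → ℝ) → E)
    (lam v : Fin N → ℝ) :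
    fderiv ℝ F lam v = ∑ j, v j • fderiv ℝ F lam (Pi.single j 1) := by
  conv_lhs => rw [← Finset.univ_sum_single v]
  rw [map_sum]
  refine Finset.sum_congr rfl fun j _ => ?_
  rw [← map_smul, ← Pi.single_smul', smul_eq_mul, mul_one]

lemma sum_sum_Ioi_eq (f : Fin N → Fin N → ℝ) (hf : ∀ j k, f j k = f k j) :
    2 * ∑ j, ∑ k ∈ Finset.Ioi j, f k j = ∑ j, ∑ k, f j k - ∑ j, f j j := by
  have h1 : ∑ j, ∑ k ∈ Finset.Iio j, f k j = ∑ j, ∑ k ∈ Finset.Ioi j, f k j := by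
    rw [Finset.sum_comm' (t' := Finset.univ) (s' := fun k => Finset.Ioi k) (by simp)]
    exact Finset.sum_congr rfl fun j _ => Finset.sum_congr rfl fun k _ => hf _ _
  have h2 : ∀ j, ∑ k, f j k = ∑ k ∈ Finset.Iio j, f k j + f j j + ∑ k ∈ Finset.Ioi j, f k j := by
    intro j
    have h3 : (Finset.univ : Finset (Fin N)) = (Finset.Iio j ∪ {j}) ∪ Finset.Ioi j := by
      ext k
      simp only [Finset.mem_univ, Finset.mem_union, Finset.mem_Iio, Finset.mem_singleton,
        Finset.mem_Ioi, true_iff]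
      rcases lt_trichotomy k j with h | h | h <;> simp [h]
    rw [h3, Finset.sum_union, Finset.sum_union]
    · simp [hf j]
    · simp
    · rw [Finset.disjoint_left]
      intro k hk
      simp only [Finset.mem_union, Finset.mem_Iio, Finset.mem_singleton] at hk
      simp only [Finset.mem_Ioi, not_lt]
      rcases hk with h | h
      · exact h.le
      · exact h.le
  rw [Finset.sum_congr rfl fun j _ => h2 j, Finset.sum_add_distrib, Finset.sum_add_distrib, h1]
  ring

/-- For a symmetric divided difference the sum over pairs is half of a full double sum minus the
diagonal, which turns the Jacobian term into `(1 - β / 2) ∑ D(λ, λ)`. -/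
lemma divergence_symm {D : ℝ → ℝ → ℝ} (hD : ∀ x y, D x y = D y x) (lam : Fin N → ℝ) :
    divergence β α D lam = ∑ l, (α * D (lam l) 0 - lam l * D (lam l) 0) +
      (1 - β / 2) * ∑ l, D (lam l) (lam l) + β / 2 * ∑ j, ∑ k, D (lam j) (lam k) := by
  have h := sum_sum_Ioi_eq (fun j k => D (lam j) (lam k)) fun j k => hD _ _
  unfold divergence
  rw [Finset.sum_add_distrib]
  linear_combination β / 2 * h

lemma powField_symm (k : ℕ) (x y : ℝ) : powField k x y = powField k y x := by
  unfold powField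
  rw [← Finset.sum_range_reflect]
  refine Finset.sum_congr rfl fun i hi => ?_
  have h : k - 1 - (k - 1 - i) = i := by have := Finset.mem_range.1 hi; omega
  rw [h, mul_comm]

/-- The divergence of the field `x ^ k` is `-p_k` plus terms of degree `k - 1` in power sums. -/
lemma divergence_powField {k : ℕ} (hk : 0 < k) (lam : Fin N → ℝ) :
    divergence β α (powField k) lam = (α + (1 - β / 2) * k) * psum (k - 1) lam - psum k lam +
      β / 2 * ∑ i ∈ Finset.range k, psum i lam * psum (k - 1 - i) lam := by
  rw [divergence_symm (powField_symm k)]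
  have h1 : ∑ j, ∑ l, powField k (lam j) (lam l) =
      ∑ i ∈ Finset.range k, psum i lam * psum (k - 1 - i) lam := by
    simp only [powField, psum, Finset.sum_mul_sum]
    rw [Finset.sum_comm]
    rw [Finset.sum_congr rfl fun j _ => Finset.sum_comm, Finset.sum_comm]
    exact Finset.sum_congr rfl fun i _ => Finset.sum_comm
  rw [h1]
  have h2 : ∀ l, lam l * lam l ^ (k - 1) = lam l ^ k := fun l => by
    rw [← pow_succ', Nat.sub_add_cancel hk]
  simp only [powField_zero hk, powField_self, h2, Finset.sum_sub_distrib, ← Finset.mul_sum]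
  simp only [psum]
  ring

lemma isGen_psum (hβ : 0 ≤ β) (hα : -1 < α) {k : ℕ} (hk : 0 < k) :
    IsGen β α (psum (N := N) k) fun lam => k * divergence β α (powField k) lam := by
  intro F hF
  have h := (isField_powField hk).integral_divergence (N := N) hβ hα hF
  have h1 : ∀ lam : Fin N → ℝ, carre F (psum k) lam =
      k * fderiv ℝ F lam (fun j => lam j * powField k (lam j) 0) := by
    intro lam
    rw [fderiv_eq_sum, carre, Finset.mul_sum]
    refine Finset.sum_congr rfl fun j _ => ?_
    rw [fderiv_psum, powField_zero hk, smul_eq_mul]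
    ring
  have hdiv : IsTest (divergence (N := N) β α (powField k)) := by
    have h2 : divergence (N := N) β α (powField k) = fun lam =>
      (α + (1 - β / 2) * k) * psum (k - 1) lam - psum k lam +
      β / 2 * ∑ i ∈ Finset.range k, psum i lam * psum (k - 1 - i) lam :=
      funext fun lam => divergence_powField hk lam
    rw [h2]
    exact (((isTest_psum _).const_mul _).sub (isTest_psum k)).add
      ((IsTest.sum _ fun i _ => (isTest_psum i).mul (isTest_psum _)).const_mul _)
  have h2 : Integrable (fun lam => divergence β α (powField k) lam • F lam) (ensemble β α N) :=
    (hdiv.mul hF).integrable hβ hα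
  have h3 : Integrable (fun lam => fderiv ℝ F lam (fun j => lam j * powField k (lam j) 0))
      (ensemble β α N) := by
    have h4 := (hF.integrable_carre hβ hα (isTest_psum k)).const_mul (k : ℝ)⁻¹
    refine h4.congr (Eventually.of_forall fun lam => ?_)
    have : (k : ℝ) ≠ 0 := by positivity
    simp only [h1]
    field_simp
  rw [integral_add h3 h2] at h
  simp only [h1]
  rw [integral_const_mul, eq_neg_of_add_eq_zero_left h, mul_neg, ← integral_const_mul]
  congr 1
  exact integral_congr_ae (Eventually.of_forall fun lam => by simp only [smul_eq_mul]; ring)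

/-- The product rule for the generator, with the carré du champ as the cross term. -/
lemma IsGen.mul (hβ : 0 ≤ β) (hα : -1 < α) {f g u v : (Fin N → ℝ) → ℝ} (hf : IsTest f)
    (hg : IsTest g) (hu : IsTest u) (hv : IsTest v)
    (hfu : IsGen β α f u) (hgv : IsGen β α g v) :
    IsGen β α (fun lam => f lam * g lam)
      (fun lam => f lam * v lam + g lam * u lam + 2 * carre f g lam) := by
  intro F hF
  have h1 := hfu (fun lam => g lam * F lam) (hg.mul hF)
  have h2 := hgv (fun lam => f lam * F lam) (hf.mul hF)
  have i1 : Integrable (fun lam => F lam * carre f g lam) (ensemble β α N) :=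
    integrable_of_polyBdd hβ hα (hF.aestronglyMeasurable.mul
      (measurable_carre f g).aestronglyMeasurable) (hF.bdd.mul (hf.polyBdd_carre hg))
  have i2 := (hg.mul hF).integrable_carre (β := β) hβ hα hf
  have i3 := (hf.mul hF).integrable_carre (β := β) hβ hα hg
  have i4 := ((hf.mul hF).mul hv).integrable (β := β) hβ hα
  have i5 := ((hg.mul hF).mul hu).integrable (β := β) hβ hα
  have e1 : ∫ lam, carre F (fun lam => f lam * g lam) lam ∂ensemble β α N =
      ∫ lam, (carre (fun lam => g lam * F lam) f lam + carre (fun lam => f lam * F lam) g lam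
        - 2 * (F lam * carre f g lam)) ∂ensemble β α N := by
    refine integral_congr_ae ?_
    filter_upwards [ensemble_ae_mem_orthant] with lam hl
    have df := hf.diff lam hl
    have dg := hg.diff lam hl
    have dF := hF.diff lam hl
    rw [carre_mul_right F df dg, carre_mul_left f dg dF, carre_mul_left g df dF, carre_comm g f]
    ring
  have e2 : ∫ lam, F lam * (f lam * v lam + g lam * u lam + 2 * carre f g lam) ∂ensemble β α N =
      ∫ lam, (f lam * F lam * v lam + g lam * F lam * u lam + 2 * (F lam * carre f g lam))
        ∂ensemble β α N :=
    integral_congr_ae (Eventually.of_forall fun lam => by ring)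
  have i23 : Integrable (fun lam => carre (fun lam => g lam * F lam) f lam +
      carre (fun lam => f lam * F lam) g lam) (ensemble β α N) := i2.add i3
  have i45 : Integrable (fun lam => f lam * F lam * v lam + g lam * F lam * u lam)
      (ensemble β α N) := i4.add i5
  rw [e1, e2, integral_sub i23 (i1.const_mul 2), integral_add i2 i3,
    integral_add i45 (i1.const_mul 2), integral_add i4 i5, integral_const_mul, h1, h2]
  ring

end

/-! ### The Poincaré inequality on symmetric polynomials -/

section

variable {N : ℕ} {α β : ℝ}

/-- The product of power sums indexed by the multiset `s`. -/
def psumProd (s : Multiset ℕ) (lam : Fin N → ℝ) : ℝ := (s.map fun k => psum k lam).prod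

/-- The symmetric polynomials of degree `< n`, as the span of products of power sums. The strict
inequality makes the space trivial for `n = 0`. -/
def symPoly (N n : ℕ) : Submodule ℝ ((Fin N → ℝ) → ℝ) :=
  Submodule.span ℝ {f | ∃ s : Multiset ℕ, (∀ k ∈ s, 0 < k) ∧ s.sum < n ∧ f = psumProd s}

lemma psumProd_mem {s : Multiset ℕ} (hs : ∀ k ∈ s, 0 < k) {n : ℕ} (hn : s.sum < n) :
    psumProd s ∈ symPoly N n :=
  Submodule.subset_span ⟨s, hs, hn, rfl⟩

lemma symPoly_mono {m n : ℕ} (h : m ≤ n) : symPoly N m ≤ symPoly N n :=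
  Submodule.span_mono fun _ ⟨s, hs, hn, hf⟩ => ⟨s, hs, hn.trans_le h, hf⟩

instance finiteDimensional_symPoly (n : ℕ) : FiniteDimensional ℝ (symPoly N n) := by
  refine FiniteDimensional.span_of_finite ℝ ?_
  refine (Set.finite_range fun p : Σ m : Fin n, Nat.Partition m =>
    psumProd (N := N) p.2.parts).subset ?_
  rintro _ ⟨s, hs, hn, rfl⟩
  exact ⟨⟨⟨s.sum, hn⟩, ⟨s, fun {i} hi => hs i hi, rfl⟩⟩, rfl⟩

lemma mul_mem_symPoly {m n : ℕ} {f g : (Fin N → ℝ) → ℝ} (hf : f ∈ symPoly N (m + 1))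
    (hg : g ∈ symPoly N n) : f * g ∈ symPoly N (m + n) := by
  have h : symPoly N (m + 1) * symPoly N n ≤ symPoly N (m + n) := by
    unfold symPoly
    rw [Submodule.span_mul_span]
    refine Submodule.span_mono ?_
    rintro _ ⟨_, ⟨s, hs, hsn, rfl⟩, _, ⟨t, ht, htn, rfl⟩, rfl⟩
    refine ⟨s + t, fun k hk => ?_, ?_, ?_⟩
    · rcases Multiset.mem_add.1 hk with h | h
      exacts [hs k h, ht k h]
    · rw [Multiset.sum_add]; omega
    · funext lam
      simp [psumProd]
  exact h (Submodule.mul_mem_mul hf hg)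

lemma const_mem_symPoly (c : ℝ) {n : ℕ} (hn : 0 < n) : (fun _ => c) ∈ symPoly N n := by
  have h : (psumProd 0 : (Fin N → ℝ) → ℝ) ∈ symPoly N n := psumProd_mem (by simp) (by simpa)
  have h2 := Submodule.smul_mem _ c h
  convert h2 using 1
  funext lam
  simp [psumProd]

lemma psum_mem_symPoly {k n : ℕ} (h : k < n) : psum k ∈ symPoly N n := by
  rcases Nat.eq_zero_or_pos k with rfl | hk
  · convert const_mem_symPoly (N := N) (N : ℝ) h using 1
    funext lam
    simp [psum]
  · convert psumProd_mem (N := N) (s := {k}) (by simpa using hk) (by simpa using h) using 1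
    funext lam
    simp [psumProd]

lemma psumProd_cons (k : ℕ) (s : Multiset ℕ) :
    (psumProd (k ::ₘ s) : (Fin N → ℝ) → ℝ) = fun lam => psum k lam * psumProd s lam := by
  funext lam
  simp [psumProd]

lemma psumProd_zero : (psumProd 0 : (Fin N → ℝ) → ℝ) = fun _ => 1 := by
  funext lam
  simp [psumProd]

lemma isTest_psumProd (s : Multiset ℕ) : IsTest (psumProd (N := N) s) := by
  induction s using Multiset.induction_on with
  | empty => rw [psumProd_zero]; exact IsTest.const _
  | cons k s ih => rw [psumProd_cons]; exact (isTest_psum k).mul ih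

lemma differentiable_psumProd (s : Multiset ℕ) : Differentiable ℝ (psumProd (N := N) s) := by
  induction s using Multiset.induction_on with
  | empty => rw [psumProd_zero]; exact differentiable_const _
  | cons k s ih => rw [psumProd_cons]; exact (differentiable_psum k).mul ih

lemma isTest_of_mem_symPoly {n : ℕ} {f : (Fin N → ℝ) → ℝ} (hf : f ∈ symPoly N n) :
    IsTest f := by
  induction hf using Submodule.span_induction with
  | mem f h => obtain ⟨s, -, -, rfl⟩ := h; exact isTest_psumProd s
  | zero => exact IsTest.const _
  | add f g _ _ hf hg => exact hf.add hg
  | smul c f _ hf => exact hf.const_mul c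

lemma carre_psum_psumProd_mem {k : ℕ} (hk : 0 < k) (s : Multiset ℕ) (hs : ∀ k ∈ s, 0 < k) :
    carre (psum k) (psumProd s) ∈ symPoly N (k + s.sum) := by
  induction s using Multiset.induction_on with
  | empty =>
    rw [psumProd_zero]
    have : carre (psum (N := N) k) (fun _ => 1) = 0 := funext fun lam => carre_const_right _ _ _
    rw [this]
    exact Submodule.zero_mem _
  | cons l s ih =>
    have hl : 0 < l := hs l (by simp)
    have hs' : ∀ k ∈ s, 0 < k := fun k hk => hs k (by simp [hk])
    have : carre (psum (N := N) k) (psumProd (l ::ₘ s)) =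
        psum l * carre (psum k) (psumProd s) + (k * l : ℝ) • (psum (k + l - 1) * psumProd s) := by
      funext lam
      rw [psumProd_cons, carre_mul_right _ (differentiable_psum l _) (differentiable_psumProd s _),
        carre_psum_psum hk hl]
      simp only [Pi.add_apply, Pi.mul_apply, Pi.smul_apply, smul_eq_mul]
      ring
    rw [this, Multiset.sum_cons]
    refine Submodule.add_mem _ ?_ (Submodule.smul_mem _ _ ?_)
    · have h3 := mul_mem_symPoly (psum_mem_symPoly (Nat.lt_succ_self l)) (ih hs')
      rwa [show l + (k + s.sum) = k + (l + s.sum) by omega] at h3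
    · have h1 : psumProd s ∈ symPoly N (s.sum + 1) := psumProd_mem hs' (Nat.lt_succ_self _)
      have h2 : psum (k + l - 1) ∈ symPoly N (k + l - 1 + 1) :=
        psum_mem_symPoly (Nat.lt_succ_self _)
      have h3 := mul_mem_symPoly h2 h1
      rwa [show k + l - 1 + (s.sum + 1) = k + (l + s.sum) by omega] at h3

lemma IsGen.add {f g u v : (Fin N → ℝ) → ℝ} (hβ : 0 ≤ β) (hα : -1 < α) (hf : IsTest f)
    (hg : IsTest g) (hu : IsTest u) (hv : IsTest v) (hfu : IsGen β α f u) (hgv : IsGen β α g v) :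
    IsGen β α (fun lam => f lam + g lam) fun lam => u lam + v lam := by
  intro F hF
  have e1 : ∫ lam, carre F (fun lam => f lam + g lam) lam ∂ensemble β α N =
      ∫ lam, (carre F f lam + carre F g lam) ∂ensemble β α N := by
    refine integral_congr_ae ?_
    filter_upwards [ensemble_ae_mem_orthant] with lam hl
    rw [carre_add_right F (hf.diff lam hl) (hg.diff lam hl)]
  rw [e1, integral_add (hF.integrable_carre hβ hα hf) (hF.integrable_carre hβ hα hg), hfu F hF,
    hgv F hF]
  simp only [mul_add]
  rw [integral_add ((hF.mul hu).integrable hβ hα) ((hF.mul hv).integrable hβ hα)]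
  ring

lemma IsGen.const_mul {f u : (Fin N → ℝ) → ℝ} (c : ℝ) (hf : IsTest f)
    (hfu : IsGen β α f u) : IsGen β α (fun lam => c * f lam) fun lam => c * u lam := by
  intro F hF
  have e1 : ∫ lam, carre F (fun lam => c * f lam) lam ∂ensemble β α N =
      ∫ lam, c * carre F f lam ∂ensemble β α N := by
    refine integral_congr_ae ?_
    filter_upwards [ensemble_ae_mem_orthant] with lam hl
    rw [carre_const_mul_right F c (hf.diff lam hl)]
  rw [e1, integral_const_mul, hfu F hF]
  simp only [mul_left_comm _ c]
  rw [integral_const_mul]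
  ring

lemma isGen_const (c : ℝ) : IsGen (N := N) β α (fun _ => c) 0 := by
  intro F _
  simp [carre_const_right]

lemma exists_isGen_psum (hβ : 0 ≤ β) (hα : -1 < α) {k : ℕ} (hk : 0 < k) :
    ∃ u : (Fin N → ℝ) → ℝ, IsGen β α (psum k) u ∧ u + (k : ℝ) • psum k ∈ symPoly N k := by
  refine ⟨_, isGen_psum hβ hα hk, ?_⟩
  have h : (fun lam => k * divergence β α (powField k) lam) + (k : ℝ) • psum (N := N) k =
      (k : ℝ) • ((α + (1 - β / 2) * k) • psum (k - 1) +
        (β / 2) • ∑ i ∈ Finset.range k, psum i * psum (k - 1 - i)) := by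
    funext lam
    simp only [divergence_powField hk, Pi.add_apply, Pi.smul_apply, smul_eq_mul, Finset.sum_apply,
      Pi.mul_apply]
    ring
  rw [h]
  refine Submodule.smul_mem _ _ (Submodule.add_mem _ (Submodule.smul_mem _ _
    (psum_mem_symPoly (by omega))) (Submodule.smul_mem _ _ (Submodule.sum_mem _ fun i hi => ?_)))
  have hi' := Finset.mem_range.1 hi
  have h2 := mul_mem_symPoly (psum_mem_symPoly (N := N) (Nat.lt_succ_self i))
    (psum_mem_symPoly (N := N) (Nat.lt_succ_self (k - 1 - i)))
  rwa [show i + (k - 1 - i).succ = k by omega] at h2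

/-- The generator acts triangularly on products of power sums, with the degree as diagonal entry. -/
lemma exists_isGen_psumProd (hβ : 0 ≤ β) (hα : -1 < α) (s : Multiset ℕ) (hs : ∀ k ∈ s, 0 < k) :
    ∃ u : (Fin N → ℝ) → ℝ, IsGen β α (psumProd s) u ∧
      u + (s.sum : ℝ) • psumProd s ∈ symPoly N s.sum := by
  induction s using Multiset.induction_on with
  | empty =>
    refine ⟨0, ?_, by simp⟩
    rw [psumProd_zero]
    exact isGen_const 1
  | cons k s ih =>
    have hk : 0 < k := hs k (by simp)
    have hs' : ∀ k ∈ s, 0 < k := fun k hk => hs k (by simp [hk])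
    obtain ⟨v, hv, hvm⟩ := ih hs'
    obtain ⟨u, hu, hum⟩ := exists_isGen_psum (N := N) hβ hα hk
    have hp := psum_mem_symPoly (N := N) (Nat.lt_succ_self k)
    have hq : psumProd s ∈ symPoly N (s.sum + 1) := psumProd_mem hs' (Nat.lt_succ_self _)
    have hut : IsTest u := by
      have h := (isTest_of_mem_symPoly hum).sub ((isTest_psum k).const_mul k)
      convert h using 2
      simp
    have hvt : IsTest v := by
      have h := (isTest_of_mem_symPoly hvm).sub ((isTest_psumProd s).const_mul s.sum)
      convert h using 2
      simp
    refine ⟨fun lam => psum k lam * v lam + psumProd s lam * u lam +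
      2 * carre (psum k) (psumProd s) lam, ?_, ?_⟩
    · rw [psumProd_cons]
      exact IsGen.mul hβ hα (isTest_psum k) (isTest_psumProd s) hut hvt hu hv
    · have h : (fun lam => psum k lam * v lam + psumProd s lam * u lam +
          2 * carre (psum k) (psumProd s) lam) + ((k ::ₘ s).sum : ℝ) • psumProd (N := N) (k ::ₘ s) =
          psum k * (v + (s.sum : ℝ) • psumProd s) + psumProd s * (u + (k : ℝ) • psum k) +
          (2 : ℝ) • carre (psum k) (psumProd s) := by
        funext lam
        simp only [psumProd_cons, Pi.add_apply, Pi.smul_apply, Pi.mul_apply, smul_eq_mul,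
          Multiset.sum_cons, Nat.cast_add]
        ring
      rw [h, Multiset.sum_cons]
      refine Submodule.add_mem _ (Submodule.add_mem _ (mul_mem_symPoly hp hvm) ?_)
        (Submodule.smul_mem _ _ (carre_psum_psumProd_mem hk s hs'))
      rw [add_comm k]
      exact mul_mem_symPoly hq hum

/-- On symmetric polynomials of degree at most `n` the generator is `-n` modulo polynomials of
lower degree. -/
lemma exists_isGen (hβ : 0 ≤ β) (hα : -1 < α) {n : ℕ} {f : (Fin N → ℝ) → ℝ}
    (hf : f ∈ symPoly N (n + 1)) :
    ∃ u : (Fin N → ℝ) → ℝ, IsGen β α f u ∧ u + (n : ℝ) • f ∈ symPoly N n := by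
  have hut : ∀ {f u : (Fin N → ℝ) → ℝ}, IsTest f → u + (n : ℝ) • f ∈ symPoly N n → IsTest u := by
    intro f u hf h
    have h := (isTest_of_mem_symPoly h).sub (hf.const_mul n)
    convert h using 2
    simp
  induction hf using Submodule.span_induction with
  | mem f h =>
    obtain ⟨s, hs, hn, rfl⟩ := h
    obtain ⟨u, hu, hum⟩ := exists_isGen_psumProd (N := N) hβ hα s hs
    refine ⟨u, hu, ?_⟩
    have h : u + (n : ℝ) • psumProd s =
        (u + (s.sum : ℝ) • psumProd s) + ((n : ℝ) - s.sum) • psumProd s := by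
      rw [sub_smul]; abel
    rw [h]
    refine Submodule.add_mem _ (symPoly_mono (by omega) hum) ?_
    rcases Nat.lt_or_ge s.sum n with h1 | h1
    · exact Submodule.smul_mem _ _ (psumProd_mem hs h1)
    · rw [show s.sum = n by omega]
      simp
  | zero => exact ⟨0, isGen_const 0, by simp⟩
  | add f g hf hg hf' hg' =>
    obtain ⟨u, hu, hum⟩ := hf'
    obtain ⟨v, hv, hvm⟩ := hg'
    have tf := isTest_of_mem_symPoly hf
    have tg := isTest_of_mem_symPoly hg
    refine ⟨_, IsGen.add hβ hα tf tg (hut tf hum) (hut tg hvm) hu hv, ?_⟩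
    convert Submodule.add_mem _ hum hvm using 1
    funext lam
    simp
    ring
  | smul c f hf hf' =>
    obtain ⟨u, hu, hum⟩ := hf'
    refine ⟨_, IsGen.const_mul c (isTest_of_mem_symPoly hf) hu, ?_⟩
    convert Submodule.smul_mem _ c hum using 1
    funext lam
    simp
    ring

/-- Orthogonal projection onto a finite-dimensional space of test functions. -/
lemma exists_projection (hβ : 0 ≤ β) (hα : -1 < α) {K : Submodule ℝ ((Fin N → ℝ) → ℝ)}
    [FiniteDimensional ℝ K] (hK : ∀ f ∈ K, IsTest f) {F : (Fin N → ℝ) → ℝ} (hF : IsTest F) :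
    ∃ h ∈ K, ∀ v ∈ K, ∫ lam, (F lam - h lam) * v lam ∂ensemble β α N = 0 := by
  have hm : ∀ f : K, MemLp (f : (Fin N → ℝ) → ℝ) 2 (ensemble β α N) :=
    fun f => (hK f f.2).memLp hβ hα
  let T : K →ₗ[ℝ] Lp ℝ 2 (ensemble β α N) :=
    { toFun := fun f => (hm f).toLp
      map_add' := fun f g => rfl
      map_smul' := fun c f => rfl }
  let y := (hF.memLp hβ hα).toLp
  let R := LinearMap.range T
  have hfin : FiniteDimensional ℝ R := inferInstance
  obtain ⟨h, hh⟩ : ∃ h, T h = R.starProjection y := by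
    have := R.starProjection_apply_mem y
    exact this
  refine ⟨h, h.2, fun v hv => ?_⟩
  have h1 : inner ℝ (y - R.starProjection y) (T ⟨v, hv⟩) = 0 :=
    R.starProjection_inner_eq_zero y (T ⟨v, hv⟩) ⟨_, rfl⟩
  rw [← hh, L2.inner_def] at h1
  rw [← h1]
  refine integral_congr_ae ?_
  have e1 : y =ᵐ[ensemble β α N] F := (hF.memLp hβ hα).coeFn_toLp
  have e2 : T h =ᵐ[ensemble β α N] (h : (Fin N → ℝ) → ℝ) := (hm h).coeFn_toLp
  have e3 : T ⟨v, hv⟩ =ᵐ[ensemble β α N] v := (hm ⟨v, hv⟩).coeFn_toLp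
  filter_upwards [e1, e2, e3, Lp.coeFn_sub y (T h)] with lam h1 h2 h3 h4
  rw [h4, Pi.sub_apply, h1, h2, h3]
  simp [mul_comm]

/-- Pythagoras for the Dirichlet form. -/
lemma integral_carre_self_of_orthogonal (hβ : 0 ≤ β) (hα : -1 < α) {F h : (Fin N → ℝ) → ℝ}
    (hF : IsTest F) (th : IsTest h)
    (h0 : ∫ lam, carre (fun lam => F lam - h lam) h lam ∂ensemble β α N = 0) :
    ∫ lam, carre F F lam ∂ensemble β α N =
      ∫ lam, carre (fun lam => F lam - h lam) (fun lam => F lam - h lam) lam ∂ensemble β α N +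
        ∫ lam, carre h h lam ∂ensemble β α N := by
  set f : (Fin N → ℝ) → ℝ := fun lam => F lam - h lam with hf
  have tf : IsTest f := hF.sub th
  have h1 : ∫ lam, carre F F lam ∂ensemble β α N =
      ∫ lam, (carre f f lam + 2 * carre f h lam + carre h h lam) ∂ensemble β α N := by
    refine integral_congr_ae ?_
    filter_upwards [ensemble_ae_mem_orthant] with lam hl
    have df := tf.diff lam hl
    have dg := th.diff lam hl
    have hfg : F = fun lam => f lam + h lam := by funext lam; simp [hf]
    rw [hfg, carre_add_right _ df dg, carre_comm _ f, carre_comm _ h,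
      carre_add_right _ df dg, carre_add_right _ df dg, carre_comm h f]
    ring
  have i1 := tf.integrable_carre (β := β) hβ hα tf
  have i2 := (tf.integrable_carre (β := β) hβ hα th).const_mul 2
  have i12 : Integrable (fun lam => carre f f lam + 2 * carre f h lam) (ensemble β α N) :=
    i1.add i2
  rw [h1, integral_add i12 (th.integrable_carre hβ hα th), integral_add i1 i2,
    integral_const_mul, h0]
  ring

/-- The Poincaré inequality on symmetric polynomials. The component of degree exactly `n`, i.e.
the part orthogonal to lower degrees, is an eigenfunction of the generator with eigenvalue `-n`,
so the Dirichlet form dominates the variance degree by degree. -/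
lemma poincare_symPoly (hβ : 0 ≤ β) (hα : -1 < α) {n : ℕ} (hn : 1 ≤ n) :
    ∀ h ∈ symPoly N n, ∫ lam, h lam ^ 2 ∂ensemble β α N - (∫ lam, h lam ∂ensemble β α N) ^ 2 ≤
      ∫ lam, carre h h lam ∂ensemble β α N := by
  have := isProbabilityMeasure_ensemble (N := N) hβ hα
  induction n, hn using Nat.le_induction with
  | base =>
    intro h hh
    have hc : ∃ c : ℝ, h = fun _ => c := by
      induction hh using Submodule.span_induction with
      | mem f hf =>
        obtain ⟨s, hs, hn, rfl⟩ := hf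
        have h0 : s = 0 := by
          refine Multiset.eq_zero_of_forall_notMem fun k hk => ?_
          have h1 := hs k hk
          have h2 := Multiset.single_le_sum (by simp) k hk
          omega
        subst h0
        exact ⟨1, psumProd_zero⟩
      | zero => exact ⟨0, rfl⟩
      | add f g _ _ hf hg =>
        obtain ⟨c, rfl⟩ := hf
        obtain ⟨d, rfl⟩ := hg
        exact ⟨c + d, rfl⟩
      | smul c f _ hf =>
        obtain ⟨d, rfl⟩ := hf
        exact ⟨c * d, rfl⟩
    obtain ⟨c, rfl⟩ := hc
    simp [carre_const_right]
  | succ n hn ih =>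
    intro h hh
    have th := isTest_of_mem_symPoly hh
    obtain ⟨g, hg, hortho⟩ := exists_projection hβ hα
      (fun f hf => isTest_of_mem_symPoly (n := n) hf) th
    have tg := isTest_of_mem_symPoly hg
    set f : (Fin N → ℝ) → ℝ := fun lam => h lam - g lam with hf
    have tf : IsTest f := th.sub tg
    have hfm : f ∈ symPoly N (n + 1) :=
      Submodule.sub_mem _ hh (symPoly_mono (Nat.le_succ n) hg)
    obtain ⟨u, hu, hum⟩ := exists_isGen hβ hα hfm
    obtain ⟨v, hv, hvm⟩ := exists_isGen hβ hα (symPoly_mono (Nat.le_succ n) hg)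
    have hvm' : v ∈ symPoly N n := by
      have := Submodule.sub_mem _ hvm (Submodule.smul_mem _ (n : ℝ) hg)
      simpa using this
    -- `u + n f` has lower degree, so it is orthogonal to `f`
    have e1 : ∫ lam, carre f f lam ∂ensemble β α N = n * ∫ lam, f lam ^ 2 ∂ensemble β α N := by
      rw [hu f tf]
      have h0 := hortho _ hum
      have h1 : ∫ lam, (f lam * u lam + n * f lam ^ 2) ∂ensemble β α N = 0 := by
        rw [← h0]
        refine integral_congr_ae (Eventually.of_forall fun lam => ?_)
        simp only [Pi.add_apply, Pi.smul_apply, smul_eq_mul, hf]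
        ring
      have tu : IsTest u := by
        have h := (isTest_of_mem_symPoly hum).sub (tf.const_mul n)
        convert h using 2
        simp
      have i2 : Integrable (fun lam => f lam ^ 2) (ensemble β α N) := by
        simpa [sq] using (tf.mul tf).integrable (β := β) hβ hα
      rw [integral_add ((tf.mul tu).integrable hβ hα) (i2.const_mul _), integral_const_mul] at h1
      linarith
    have e2 : ∫ lam, carre f g lam ∂ensemble β α N = 0 := by
      rw [hv f tf, hortho v hvm', neg_zero]
    have e3 := integral_carre_self_of_orthogonal hβ hα th tg e2
    have e4 : ∫ lam, f lam ∂ensemble β α N = 0 := by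
      have := hortho _ (const_mem_symPoly 1 hn)
      simpa using this
    have e5 : ∫ lam, h lam ∂ensemble β α N = ∫ lam, g lam ∂ensemble β α N := by
      rw [hf, integral_sub (th.integrable hβ hα) (tg.integrable hβ hα)] at e4
      linarith
    have i2 : ∀ {f : (Fin N → ℝ) → ℝ}, IsTest f →
        Integrable (fun lam => f lam ^ 2) (ensemble β α N) := fun tf => by
      simpa [sq] using (tf.mul tf).integrable (β := β) hβ hα
    have e6 : ∫ lam, h lam ^ 2 ∂ensemble β α N =
        ∫ lam, f lam ^ 2 ∂ensemble β α N + ∫ lam, g lam ^ 2 ∂ensemble β α N := by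
      have h1 : ∀ lam, h lam ^ 2 = f lam ^ 2 + 2 * (f lam * g lam) + g lam ^ 2 := fun lam => by
        simp only [hf]; ring
      have i3 := ((tf.mul tg).integrable (β := β) hβ hα).const_mul 2
      have i4 : Integrable (fun lam => f lam ^ 2 + 2 * (f lam * g lam)) (ensemble β α N) :=
        (i2 tf).add i3
      simp only [h1]
      rw [integral_add i4 (i2 tg), integral_add (i2 tf) i3, integral_const_mul, hortho g hg]
      ring
    have hn' : (1 : ℝ) ≤ n := by exact_mod_cast hn
    have hpos : 0 ≤ ∫ lam, f lam ^ 2 ∂ensemble β α N := integral_nonneg fun _ => sq_nonneg _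
    have := ih g hg
    rw [e3, e1, e5, e6]
    nlinarith

/-- The Dirichlet form of a test function dominates the variance of its projection to the
symmetric polynomials of bounded degree. -/
lemma exists_projection_variance_le (hβ : 0 ≤ β) (hα : -1 < α) {n : ℕ} (hn : 1 ≤ n)
    {F : (Fin N → ℝ) → ℝ} (hF : IsTest F) :
    ∃ h ∈ symPoly N n, (∀ v ∈ symPoly N n, ∫ lam, (F lam - h lam) * v lam ∂ensemble β α N = 0) ∧
      ∫ lam, h lam ^ 2 ∂ensemble β α N - (∫ lam, F lam ∂ensemble β α N) ^ 2 ≤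
      ∫ lam, carre F F lam ∂ensemble β α N := by
  obtain ⟨h, hh, hortho⟩ := exists_projection hβ hα
      (fun f hf => isTest_of_mem_symPoly (n := n) hf) hF
  refine ⟨h, hh, hortho, ?_⟩
  have th := isTest_of_mem_symPoly hh
  obtain ⟨u, hu, hum⟩ := exists_isGen hβ hα (symPoly_mono (Nat.le_succ n) hh)
  have hum' : u ∈ symPoly N n := by
    have := Submodule.sub_mem _ hum (Submodule.smul_mem _ (n : ℝ) hh)
    simpa using this
  set f : (Fin N → ℝ) → ℝ := fun lam => F lam - h lam with hf
  have tf : IsTest f := hF.sub th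
  have e2 : ∫ lam, carre f h lam ∂ensemble β α N = 0 := by
    rw [hu f tf, hortho u hum', neg_zero]
  have e3 := integral_carre_self_of_orthogonal hβ hα hF th e2
  have e4 : 0 ≤ ∫ lam, carre f f lam ∂ensemble β α N := integral_nonneg_of_ae <| by
    filter_upwards [ensemble_ae_mem_orthant] with lam hl using carre_self_nonneg f hl
  have e5 : ∫ lam, F lam ∂ensemble β α N = ∫ lam, h lam ∂ensemble β α N := by
    have := hortho _ (const_mem_symPoly 1 hn)
    simp only [mul_one] at this
    rw [integral_sub (hF.integrable hβ hα) (th.integrable hβ hα)] at this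
    linarith
  have := poincare_symPoly hβ hα hn h hh
  rw [e3, e5]
  linarith

end

/-! ### Density of the symmetric polynomials -/

section

open ProbabilityTheory in
/-- A finite measure all of whose one-dimensional projections have exponential moments is
determined by the moments of these projections. -/
theorem measure_ext_of_moments {V : Type*} [NormedAddCommGroup V] [NormedSpace ℝ V]
    [MeasurableSpace V] [BorelSpace V] [SecondCountableTopology V] [CompleteSpace V]
    {μ ν : Measure V} [IsFiniteMeasure μ] [IsFiniteMeasure ν]
    (hμ : ∀ L : V →L[ℝ] ℝ, ∃ c > 0, ∀ t : ℝ, |t| < c →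
      Integrable (fun x => Real.exp (t * L x)) μ ∧ Integrable (fun x => Real.exp (t * L x)) ν)
    (h : ∀ (L : V →L[ℝ] ℝ) (n : ℕ), ∫ x, ((L x : ℝ) : ℂ) ^ n ∂μ = ∫ x, ((L x : ℝ) : ℂ) ^ n ∂ν) :
    μ = ν := by
  -- the moment generating functions are analytic on a strip and agree to all orders at `0`, so
  -- they agree at `i`, which gives the characteristic functions
  refine Measure.ext_of_charFunDual (funext fun L => ?_)
  obtain ⟨c, hc, hint⟩ := hμ L
  set U : Set ℂ := Complex.re ⁻¹' Metric.ball 0 c with hU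
  have hsub : ∀ {κ : Measure V}, (∀ t : ℝ, |t| < c → Integrable (fun x => Real.exp (t * L x)) κ) →
      ∀ z ∈ U, z.re ∈ interior (integrableExpSet L κ) := by
    intro κ hκ z hz
    refine mem_interior.2 ⟨Metric.ball 0 c, fun t ht => ?_, Metric.isOpen_ball, hz⟩
    exact hκ t (by simpa using ht)
  have hμU := hsub (fun t ht => (hint t ht).1)
  have hνU := hsub (fun t ht => (hint t ht).2)
  have a1 : AnalyticOnNhd ℂ (complexMGF L μ) U := analyticOnNhd_complexMGF.mono hμU
  have a2 : AnalyticOnNhd ℂ (complexMGF L ν) U := analyticOnNhd_complexMGF.mono hνU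
  have h0 : (0 : ℂ) ∈ U := by simp [hU, hc]
  have hconn : IsPreconnected U :=
    ((convex_ball (0 : ℝ) c).linear_preimage Complex.reLm).isPreconnected
  have hev : complexMGF L μ =ᶠ[𝓝 0] complexMGF L ν := by
    have s1 := (a1 0 h0).hasFPowerSeriesAt
    have s2 := (a2 0 h0).hasFPowerSeriesAt
    have hd : ∀ n, iteratedDeriv n (complexMGF L μ) 0 = iteratedDeriv n (complexMGF L ν) 0 := by
      intro n
      rw [iteratedDeriv_complexMGF (hμU 0 h0), iteratedDeriv_complexMGF (hνU 0 h0)]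
      simpa using h L n
    simp only [hd] at s1
    filter_upwards [s1.eventually_hasSum_sub, s2.eventually_hasSum_sub] with z h1 h2
    exact h1.unique h2
  have heq := a1.eqOn_of_preconnected_of_eventuallyEq a2 hconn h0 hev
  have hI : Complex.I ∈ U := by simp [hU, hc]
  have := heq hI
  simpa [complexMGF, charFunDual_apply, mul_comm] using this

variable {N : ℕ} {α β : ℝ}

/-- A square-integrable density still has an exponential moment, by Cauchy–Schwarz. -/
lemma integrable_mul_exp_of_memLp (hβ : 0 ≤ β) (hα : -1 < α) {w : (Fin N → ℝ) → ℝ}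
    (hw : MemLp w 2 (ensemble β α N)) :
    Integrable (fun lam => w lam * Real.exp (total lam / 8)) (ensemble β α N) := by
  refine MemLp.integrable_mul hw ((memLp_two_iff_integrable_sq ?_).2 ?_)
  · exact (Real.measurable_exp.comp (continuous_total.measurable.div_const 8)).aestronglyMeasurable
  · refine (integrable_exp_total (N := N) hβ hα).congr (Eventually.of_forall fun lam => ?_)
    simp only [sq, ← Real.exp_add]
    ring_nf

/-- The two-point measure `∑_{j,k} (λ_j, λ_k)_* (w P)`, where `P` is the ensemble. -/
def pairMeasure (β α : ℝ) (w : (Fin N → ℝ) → ℝ) : Measure (ℝ × ℝ) :=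
  ∑ p : Fin N × Fin N, ((ensemble β α N).withDensity fun lam => ENNReal.ofReal (w lam)).map
    fun lam => (lam p.1, lam p.2)

lemma measurable_pair (p : Fin N × Fin N) :
    Measurable fun lam : Fin N → ℝ => (lam p.1, lam p.2) := by fun_prop

/-- Integrals against `pairMeasure`, for integrands of moderate exponential growth. -/
lemma pairMeasure_integral (hβ : 0 ≤ β) (hα : -1 < α) {w : (Fin N → ℝ) → ℝ}
    (hw0 : ∀ lam, 0 ≤ w lam) (hwm : Measurable w) (hw : MemLp w 2 (ensemble β α N))
    {E : Type*} [NormedAddCommGroup E] [NormedSpace ℝ E] [MeasurableSpace E] [BorelSpace E]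
    [SecondCountableTopology E]
    {g : ℝ × ℝ → E} (hg : Measurable g) {C : ℝ}
    (hgb : ∀ lam ∈ orthant N, ∀ p : Fin N × Fin N,
      ‖g (lam p.1, lam p.2)‖ ≤ C * Real.exp (total lam / 8)) :
    Integrable g (pairMeasure (N := N) β α w) ∧
      (∀ p : Fin N × Fin N, Integrable (fun lam => w lam • g (lam p.1, lam p.2))
        (ensemble β α N)) ∧
      ∫ x, g x ∂pairMeasure (N := N) β α w =
        ∑ p : Fin N × Fin N, ∫ lam, w lam • g (lam p.1, lam p.2) ∂ensemble β α N := by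
  have hint : ∀ p : Fin N × Fin N, Integrable (fun lam => w lam • g (lam p.1, lam p.2))
        (ensemble β α N) := by
    intro p
    refine ((integrable_mul_exp_of_memLp hβ hα hw).const_mul C).mono'
      (hwm.smul (hg.comp (measurable_pair p))).aestronglyMeasurable ?_
    filter_upwards [ensemble_ae_mem_orthant] with lam hl
    rw [norm_smul, Real.norm_of_nonneg (hw0 lam), mul_left_comm]
    exact mul_le_mul_of_nonneg_left (hgb lam hl p) (hw0 lam)
  have hmap : ∀ p : Fin N × Fin N, Integrable g
      (((ensemble β α N).withDensity fun lam => ENNReal.ofReal (w lam)).map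
        fun lam => (lam p.1, lam p.2)) := by
    intro p
    rw [integrable_map_measure hg.aestronglyMeasurable (measurable_pair p).aemeasurable,
      integrable_withDensity_iff_integrable_smul' hwm.ennreal_ofReal (by simp)]
    refine (hint p).congr (Eventually.of_forall fun lam => ?_)
    simp [ENNReal.toReal_ofReal (hw0 lam)]
  refine ⟨?_, hint, ?_⟩
  · unfold pairMeasure
    exact integrable_finsetSum_measure.2 fun p _ => hmap p
  · unfold pairMeasure
    rw [integral_finsetSum_measure fun p _ => hmap p]
    refine Finset.sum_congr rfl fun p _ => ?_
    rw [integral_map (measurable_pair p).aemeasurable hg.aestronglyMeasurable,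
      integral_withDensity_eq_integral_toReal_smul hwm.ennreal_ofReal (by simp)]
    exact integral_congr_ae (Eventually.of_forall fun lam => by
      simp [ENNReal.toReal_ofReal (hw0 lam)])

lemma sum_pair_pow (a b : ℝ) (n : ℕ) (lam : Fin N → ℝ) :
    ∑ p : Fin N × Fin N, (a * lam p.1 + b * lam p.2) ^ n =
      ∑ i ∈ Finset.range (n + 1), (a ^ i * b ^ (n - i) * n.choose i) *
        (psum i lam * psum (n - i) lam) := by
  simp only [add_pow, mul_pow]
  rw [Finset.sum_comm]
  refine Finset.sum_congr rfl fun i _ => ?_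
  rw [Fintype.sum_prod_type, psum, psum, Finset.sum_mul_sum, Finset.mul_sum]
  refine Finset.sum_congr rfl fun j _ => ?_
  rw [Finset.mul_sum]
  exact Finset.sum_congr rfl fun k _ => by ring

/-- A square-integrable function orthogonal to all symmetric polynomials is orthogonal to
products of two linear statistics: the two-point measures weighted by the positive and by the
negative part of `v` have the same moments, hence coincide. -/
theorem integral_mul_linearStat_eq_zero (hβ : 0 ≤ β) (hα : -1 < α) {v : (Fin N → ℝ) → ℝ}
    (hvm : Measurable v) (hv : MemLp v 2 (ensemble β α N))
    (hortho : ∀ n, ∀ f ∈ symPoly N n, ∫ lam, v lam * f lam ∂ensemble β α N = 0)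
    {f g : ℝ → ℝ} (hf : Measurable f) (hg : Measurable g) {C : ℝ}
    (hfb : ∀ x, 0 < x → |f x| ≤ C) (hgb : ∀ x, 0 < x → |g x| ≤ C) :
    ∫ lam, v lam * ((∑ j, f (lam j)) * ∑ j, g (lam j)) ∂ensemble β α N = 0 := by
  set P := ensemble β α N with hP
  set w₁ : (Fin N → ℝ) → ℝ := fun lam => max (v lam) 0 with hw₁
  set w₂ : (Fin N → ℝ) → ℝ := fun lam => max (-v lam) 0 with hw₂
  have m₁ : Measurable w₁ := hvm.max measurable_const
  have m₂ : Measurable w₂ := hvm.neg.max measurable_const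
  have n₁ : ∀ lam, 0 ≤ w₁ lam := fun lam => le_max_right _ _
  have n₂ : ∀ lam, 0 ≤ w₂ lam := fun lam => le_max_right _ _
  have l₁ : MemLp w₁ 2 P := hv.mono m₁.aestronglyMeasurable (Eventually.of_forall fun lam => by
    rw [Real.norm_of_nonneg (n₁ lam)]
    exact max_le (le_abs_self _) (abs_nonneg _))
  have l₂ : MemLp w₂ 2 P := hv.mono m₂.aestronglyMeasurable (Eventually.of_forall fun lam => by
    rw [Real.norm_of_nonneg (n₂ lam)]
    exact max_le (neg_le_abs _) (abs_nonneg _))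
  have hdiff : ∀ lam, v lam = w₁ lam - w₂ lam := fun lam => by
    simp only [hw₁, hw₂]
    rcases le_total (v lam) 0 with h | h
    · rw [max_eq_right h, max_eq_left (by linarith)]; ring
    · rw [max_eq_left h, max_eq_right (by linarith)]; ring
  have hcomb : ∀ G : Fin N × Fin N → (Fin N → ℝ) → ℝ,
      (∀ p, Integrable (fun lam => w₁ lam • G p lam) P) →
      (∀ p, Integrable (fun lam => w₂ lam • G p lam) P) →
      ∑ p, ∫ lam, w₁ lam • G p lam ∂P - ∑ p, ∫ lam, w₂ lam • G p lam ∂P =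
        ∫ lam, v lam * ∑ p, G p lam ∂P := by
    intro G i₁ i₂
    rw [← integral_finsetSum _ fun p _ => i₁ p, ← integral_finsetSum _ fun p _ => i₂ p,
      ← integral_sub (integrable_finsetSum _ fun p _ => i₁ p)
        (integrable_finsetSum _ fun p _ => i₂ p)]
    refine integral_congr_ae (Eventually.of_forall fun lam => ?_)
    simp only [hdiff, Finset.mul_sum, smul_eq_mul, ← Finset.sum_sub_distrib]
    exact Finset.sum_congr rfl fun p _ => by ring
  have hfin : ∀ {w : (Fin N → ℝ) → ℝ}, (∀ lam, 0 ≤ w lam) → Measurable w → MemLp w 2 P →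
      IsFiniteMeasure (pairMeasure (N := N) β α w) := by
    intro w hw0 hwm hw
    have := (pairMeasure_integral hβ hα hw0 hwm hw (g := fun _ => (1 : ℝ)) measurable_const
      (C := 1) fun lam hl p => by
        have := total_nonneg lam hl
        rw [norm_one, one_mul]
        exact Real.one_le_exp (by positivity)).1
    exact (integrable_const_iff_isFiniteMeasure one_ne_zero).1 this
  have fin₁ := hfin n₁ m₁ l₁
  have fin₂ := hfin n₂ m₂ l₂
  have hL : ∀ (L : ℝ × ℝ →L[ℝ] ℝ), ∀ lam ∈ orthant N, ∀ p : Fin N × Fin N,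
      |L (lam p.1, lam p.2)| ≤ ‖L‖ * total lam := by
    intro L lam hl p
    refine (L.le_opNorm _).trans (mul_le_mul_of_nonneg_left ?_ (norm_nonneg _))
    refine max_le ?_ ?_ <;> simp only [Real.norm_eq_abs]
    · rw [abs_of_pos (hl _)]; exact coord_le_total hl _
    · rw [abs_of_pos (hl _)]; exact coord_le_total hl _
  have heq : pairMeasure (N := N) β α w₁ = pairMeasure (N := N) β α w₂ := by
    refine measure_ext_of_moments (fun L => ?_) fun L n => ?_
    · refine ⟨1 / (8 * (‖L‖ + 1)), by positivity, fun t ht => ?_⟩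
      have hb : ∀ lam ∈ orthant N, ∀ p : Fin N × Fin N,
          ‖Real.exp (t * L (lam p.1, lam p.2))‖ ≤ 1 * Real.exp (total lam / 8) := by
        intro lam hl p
        have h0 := total_nonneg lam hl
        rw [Real.norm_of_nonneg (Real.exp_pos _).le, one_mul]
        refine Real.exp_le_exp.2 ((le_abs_self _).trans ?_)
        rw [abs_mul]
        calc |t| * |L (lam p.1, lam p.2)|
            ≤ 1 / (8 * (‖L‖ + 1)) * ((‖L‖ + 1) * total lam) := by
              gcongr
              refine (hL L lam hl p).trans ?_
              gcongr
              linarith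
          _ = total lam / 8 := by
              have : ‖L‖ + 1 ≠ 0 := by positivity
              field_simp
      have hm : Measurable fun x : ℝ × ℝ => Real.exp (t * L x) := by fun_prop
      exact ⟨(pairMeasure_integral hβ hα n₁ m₁ l₁ hm hb).1,
        (pairMeasure_integral hβ hα n₂ m₂ l₂ hm hb).1⟩
    · obtain ⟨C', hC', h'⟩ := one_add_pow_le_exp n (c := 1 / 8) (by norm_num)
      have hb : ∀ lam ∈ orthant N, ∀ p : Fin N × Fin N,
          ‖(L (lam p.1, lam p.2)) ^ n‖ ≤ (‖L‖ ^ n * C') * Real.exp (total lam / 8) := by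
        intro lam hl p
        have h0 := total_nonneg lam hl
        rw [norm_pow, Real.norm_eq_abs]
        calc |L (lam p.1, lam p.2)| ^ n ≤ (‖L‖ * (1 + total lam)) ^ n := by
              gcongr
              refine (hL L lam hl p).trans ?_
              gcongr
              linarith
          _ = ‖L‖ ^ n * (1 + total lam) ^ n := mul_pow _ _ _
          _ ≤ ‖L‖ ^ n * (C' * Real.exp (1 / 8 * total lam)) := by
              gcongr
              exact h' _ h0
          _ = _ := by rw [mul_assoc]; ring_nf
      have hm : Measurable fun x : ℝ × ℝ => (L x) ^ n := by fun_prop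
      obtain ⟨-, i₁, e₁⟩ := pairMeasure_integral hβ hα n₁ m₁ l₁ hm hb
      obtain ⟨-, i₂, e₂⟩ := pairMeasure_integral hβ hα n₂ m₂ l₂ hm hb
      simp only [← Complex.ofReal_pow]
      rw [integral_complex_ofReal, integral_complex_ofReal, e₁, e₂]
      congr 1
      rw [← sub_eq_zero, hcomb _ i₁ i₂]
      have hmem : (fun lam => ∑ p : Fin N × Fin N, (L (lam p.1, lam p.2)) ^ n) ∈
          symPoly N (n + 1) := by
        obtain ⟨a, b, hLab⟩ : ∃ a b : ℝ, ∀ x : ℝ × ℝ, L x = a * x.1 + b * x.2 := by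
          refine ⟨L (1, 0), L (0, 1), fun x => ?_⟩
          have : x = x.1 • ((1 : ℝ), (0 : ℝ)) + x.2 • ((0 : ℝ), (1 : ℝ)) := by
            ext <;> simp
          conv_lhs => rw [this]
          rw [map_add, map_smul, map_smul, smul_eq_mul, smul_eq_mul]
          ring
        have : (fun lam : Fin N → ℝ => ∑ p : Fin N × Fin N, (L (lam p.1, lam p.2)) ^ n) =
            ∑ i ∈ Finset.range (n + 1), (a ^ i * b ^ (n - i) * n.choose i : ℝ) •
              (psum i * psum (n - i)) := by
          funext lam
          simp only [hLab, Finset.sum_apply, Pi.smul_apply, Pi.mul_apply, smul_eq_mul]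
          exact sum_pair_pow _ _ n lam
        rw [this]
        refine Submodule.sum_mem _ fun i hi => Submodule.smul_mem _ _ ?_
        have hi' := Finset.mem_range.1 hi
        have h2 := mul_mem_symPoly (psum_mem_symPoly (N := N) (Nat.lt_succ_self i))
          (psum_mem_symPoly (N := N) (Nat.lt_succ_self (n - i)))
        rwa [show i + (n - i).succ = n + 1 by omega] at h2
      exact hortho _ _ hmem
  have hC : ∀ x : ℝ, 0 < x → 0 ≤ C := fun x hx => (abs_nonneg _).trans (hfb x hx)
  have hb : ∀ lam ∈ orthant N, ∀ p : Fin N × Fin N,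
      ‖f (lam p.1) * g (lam p.2)‖ ≤ (C * C) * Real.exp (total lam / 8) := by
    intro lam hl p
    have h0 := total_nonneg lam hl
    have h1 := hC _ (hl p.1)
    rw [norm_mul]
    calc ‖f (lam p.1)‖ * ‖g (lam p.2)‖ ≤ C * C :=
          mul_le_mul (hfb _ (hl _)) (hgb _ (hl _)) (norm_nonneg _) h1
      _ ≤ (C * C) * Real.exp (total lam / 8) :=
          le_mul_of_one_le_right (by positivity) (Real.one_le_exp (by positivity))
  have hm : Measurable fun x : ℝ × ℝ => f x.1 * g x.2 :=
    (hf.comp measurable_fst).mul (hg.comp measurable_snd)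
  obtain ⟨-, i₁, e₁⟩ := pairMeasure_integral hβ hα n₁ m₁ l₁ hm hb
  obtain ⟨-, i₂, e₂⟩ := pairMeasure_integral hβ hα n₂ m₂ l₂ hm hb
  rw [heq, e₂, eq_comm, ← sub_eq_zero, hcomb _ i₁ i₂] at e₁
  rw [← e₁]
  refine integral_congr_ae (Eventually.of_forall fun lam => ?_)
  simp only [Finset.sum_mul_sum, Fintype.sum_prod_type]

/-- Products of two bounded linear statistics are limits in mean square of symmetric
polynomials. -/
theorem exists_symPoly_approx (hβ : 0 ≤ β) (hα : -1 < α) {f g : ℝ → ℝ} (hf : Measurable f)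
    (hg : Measurable g) {C : ℝ} (hfb : ∀ x, 0 < x → |f x| ≤ C) (hgb : ∀ x, 0 < x → |g x| ≤ C)
    (hF : IsTest fun lam : Fin N → ℝ => (∑ j, f (lam j)) * ∑ j, g (lam j)) {δ : ℝ} (hδ : 0 < δ) :
    ∃ n, 1 ≤ n ∧ ∃ h ∈ symPoly N n,
      ∫ lam, ((∑ j, f (lam j)) * (∑ j, g (lam j)) - h lam) ^ 2 ∂ensemble β α N < δ := by
  set F : (Fin N → ℝ) → ℝ := fun lam => (∑ j, f (lam j)) * ∑ j, g (lam j) with hFdef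
  let A : Submodule ℝ ((Fin N → ℝ) → ℝ) := ⨆ n, symPoly N n
  have hdir : Directed (· ≤ ·) (symPoly N) := fun m n =>
    ⟨max m n, symPoly_mono (le_max_left _ _), symPoly_mono (le_max_right _ _)⟩
  have hA : ∀ f ∈ A, ∃ n, f ∈ symPoly N n := fun f hf =>
    (Submodule.mem_iSup_of_directed _ hdir).1 hf
  have hm : ∀ f : A, MemLp (f : (Fin N → ℝ) → ℝ) 2 (ensemble β α N) := fun f => by
    obtain ⟨n, hn⟩ := hA f f.2
    exact (isTest_of_mem_symPoly hn).memLp hβ hα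
  let T : A →ₗ[ℝ] Lp ℝ 2 (ensemble β α N) :=
    { toFun := fun f => (hm f).toLp
      map_add' := fun f g => rfl
      map_smul' := fun c f => rfl }
  let K := LinearMap.range T
  let y := (hF.memLp hβ hα).toLp
  have hy : y =ᵐ[ensemble β α N] F := (hF.memLp hβ hα).coeFn_toLp
  have hmem : y ∈ K.topologicalClosure := by
    rw [← Submodule.orthogonal_orthogonal_eq_closure, Submodule.mem_orthogonal]
    intro v hv
    rw [Submodule.mem_orthogonal] at hv
    have h0 := integral_mul_linearStat_eq_zero hβ hα (Lp.stronglyMeasurable v).measurable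
      (Lp.memLp v) (fun n q hq => ?_) hf hg hfb hgb
    · rw [L2.inner_def, ← h0]
      refine integral_congr_ae ?_
      filter_upwards [hy] with lam h1
      rw [h1]
      simp [hFdef, mul_comm]
    · have hqA : q ∈ A := Submodule.mem_iSup_of_mem n hq
      have h1 := hv (T ⟨q, hqA⟩) ⟨_, rfl⟩
      rw [L2.inner_def] at h1
      rw [← h1]
      refine integral_congr_ae ?_
      have e3 : T ⟨q, hqA⟩ =ᵐ[ensemble β α N] q := (hm ⟨q, hqA⟩).coeFn_toLp
      filter_upwards [e3] with lam h1
      rw [h1]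
      simp
  have hcl := Metric.mem_closure_iff.1 hmem (√δ) (Real.sqrt_pos.2 hδ)
  obtain ⟨_, ⟨q, rfl⟩, hq⟩ := hcl
  obtain ⟨n, hn⟩ := hA q q.2
  refine ⟨n + 1, by omega, q, symPoly_mono (Nat.le_succ n) hn, ?_⟩
  rw [dist_eq_norm] at hq
  have h1 : ‖y - T q‖ ^ 2 < δ := by
    have := pow_lt_pow_left₀ hq (norm_nonneg _) two_ne_zero
    rwa [Real.sq_sqrt hδ.le] at this
  rw [← real_inner_self_eq_norm_sq, L2.inner_def] at h1
  refine lt_of_eq_of_lt (integral_congr_ae ?_) h1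
  have e2 : T q =ᵐ[ensemble β α N] (q : (Fin N → ℝ) → ℝ) := (hm q).coeFn_toLp
  filter_upwards [hy, e2, Lp.coeFn_sub y (T q)] with lam h1 h2 h3
  rw [h3, Pi.sub_apply, h1, h2]
  simp [hFdef, sq]

/-- The Poincaré inequality for products of two bounded linear statistics, with the spectral gap
`1` of the Laguerre diffusion. -/
theorem poincare_linearStat_mul (hβ : 0 ≤ β) (hα : -1 < α) {f g : ℝ → ℝ} (hf : Measurable f)
    (hg : Measurable g) {C : ℝ} (hfb : ∀ x, 0 < x → |f x| ≤ C) (hgb : ∀ x, 0 < x → |g x| ≤ C)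
    {F : (Fin N → ℝ) → ℝ} (hF : IsTest F)
    (hFeq : F = fun lam => (∑ j, f (lam j)) * ∑ j, g (lam j)) :
    ∫ lam, F lam ^ 2 ∂ensemble β α N - (∫ lam, F lam ∂ensemble β α N) ^ 2 ≤
      ∫ lam, carre F F lam ∂ensemble β α N := by
  refine le_of_forall_pos_le_add fun δ hδ => ?_
  obtain ⟨n, hn, q, hq, hqδ⟩ := exists_symPoly_approx (N := N) hβ hα hf hg hfb hgb
    (hFeq ▸ hF) hδ
  obtain ⟨h, hh, hortho, hle⟩ := exists_projection_variance_le hβ hα hn hF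
  have th := isTest_of_mem_symPoly hh
  have tq := isTest_of_mem_symPoly hq
  have hFq : ∫ lam, (F lam - q lam) ^ 2 ∂ensemble β α N < δ := by rw [hFeq]; exact hqδ
  have i2 : ∀ {f : (Fin N → ℝ) → ℝ}, IsTest f →
      Integrable (fun lam => f lam ^ 2) (ensemble β α N) := fun tf => by
    simpa [sq] using (tf.mul tf).integrable (β := β) hβ hα
  -- Pythagoras for `F - h ⊥ v`, used with `v = h` and with `v = h - q`
  have pyth : ∀ v ∈ symPoly N n, ∫ lam, (F lam - h lam + v lam) ^ 2 ∂ensemble β α N =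
      ∫ lam, (F lam - h lam) ^ 2 ∂ensemble β α N + ∫ lam, v lam ^ 2 ∂ensemble β α N := by
    intro v hv
    have tv := isTest_of_mem_symPoly hv
    have i3 := (((hF.sub th).mul tv).integrable (β := β) hβ hα).const_mul 2
    have i4 : Integrable (fun lam => (F lam - h lam) ^ 2 + 2 * ((F lam - h lam) * v lam))
        (ensemble β α N) := (i2 (hF.sub th)).add i3
    have h1 : ∀ lam, (F lam - h lam + v lam) ^ 2 =
      (F lam - h lam) ^ 2 + 2 * ((F lam - h lam) * v lam) + v lam ^ 2 := fun lam => by ring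
    simp only [h1]
    rw [integral_add i4 (i2 tv), integral_add (i2 (hF.sub th)) i3, integral_const_mul,
      hortho v hv]
    ring
  have p1 := pyth h hh
  have p2 := pyth (h - q) (Submodule.sub_mem _ hh hq)
  simp only [sub_add_cancel, Pi.sub_apply, sub_add_sub_cancel] at p1 p2
  have : 0 ≤ ∫ lam, (h lam - q lam) ^ 2 ∂ensemble β α N := integral_nonneg fun _ => sq_nonneg _
  rw [p1]
  linarith

end

/-! ### Fluctuations of linear statistics -/

section

variable {N : ℕ} {α β : ℝ}

lemma isTest_linearStat {E : Type*} [NormedAddCommGroup E] [NormedSpace ℝ E] {f f' : ℝ → E}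
    (hf : ∀ x, 0 < x → HasDerivAt f (f' x) x) {C : ℝ} (hb : ∀ x, 0 < x → ‖f x‖ ≤ C)
    (hb' : ∀ x, 0 < x → ‖f' x‖ ≤ C) : IsTest fun lam : Fin N → ℝ => ∑ j, f (lam j) := by
  have hc : ∀ {g : ℝ → E}, (∀ x, 0 < x → ‖g x‖ ≤ C) → ∀ l : Fin N,
      PolyBdd (orthant N) total fun lam => g (lam l) := fun hg l =>
    (PolyBdd.const C).of_le fun lam h => (hg _ (h l)).trans (le_abs_self C)
  exact IsTest.sum _ fun l _ => IsTest.comp_coord hf l (hc hb l) (hc hb' l)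

lemma fderiv_linearStat {E : Type*} [NormedAddCommGroup E] [NormedSpace ℝ E] {f f' : ℝ → E}
    (hf : ∀ x, 0 < x → HasDerivAt f (f' x) x) {lam : Fin N → ℝ} (h : lam ∈ orthant N)
    (v : Fin N → ℝ) :
    fderiv ℝ (fun lam : Fin N → ℝ => ∑ j, f (lam j)) lam v = ∑ j, v j • f' (lam j) := by
  have h1 : HasFDerivAt (fun lam : Fin N → ℝ => ∑ j, f (lam j))
      (∑ j, (ContinuousLinearMap.toSpanSingleton ℝ (f' (lam j))).comp
        (ContinuousLinearMap.proj (R := ℝ) (φ := fun _ : Fin N => ℝ) j)) lam := by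
    refine HasFDerivAt.fun_sum fun j _ => ?_
    exact HasFDerivAt.comp (g := f) (f := fun mu : Fin N → ℝ => mu j) lam
      (hf _ (h j)).hasFDerivAt (hasFDerivAt_apply j lam)
  rw [h1.fderiv]
  simp

lemma carre_linearStat {u u' : ℝ → ℝ} (hu : ∀ x, 0 < x → HasDerivAt u (u' x) x)
    {lam : Fin N → ℝ} (h : lam ∈ orthant N) :
    carre (fun lam => ∑ j, u (lam j)) (fun lam => ∑ j, u (lam j)) lam =
      ∑ j, lam j * u' (lam j) ^ 2 := by
  unfold carre
  refine Finset.sum_congr rfl fun j _ => ?_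
  rw [fderiv_linearStat hu h, ← sq]
  simp [Pi.single_apply]

/-- Second and fourth central moments of a bounded linear statistic, from the Poincaré inequality
applied to the statistic and to its square. -/
theorem moments_linearStat_le (hβ : 0 ≤ β) (hα : -1 < α) (hN : 0 < N) {u u' : ℝ → ℝ}
    (hum : Measurable u) (hu : ∀ x, 0 < x → HasDerivAt u (u' x) x) {C B : ℝ}
    (hb : ∀ x, 0 < x → |u x| ≤ C) (hb' : ∀ x, 0 < x → |u' x| ≤ C)
    (hB : ∀ x, 0 < x → x * u' x ^ 2 ≤ B) :
    ∫ lam, (∑ j, u (lam j) - ∫ mu, ∑ j, u (mu j) ∂ensemble β α N) ^ 2 ∂ensemble β α N ≤ N * B ∧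
    ∫ lam, (∑ j, u (lam j) - ∫ mu, ∑ j, u (mu j) ∂ensemble β α N) ^ 4 ∂ensemble β α N ≤
      5 * (N * B) ^ 2 := by
  have := isProbabilityMeasure_ensemble (N := N) hβ hα
  set m := ∫ mu, ∑ j, u (mu j) ∂ensemble β α N with hm
  have hN' : (N : ℝ) ≠ 0 := by positivity
  -- spreading the mean over the `N` summands makes the centred statistic a linear statistic
  set v : ℝ → ℝ := fun x => u x - m / N with hv
  have hvd : ∀ x, 0 < x → HasDerivAt v (u' x) x := fun x hx => (hu x hx).sub_const _
  have hvm : Measurable v := hum.sub_const _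
  set C' := C + |m / N| with hC'
  have hvb : ∀ x, 0 < x → |v x| ≤ C' := fun x hx =>
    (abs_sub _ _).trans (add_le_add (hb x hx) le_rfl)
  have hvb' : ∀ x, 0 < x → |u' x| ≤ C' := fun x hx =>
    (hb' x hx).trans (le_add_of_nonneg_right (abs_nonneg _))
  set X : (Fin N → ℝ) → ℝ := fun lam => ∑ j, v (lam j) with hX
  have hXeq : ∀ lam, ∑ j, u (lam j) - m = X lam := fun lam => by
    simp only [hX, hv, Finset.sum_sub_distrib, Finset.sum_const, Finset.card_univ,
      Fintype.card_fin, nsmul_eq_mul]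
    field_simp
  have tX : IsTest X := isTest_linearStat hvd hvb hvb'
  have tu : IsTest fun lam : Fin N → ℝ => ∑ j, u (lam j) := isTest_linearStat hu hb hb'
  have hX0 : ∫ lam, X lam ∂ensemble β α N = 0 := by
    simp only [← hXeq]
    rw [integral_sub (tu.integrable hβ hα) (integrable_const _)]
    simp [hm]
  have hcarre : ∀ lam ∈ orthant N, carre X X lam ≤ N * B := by
    intro lam hl
    rw [carre_linearStat hvd hl]
    calc ∑ j, lam j * u' (lam j) ^ 2 ≤ ∑ _j : Fin N, B :=
          Finset.sum_le_sum fun j _ => hB _ (hl j)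
      _ = N * B := by simp
  have h2 : ∫ lam, X lam ^ 2 ∂ensemble β α N ≤ N * B := by
    -- the factor `∑ⱼ 1 / N = 1` reduces the product to a single linear statistic
    have h1 := poincare_linearStat_mul (N := N) hβ hα (f := v) (g := fun _ => (1 : ℝ) / N)
      (C := max C' (1 / N)) hvm measurable_const
      (fun x hx => (hvb x hx).trans (le_max_left _ _))
      (fun x hx => by rw [abs_of_nonneg (by positivity)]; exact le_max_right _ _) tX (by
        funext lam
        simp [hX]
        field_simp)
    rw [hX0] at h1
    have h3 : ∫ lam, carre X X lam ∂ensemble β α N ≤ ∫ _lam, (N * B : ℝ) ∂ensemble β α N := by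
      refine integral_mono_ae (tX.integrable_carre hβ hα tX) (integrable_const _) ?_
      filter_upwards [ensemble_ae_mem_orthant] with lam hl using hcarre lam hl
    simp only [integral_const, probReal_univ, one_smul] at h3
    linarith
  refine ⟨by simpa only [hXeq] using h2, ?_⟩
  simp only [hXeq]
  have tX2 : IsTest fun lam => X lam * X lam := tX.mul tX
  have h1 := poincare_linearStat_mul (N := N) hβ hα (f := v) (g := v) (C := C') hvm hvm hvb hvb
    tX2 rfl
  have h3 : ∫ lam, carre (fun lam => X lam * X lam) (fun lam => X lam * X lam) lam
      ∂ensemble β α N ≤ ∫ lam, 4 * (N * B) * (X lam ^ 2) ∂ensemble β α N := by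
    have i2 : Integrable (fun lam => X lam ^ 2) (ensemble β α N) := by
      simpa [sq] using tX2.integrable (β := β) hβ hα
    refine integral_mono_ae (tX2.integrable_carre hβ hα tX2) (i2.const_mul _) ?_
    filter_upwards [ensemble_ae_mem_orthant] with lam hl
    have dX := tX.diff lam hl
    rw [carre_mul_right _ dX dX, carre_mul_left _ dX dX]
    have := hcarre lam hl
    nlinarith [sq_nonneg (X lam)]
  rw [integral_const_mul] at h3
  have h4 : ∀ lam, (X lam * X lam) ^ 2 = X lam ^ 4 := fun lam => by ring
  have h5 : ∀ lam, X lam * X lam = X lam ^ 2 := fun lam => by ring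
  simp only [h4] at h1
  simp only [h5] at h1 h3
  have hNB : 0 ≤ N * B := le_trans (integral_nonneg fun _ => sq_nonneg _) h2
  have h6 : 0 ≤ ∫ lam, X lam ^ 2 ∂ensemble β α N := integral_nonneg fun _ => sq_nonneg _
  nlinarith

/-- The complex version of `moments_linearStat_le`. -/
theorem moments_linearStat_complex_le (hβ : 0 ≤ β) (hα : -1 < α) (hN : 0 < N) {f f' : ℝ → ℂ}
    (hfm : Measurable f) (hf : ∀ x, 0 < x → HasDerivAt f (f' x) x) {C B : ℝ}
    (hb : ∀ x, 0 < x → ‖f x‖ ≤ C) (hb' : ∀ x, 0 < x → ‖f' x‖ ≤ C)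
    (hB : ∀ x, 0 < x → x * ‖f' x‖ ^ 2 ≤ B) :
    ∫ lam, ‖∑ j, f (lam j) - ∫ mu, ∑ j, f (mu j) ∂ensemble β α N‖ ^ 2 ∂ensemble β α N ≤
      2 * (N * B) ∧
    ∫ lam, ‖∑ j, f (lam j) - ∫ mu, ∑ j, f (mu j) ∂ensemble β α N‖ ^ 4 ∂ensemble β α N ≤
      20 * (N * B) ^ 2 := by
  have := isProbabilityMeasure_ensemble (N := N) hβ hα
  have tf : IsTest fun lam : Fin N → ℝ => ∑ j, f (lam j) := isTest_linearStat hf hb hb'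
  have dre : ∀ x, 0 < x → HasDerivAt (fun x => (f x).re) (f' x).re x := fun x hx =>
    Complex.reCLM.hasFDerivAt.comp_hasDerivAt x (hf x hx)
  have dim : ∀ x, 0 < x → HasDerivAt (fun x => (f x).im) (f' x).im x := fun x hx =>
    Complex.imCLM.hasFDerivAt.comp_hasDerivAt x (hf x hx)
  have bre : ∀ {g : ℝ → ℂ}, (∀ x, 0 < x → ‖g x‖ ≤ C) → ∀ x, 0 < x → |(g x).re| ≤ C :=
    fun hg x hx => (Complex.abs_re_le_norm _).trans (hg x hx)
  have bim : ∀ {g : ℝ → ℂ}, (∀ x, 0 < x → ‖g x‖ ≤ C) → ∀ x, 0 < x → |(g x).im| ≤ C :=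
    fun hg x hx => (Complex.abs_im_le_norm _).trans (hg x hx)
  have hsq : ∀ z : ℂ, ‖z‖ ^ 2 = z.re ^ 2 + z.im ^ 2 := fun z => by
    rw [Complex.sq_norm, Complex.normSq_apply]; ring
  have B1 : ∀ x, 0 < x → x * (f' x).re ^ 2 ≤ B := fun x hx =>
    (mul_le_mul_of_nonneg_left (by rw [hsq]; nlinarith [sq_nonneg (f' x).im]) hx.le).trans (hB x hx)
  have B2 : ∀ x, 0 < x → x * (f' x).im ^ 2 ≤ B := fun x hx =>
    (mul_le_mul_of_nonneg_left (by rw [hsq]; nlinarith [sq_nonneg (f' x).re]) hx.le).trans (hB x hx)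
  obtain ⟨r2, r4⟩ := moments_linearStat_le hβ hα hN (Complex.measurable_re.comp hfm) dre
    (bre hb) (bre hb') B1
  obtain ⟨j2, j4⟩ := moments_linearStat_le hβ hα hN (Complex.measurable_im.comp hfm) dim
    (bim hb) (bim hb') B2
  have tre : IsTest fun lam : Fin N → ℝ => ∑ j, (f (lam j)).re :=
    isTest_linearStat dre (bre hb) (bre hb')
  have tim : IsTest fun lam : Fin N → ℝ => ∑ j, (f (lam j)).im :=
    isTest_linearStat dim (bim hb) (bim hb')
  set M := ∫ mu, ∑ j, f (mu j) ∂ensemble β α N with hM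
  have hMre : M.re = ∫ mu, ∑ j, (f (mu j)).re ∂ensemble β α N := by
    have := integral_re (𝕜 := ℂ) (tf.integrable (β := β) hβ hα)
    simp only [RCLike.re_to_complex, Complex.re_sum] at this
    exact this.symm
  have hMim : M.im = ∫ mu, ∑ j, (f (mu j)).im ∂ensemble β α N := by
    have := integral_im (𝕜 := ℂ) (tf.integrable (β := β) hβ hα)
    simp only [RCLike.im_to_complex, Complex.im_sum] at this
    exact this.symm
  simp only [Function.comp_def] at r2 r4 j2 j4
  rw [← hMre] at r2 r4
  rw [← hMim] at j2 j4
  set X : (Fin N → ℝ) → ℝ := fun lam => ∑ j, (f (lam j)).re - M.re with hX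
  set Y : (Fin N → ℝ) → ℝ := fun lam => ∑ j, (f (lam j)).im - M.im with hY
  have tX : IsTest X := tre.sub (IsTest.const _)
  have tY : IsTest Y := tim.sub (IsTest.const _)
  have hXY : ∀ lam, ‖∑ j, f (lam j) - M‖ ^ 2 = X lam ^ 2 + Y lam ^ 2 := fun lam => by
    rw [hsq]
    simp [hX, hY]
  have i2 : ∀ {f : (Fin N → ℝ) → ℝ}, IsTest f →
      Integrable (fun lam => f lam ^ 2) (ensemble β α N) := fun tf => by
    simpa [sq] using (tf.mul tf).integrable (β := β) hβ hα
  have i4 : ∀ {f : (Fin N → ℝ) → ℝ}, IsTest f →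
      Integrable (fun lam => f lam ^ 4) (ensemble β α N) := fun tf => by
    have := ((tf.mul tf).mul (tf.mul tf)).integrable (β := β) hβ hα
    refine this.congr (Eventually.of_forall fun lam => ?_)
    ring
  constructor
  · simp only [hXY]
    rw [integral_add (i2 tX) (i2 tY)]
    linarith
  · have h1 : ∫ lam, ‖∑ j, f (lam j) - M‖ ^ 4 ∂ensemble β α N ≤
        ∫ lam, (2 * X lam ^ 4 + 2 * Y lam ^ 4) ∂ensemble β α N := by
      refine integral_mono_of_nonneg (Eventually.of_forall fun _ => by positivity)
        (((i4 tX).const_mul 2).add ((i4 tY).const_mul 2)) (Eventually.of_forall fun lam => ?_)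
      simp only
      have : ‖∑ j, f (lam j) - M‖ ^ 4 = (‖∑ j, f (lam j) - M‖ ^ 2) ^ 2 := by ring
      rw [this, hXY]
      nlinarith [sq_nonneg (X lam ^ 2 - Y lam ^ 2)]
    rw [integral_add ((i4 tX).const_mul 2) ((i4 tY).const_mul 2), integral_const_mul,
      integral_const_mul] at h1
    linarith

end

/-! ### Loop equations -/

section

variable {N : ℕ} {α β : ℝ}

/-- The complex plane cut along `[0, ∞)`. -/
def cutPlane : Set ℂ := {s | s.im ≠ 0 ∨ s.re < 0}

/-- The distance to the cut. -/
def gap (s : ℂ) : ℝ := Metric.infDist s ((fun x : ℝ => (x : ℂ)) '' Set.Ici 0)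

lemma isOpen_cutPlane : IsOpen cutPlane :=
  (isOpen_ne_fun Complex.continuous_im continuous_const).union
    (isOpen_lt Complex.continuous_re continuous_const)

lemma continuous_gap : Continuous gap := Metric.continuous_infDist_pt _

lemma gap_le (s : ℂ) {x : ℝ} (hx : 0 ≤ x) : gap s ≤ ‖s - x‖ := by
  rw [← dist_eq_norm]
  exact Metric.infDist_le_dist_of_mem ⟨x, hx, rfl⟩

lemma gap_pos {s : ℂ} (hs : s ∈ cutPlane) : 0 < gap s := by
  have hc : IsClosed ((fun x : ℝ => (x : ℂ)) '' Set.Ici 0) :=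
    Complex.isometry_ofReal.isClosedEmbedding.isClosedMap _ isClosed_Ici
  rw [gap, ← hc.notMem_iff_infDist_pos ⟨0, 0, Set.mem_Ici.2 le_rfl, by simp⟩]
  rintro ⟨x, hx, rfl⟩
  rcases hs with h | h
  · simp at h
  · simp only [Complex.ofReal_re] at h
    exact absurd (Set.mem_Ici.1 hx) (not_le.2 h)

lemma sub_ne_zero_of_mem_cutPlane {s : ℂ} (hs : s ∈ cutPlane) {x : ℝ} (hx : 0 ≤ x) :
    s - x ≠ 0 :=
  norm_pos_iff.1 ((gap_pos hs).trans_le (gap_le s hx))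

lemma mul_mem_cutPlane {s : ℂ} (hs : s ∈ cutPlane) {c : ℝ} (hc : 0 < c) :
    (c : ℂ) * s ∈ cutPlane := by
  rcases hs with h | h
  · left; simpa [hc.ne'] using h
  · right; simpa using mul_neg_of_pos_of_neg hc h

lemma norm_inv_sub_le {s : ℂ} (hs : s ∈ cutPlane) {x : ℝ} (hx : 0 ≤ x) :
    ‖1 / (s - x)‖ ≤ 1 / gap s := by
  rw [norm_div, norm_one]
  exact one_div_le_one_div_of_le (gap_pos hs) (gap_le s hx)

/-- The divided difference of the vector field `x ↦ x / (z - x)`. -/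
def resField (z : ℂ) (x y : ℝ) : ℂ := z * (1 / (z - x)) * (1 / (z - y))

lemma mul_resField_zero {z : ℂ} (hz : z ∈ cutPlane) (x : ℝ) :
    resField z x 0 = 1 / (z - x) := by
  have := sub_ne_zero_of_mem_cutPlane hz (le_refl (0 : ℝ))
  simp only [Complex.ofReal_zero, sub_zero] at this
  rw [resField, Complex.ofReal_zero, sub_zero]
  field_simp

lemma continuousOn_resField {z : ℂ} (hz : z ∈ cutPlane) :
    ContinuousOn (fun p : ℝ × ℝ => resField z p.1 p.2) (Set.Ici 0 ×ˢ Set.Ici 0) := by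
  unfold resField
  refine (continuousOn_const.mul (continuousOn_const.div (by fun_prop) fun p hp => ?_)).mul
    (continuousOn_const.div (by fun_prop) fun p hp => ?_)
  · exact sub_ne_zero_of_mem_cutPlane hz hp.1
  · exact sub_ne_zero_of_mem_cutPlane hz hp.2

lemma resField_diff {z : ℂ} (hz : z ∈ cutPlane) {x y : ℝ} (hx : 0 ≤ x) (hy : 0 ≤ y) :
    x * resField z x 0 - y * resField z y 0 = (x - y) * resField z x y := by
  rw [mul_resField_zero hz, mul_resField_zero hz, resField]
  have h1 := sub_ne_zero_of_mem_cutPlane hz hx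
  have h2 := sub_ne_zero_of_mem_cutPlane hz hy
  field_simp
  ring

lemma norm_resField_le {z : ℂ} (hz : z ∈ cutPlane) {x y : ℝ} (hx : 0 ≤ x) (hy : 0 ≤ y) :
    ‖resField z x y‖ ≤ ‖z‖ * (1 / gap z) * (1 / gap z) := by
  have := gap_pos hz
  rw [resField, norm_mul, norm_mul]
  gcongr
  · exact norm_inv_sub_le hz hx
  · exact norm_inv_sub_le hz hy

lemma norm_mul_resField_zero_le {z : ℂ} (hz : z ∈ cutPlane) {x : ℝ} (hx : 0 ≤ x) :
    ‖x * resField z x 0‖ ≤ ‖z‖ * (1 / gap z) + 1 := by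
  have h1 := sub_ne_zero_of_mem_cutPlane hz hx
  have : x * resField z x 0 = z * (1 / (z - x)) - 1 := by
    rw [mul_resField_zero hz]
    field_simp
    ring
  rw [this]
  refine (norm_sub_le _ _).trans ?_
  rw [norm_mul, norm_one]
  gcongr
  exact norm_inv_sub_le hz hx

/-- Real and imaginary parts of the resolvent field are admissible. -/
lemma isField_clm_resField {z : ℂ} (hz : z ∈ cutPlane) (L : ℂ →L[ℝ] ℝ) :
    IsField fun x y => L (resField z x y) where
  cont := L.continuous.comp_continuousOn (continuousOn_resField hz)
  diff x y hx hy := by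
    have h := congrArg L (resField_diff hz hx hy)
    rw [map_sub, ← Complex.ofReal_sub, ← Complex.real_smul, ← Complex.real_smul,
      ← Complex.real_smul, map_smul, map_smul, map_smul] at h
    simpa using h
  bdd := by
    have := gap_pos hz
    refine ⟨‖L‖ * (‖z‖ * (1 / gap z) * (1 / gap z)), 0, by positivity, fun x y hx hy => ?_⟩
    rw [pow_zero, mul_one]
    exact (L.le_opNorm _).trans (by gcongr; exact norm_resField_le hz hx hy)
  lower := by
    have := gap_pos hz
    refine ⟨‖L‖ * (‖z‖ * (1 / gap z) * (1 / gap z)) + ‖L‖ * (‖z‖ * (1 / gap z) + 1),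
      by positivity, fun x y hx hy => ⟨?_, ?_⟩⟩
    · have h1 : |L (resField z x y)| ≤ ‖L‖ * (‖z‖ * (1 / gap z) * (1 / gap z)) :=
        (L.le_opNorm _).trans (by gcongr; exact norm_resField_le hz hx hy)
      have h2 : 0 ≤ ‖L‖ * (‖z‖ * (1 / gap z) + 1) := by positivity
      have := neg_abs_le (L (resField z x y))
      linarith
    · have h1 : |L (x * resField z x 0)| ≤ ‖L‖ * (‖z‖ * (1 / gap z) + 1) :=
        (L.le_opNorm _).trans (by gcongr; exact norm_mul_resField_zero_le hz hx)
      have h2 : 0 ≤ ‖L‖ * (‖z‖ * (1 / gap z) * (1 / gap z)) := by positivity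
      rw [← Complex.real_smul, map_smul, smul_eq_mul] at h1
      have := neg_abs_le (x * L (resField z x 0))
      linarith

lemma IsField.integrable_divergence (hβ : 0 ≤ β) (hα : -1 < α) {D : ℝ → ℝ → ℝ} (hD : IsField D)
    {F : (Fin N → ℝ) → ℂ} (hF : IsTest F) :
    Integrable (fun lam => fderiv ℝ F lam (fun j => lam j * D (lam j) 0) +
      divergence β α D lam • F lam) (ensemble β α N) := by
  obtain ⟨t₀, ht₀pos, ht₀⟩ := hD.exists_step
  obtain ⟨C, m, hC, hm⟩ := hD.polyBdd_pullbackDeriv (β := β) (α := α) ht₀ hF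
  refine integrable_of_polyBdd hβ hα ?_ ⟨C, m, hC, fun lam hl => ?_⟩
  · have hae : ∀ {G : (Fin N → ℝ) → ℝ}, ContinuousOn G (orthant N) →
        AEStronglyMeasurable G (ensemble β α N) := by
      intro G hG
      rw [← Measure.restrict_eq_self_of_ae_mem (ensemble_ae_mem_orthant (β := β) (α := α))]
      exact hG.aestronglyMeasurable isOpen_orthant.measurableSet
    have hD2 : ∀ l k, ContinuousOn (fun lam : Fin N → ℝ => D (lam l) (lam k)) (orthant N) :=
      fun l k => hD.continuousOn_comp (by fun_prop) (by fun_prop) (fun x hx => (hx l).le)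
        fun x hx => (hx k).le
    have hD0 : ∀ l, ContinuousOn (fun lam : Fin N → ℝ => D (lam l) 0) (orthant N) :=
      fun l => hD.continuousOn_comp (by fun_prop) (by fun_prop) (fun x hx => (hx l).le)
        fun x hx => le_rfl
    have hφ : ∀ l, ContinuousOn (fun lam : Fin N → ℝ => lam l * D (lam l) 0) (orthant N) :=
      fun l => (by fun_prop : ContinuousOn (fun lam : Fin N → ℝ => lam l) (orthant N)).mul (hD0 l)
    refine AEStronglyMeasurable.add ?_ (AEStronglyMeasurable.smul (hae ?_) hF.aestronglyMeasurable)
    · have h : (fun lam : Fin N → ℝ => fderiv ℝ F lam (fun j => lam j * D (lam j) 0)) =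
          fun lam => ∑ j, (lam j * D (lam j) 0) • fderiv ℝ F lam (Pi.single j 1) :=
        funext fun lam => fderiv_eq_sum F lam _
      rw [h]
      exact Finset.aestronglyMeasurable_fun_sum _ fun j _ => (hae (hφ j)).smul
        (measurable_fderiv_apply_const ℝ F _).aestronglyMeasurable
    · unfold divergence
      exact (continuousOn_finsetSum _ fun l _ => ((continuousOn_const.mul (hD0 l)).sub
        (hφ l)).add (hD2 l l)).add (continuousOn_const.mul (continuousOn_finsetSum _ fun j _ =>
          continuousOn_finsetSum _ fun k _ => hD2 k j))
  · have h := hm (0, lam) ⟨⟨le_rfl, ht₀pos.le⟩, hl⟩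
    simpa [pullbackDeriv, logRatio_zero, step_zero, logRatioDeriv_zero] using h

/-- The power sum `∑ⱼ (z - λⱼ)⁻ᵏ` of the resolvent. -/
def resSum (k : ℕ) (z : ℂ) (lam : Fin N → ℝ) : ℂ := ∑ j, (1 / (z - lam j)) ^ k

lemma resSum_one_mul {z : ℂ} {lam : Fin N → ℝ} (h : ∀ j, z - lam j ≠ 0) :
    ∑ j, (lam j : ℂ) * (1 / (z - lam j)) = z * resSum 1 z lam - N := by
  have : ∀ j, (lam j : ℂ) * (1 / (z - lam j)) = z * (1 / (z - lam j)) ^ 1 - 1 := fun j => by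
    have := h j
    field_simp
    ring
  simp only [this, Finset.sum_sub_distrib, resSum, Finset.mul_sum]
  simp

lemma divergence_resField {z : ℂ} (hz : z ∈ cutPlane) {lam : Fin N → ℝ} (hl : lam ∈ orthant N) :
    (divergence β α (fun x y => (resField z x y).re) lam : ℂ) +
      Complex.I * divergence β α (fun x y => (resField z x y).im) lam =
      α * resSum 1 z lam - (z * resSum 1 z lam - N) + (1 - β / 2) * (z * resSum 2 z lam) +
        β / 2 * (z * resSum 1 z lam ^ 2) := by
  have hsymm : ∀ x y, resField z x y = resField z y x := fun x y => by unfold resField; ring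
  rw [divergence_symm (fun x y => by rw [hsymm]), divergence_symm (fun x y => by rw [hsymm])]
  have h1 : ∑ l, resField z (lam l) 0 = resSum 1 z lam := by
    simp [mul_resField_zero hz, resSum]
  have h2 : ∑ l, lam l * resField z (lam l) 0 = z * resSum 1 z lam - N := by
    simp only [mul_resField_zero hz]
    exact resSum_one_mul fun j => sub_ne_zero_of_mem_cutPlane hz (hl j).le
  have h3 : ∑ l, resField z (lam l) (lam l) = z * resSum 2 z lam := by
    simp only [resField, resSum, Finset.mul_sum]
    exact Finset.sum_congr rfl fun j _ => by ring
  have h4 : ∑ j, ∑ k, resField z (lam j) (lam k) = z * resSum 1 z lam ^ 2 := by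
    rw [sq, resSum, Finset.sum_mul_sum, Finset.mul_sum]
    refine Finset.sum_congr rfl fun j _ => ?_
    rw [Finset.mul_sum]
    exact Finset.sum_congr rfl fun k _ => by rw [resField]; ring
  rw [← h4, ← h2, ← h3, ← h1]
  apply Complex.ext <;> simp [Finset.sum_sub_distrib, Finset.mul_sum]

end

section

variable {N : ℕ} {α β : ℝ}

/-- The Schwinger–Dyson equation for the resolvent field and a test function `F`. -/
theorem integral_resField (hβ : 0 ≤ β) (hα : -1 < α) {z : ℂ} (hz : z ∈ cutPlane)
    {F : (Fin N → ℝ) → ℂ} (hF : IsTest F) :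
    ∫ lam, (∑ j, (lam j : ℂ) * (1 / (z - lam j)) * fderiv ℝ F lam (Pi.single j 1) +
      (α * resSum 1 z lam - (z * resSum 1 z lam - N) + (1 - β / 2) * (z * resSum 2 z lam) +
        β / 2 * (z * resSum 1 z lam ^ 2)) * F lam) ∂ensemble β α N = 0 := by
  have hr := isField_clm_resField hz Complex.reCLM
  have hi := isField_clm_resField hz Complex.imCLM
  have e1 := hr.integral_divergence (N := N) hβ hα hF
  have e2 := hi.integral_divergence (N := N) hβ hα hF
  have i1 := hr.integrable_divergence (N := N) hβ hα hF
  have i2 := hi.integrable_divergence (N := N) hβ hα hF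
  have h := integral_add i1 (i2.const_mul Complex.I)
  rw [integral_const_mul, e1, e2, mul_zero, add_zero] at h
  rw [← h]
  refine integral_congr_ae ?_
  filter_upwards [ensemble_ae_mem_orthant] with lam hl
  rw [← divergence_resField hz hl, fderiv_eq_sum, fderiv_eq_sum]
  simp only [Complex.reCLM_apply, Complex.imCLM_apply, Complex.real_smul]
  have h1 : ∀ j, (lam j : ℂ) * (1 / (z - lam j)) * fderiv ℝ F lam (Pi.single j 1) =
      ((lam j * (resField z (lam j) 0).re : ℝ) : ℂ) * fderiv ℝ F lam (Pi.single j 1) +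
      Complex.I * (((lam j * (resField z (lam j) 0).im : ℝ) : ℂ) *
        fderiv ℝ F lam (Pi.single j 1)) := by
    intro j
    rw [← mul_resField_zero hz]
    conv_lhs => rw [← Complex.re_add_im (resField z (lam j) 0)]
    push_cast
    ring
  simp only [h1, Finset.sum_add_distrib, ← Finset.mul_sum]
  ring

lemma measurable_resSum (k : ℕ) (z : ℂ) : Measurable (resSum (N := N) k z) := by
  unfold resSum
  exact Finset.measurable_fun_sum _ fun j _ => by fun_prop

lemma norm_resSum_le {z : ℂ} (hz : z ∈ cutPlane) (k : ℕ) {lam : Fin N → ℝ} (hl : lam ∈ orthant N) :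
    ‖resSum k z lam‖ ≤ N * (1 / gap z) ^ k := by
  unfold resSum
  calc ‖∑ j, (1 / (z - lam j)) ^ k‖ ≤ ∑ _j : Fin N, (1 / gap z) ^ k := by
        refine norm_sum_le_of_le _ fun j _ => ?_
        rw [norm_pow]
        gcongr
        exact norm_inv_sub_le hz (hl j).le
    _ = N * (1 / gap z) ^ k := by simp

lemma integrable_of_bdd (hβ : 0 ≤ β) (hα : -1 < α) {E : Type*} [NormedAddCommGroup E]
    {F : (Fin N → ℝ) → E} (hF : AEStronglyMeasurable F (ensemble β α N)) (C : ℝ)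
    (h : ∀ lam ∈ orthant N, ‖F lam‖ ≤ C) : Integrable F (ensemble β α N) :=
  integrable_of_polyBdd hβ hα hF ((PolyBdd.const C).of_le fun lam hl =>
    (h lam hl).trans (le_abs_self C))

lemma integral_add_const_mul {Ω : Type*} [MeasurableSpace Ω] {μ : Measure Ω} {f g : Ω → ℂ}
    (hf : Integrable f μ) (c : ℂ) (hg : Integrable g μ) :
    Integrable (fun x => f x + c * g x) μ ∧
      ∫ x, (f x + c * g x) ∂μ = ∫ x, f x ∂μ + c * ∫ x, g x ∂μ := by
  refine ⟨hf.add (hg.const_mul c), ?_⟩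
  rw [integral_add hf (hg.const_mul c), integral_const_mul]

lemma integrable_resSum (hβ : 0 ≤ β) (hα : -1 < α) {z : ℂ} (hz : z ∈ cutPlane) (k : ℕ) :
    Integrable (resSum (N := N) k z) (ensemble β α N) :=
  integrable_of_bdd hβ hα (measurable_resSum k z).aestronglyMeasurable _
    fun _ hl => norm_resSum_le hz k hl

lemma hasDerivAt_inv_pow {z : ℂ} (hz : z ∈ cutPlane) (k : ℕ) {x : ℝ} (hx : 0 < x) :
    HasDerivAt (fun x : ℝ => (1 / (z - x)) ^ k) (k * (1 / (z - x)) ^ (k + 1)) x := by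
  have h0 := sub_ne_zero_of_mem_cutPlane hz hx.le
  have h1 : HasDerivAt (fun x : ℝ => z - (x : ℂ)) (-1) x :=
    (Complex.ofRealCLM.hasDerivAt (x := x)).const_sub z
  have h2 := (h1.fun_inv h0).fun_pow k
  simp only [one_div]
  refine h2.congr_deriv ?_
  rcases k with _ | k
  · simp
  · simp only [Nat.add_sub_cancel]
    generalize z - (x : ℂ) = a
    ring

lemma isTest_resSum_one {z : ℂ} (hz : z ∈ cutPlane) : IsTest (resSum (N := N) 1 z) := by
  have hg := gap_pos hz
  refine isTest_linearStat (f := fun x : ℝ => (1 / (z - x)) ^ 1)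
    (f' := fun x : ℝ => (1 : ℕ) * (1 / (z - x)) ^ (1 + 1))
    (C := 1 / gap z + (1 / gap z) ^ 2)
    (fun x hx => hasDerivAt_inv_pow hz 1 hx) (fun x hx => ?_) (fun x hx => ?_)
  · have := norm_inv_sub_le hz hx.le
    rw [norm_pow, pow_one]
    have : 0 ≤ (1 / gap z) ^ 2 := by positivity
    linarith
  · have h1 := norm_inv_sub_le hz hx.le
    have h2 : ‖1 / (z - x)‖ ^ 2 ≤ (1 / gap z) ^ 2 := by gcongr
    have : 0 ≤ 1 / gap z := by positivity
    simp only [Nat.cast_one, one_mul, norm_pow]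
    linarith

/-- The first loop equation, for the mean of the resolvent. The variance of the resolvent
enters as the pseudo-variance `∫ (R - ∫ R) ^ 2`. -/
theorem loop_equation_one (hβ : 0 ≤ β) (hα : -1 < α) {z : ℂ} (hz : z ∈ cutPlane) {m m₂ : ℂ}
    (hm : m = ∫ lam, resSum 1 z lam ∂ensemble β α N)
    (hm₂ : m₂ = ∫ lam, resSum 2 z lam ∂ensemble β α N) :
    (α - z) * m + N + (1 - β / 2) * (z * m₂) +
      β / 2 * (z * (m ^ 2 + ∫ lam, (resSum 1 z lam - m) ^ 2 ∂ensemble β α N)) = 0 := by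
  have := isProbabilityMeasure_ensemble (N := N) hβ hα
  have h := integral_resField (N := N) hβ hα hz (IsTest.const (1 : ℂ))
  have r1 := integrable_resSum (N := N) hβ hα hz 1
  have r2 := integrable_resSum (N := N) hβ hα hz 2
  have hY : Integrable (fun lam => resSum (N := N) 1 z lam - m) (ensemble β α N) :=
    r1.sub (integrable_const _)
  have hY2 : Integrable (fun lam => (resSum (N := N) 1 z lam - m) ^ 2) (ensemble β α N) := by
    refine integrable_of_bdd hβ hα (((measurable_resSum 1 z).sub_const m).pow_const
      2).aestronglyMeasurable ((N * (1 / gap z) ^ 1 + ‖m‖) ^ 2) fun lam hl => ?_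
    rw [norm_pow]
    gcongr
    exact (norm_sub_le _ _).trans (by gcongr; exact norm_resSum_le hz 1 hl)
  have hY0 : ∫ lam, (resSum 1 z lam - m) ∂ensemble β α N = 0 := by
    rw [integral_sub r1 (integrable_const _)]
    simp [hm]
  have e : ∀ lam : Fin N → ℝ, ∑ j, (lam j : ℂ) * (1 / (z - lam j)) *
      fderiv ℝ (fun _ : Fin N → ℝ => (1 : ℂ)) lam (Pi.single j 1) +
      (α * resSum 1 z lam - (z * resSum 1 z lam - N) + (1 - β / 2) * (z * resSum 2 z lam) +
        β / 2 * (z * resSum 1 z lam ^ 2)) * 1 =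
      ((α - z) * m + N + β / 2 * z * m ^ 2) +
      ((α - z) + β / 2 * z * (2 * m)) * (resSum 1 z lam - m) +
      ((1 - β / 2) * z) * resSum 2 z lam + (β / 2 * z) * (resSum 1 z lam - m) ^ 2 := by
    intro lam
    simp
    ring
  simp only [e] at h
  obtain ⟨i1, e1⟩ := integral_add_const_mul (μ := ensemble β α N)
    (integrable_const ((α - z) * m + N + β / 2 * z * m ^ 2)) ((α - z) + β / 2 * z * (2 * m)) hY
  obtain ⟨i2, e2⟩ := integral_add_const_mul i1 ((1 - β / 2) * z) r2
  rw [(integral_add_const_mul i2 _ hY2).2, e2, e1, hY0, ← hm₂] at h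
  simp only [integral_const, probReal_univ, one_smul] at h
  linear_combination h

/-- The second loop equation, for the pseudo-variance of the resolvent. -/
theorem loop_equation_two (hβ : 0 ≤ β) (hα : -1 < α) {z : ℂ} (hz : z ∈ cutPlane) {m m₂ : ℂ}
    (hm : m = ∫ lam, resSum 1 z lam ∂ensemble β α N)
    (hm₂ : m₂ = ∫ lam, resSum 2 z lam ∂ensemble β α N) :
    z * (∫ lam, resSum 3 z lam ∂ensemble β α N) - m₂ +
      (α - z + β / 2 * z * (2 * m)) * (∫ lam, (resSum 1 z lam - m) ^ 2 ∂ensemble β α N) +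
      (1 - β / 2) * z * (∫ lam, (resSum 1 z lam - m) * (resSum 2 z lam - m₂) ∂ensemble β α N) +
      β / 2 * z * (∫ lam, (resSum 1 z lam - m) ^ 3 ∂ensemble β α N) = 0 := by
  have := isProbabilityMeasure_ensemble (N := N) hβ hα
  have hF : IsTest fun lam : Fin N → ℝ => resSum 1 z lam + -m :=
    (isTest_resSum_one hz).add (IsTest.const (-m))
  have h := integral_resField (N := N) hβ hα hz hF
  have r1 := integrable_resSum (N := N) hβ hα hz 1
  have r2 := integrable_resSum (N := N) hβ hα hz 2
  have r3 := integrable_resSum (N := N) hβ hα hz 3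
  have bY : ∀ lam ∈ orthant N, ‖resSum 1 z lam - m‖ ≤ N * (1 / gap z) ^ 1 + ‖m‖ := fun lam hl =>
    (norm_sub_le _ _).trans (by gcongr; exact norm_resSum_le hz 1 hl)
  have bZ : ∀ lam ∈ orthant N, ‖resSum 2 z lam - m₂‖ ≤ N * (1 / gap z) ^ 2 + ‖m₂‖ := fun lam hl =>
    (norm_sub_le _ _).trans (by gcongr; exact norm_resSum_le hz 2 hl)
  have mY := (measurable_resSum (N := N) 1 z).sub_const m
  have mZ := (measurable_resSum (N := N) 2 z).sub_const m₂
  have hY : Integrable (fun lam => resSum (N := N) 1 z lam - m) (ensemble β α N) :=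
    r1.sub (integrable_const _)
  have hYp : ∀ k : ℕ, Integrable (fun lam => (resSum (N := N) 1 z lam - m) ^ k)
      (ensemble β α N) := fun k => by
    refine integrable_of_bdd hβ hα (mY.pow_const k).aestronglyMeasurable
      ((N * (1 / gap z) ^ 1 + ‖m‖) ^ k) fun lam hl => ?_
    rw [norm_pow]
    gcongr
    exact bY lam hl
  have hYZ : Integrable (fun lam => (resSum (N := N) 1 z lam - m) * (resSum 2 z lam - m₂))
      (ensemble β α N) := by
    refine integrable_of_bdd hβ hα (mY.mul mZ).aestronglyMeasurable
      ((N * (1 / gap z) ^ 1 + ‖m‖) * (N * (1 / gap z) ^ 2 + ‖m₂‖)) fun lam hl => ?_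
    rw [norm_mul]
    have := bY lam hl
    have := bZ lam hl
    gcongr
    exact (norm_nonneg _).trans (bY lam hl)
  have hY0 : ∫ lam, (resSum 1 z lam - m) ∂ensemble β α N = 0 := by
    rw [integral_sub r1 (integrable_const _)]
    simp [hm]
  have e : ∀ lam ∈ orthant N, ∑ j, (lam j : ℂ) * (1 / (z - lam j)) *
      fderiv ℝ (fun lam : Fin N → ℝ => resSum 1 z lam + -m) lam (Pi.single j 1) +
      (α * resSum 1 z lam - (z * resSum 1 z lam - N) + (1 - β / 2) * (z * resSum 2 z lam) +
        β / 2 * (z * resSum 1 z lam ^ 2)) * (resSum 1 z lam + -m) =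
      (z * resSum 3 z lam + (-1) * resSum 2 z lam) +
      ((α - z) * m + N + (1 - β / 2) * z * m₂ + β / 2 * z * m ^ 2) * (resSum 1 z lam - m) +
      (α - z + β / 2 * z * (2 * m)) * (resSum 1 z lam - m) ^ 2 +
      ((1 - β / 2) * z) * ((resSum 1 z lam - m) * (resSum 2 z lam - m₂)) +
      (β / 2 * z) * (resSum 1 z lam - m) ^ 3 := by
    intro lam hl
    have h1 : ∀ j, fderiv ℝ (fun lam : Fin N → ℝ => resSum 1 z lam + -m) lam (Pi.single j 1) =
        (1 / (z - lam j)) ^ 2 := by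
      intro j
      rw [fderiv_add_const]
      have := fderiv_linearStat (f := fun x : ℝ => (1 / (z - x)) ^ 1)
        (f' := fun x : ℝ => (1 : ℕ) * (1 / (z - x)) ^ (1 + 1))
        (fun x hx => hasDerivAt_inv_pow hz 1 hx) hl (Pi.single j 1)
      simp only [Nat.cast_one, one_mul] at this
      have h2 : fderiv ℝ (resSum (N := N) 1 z) lam (Pi.single j 1) = _ := this
      rw [h2]
      simp [Pi.single_apply]
    have h3 : ∑ j, (lam j : ℂ) * (1 / (z - lam j)) * (1 / (z - lam j)) ^ 2 =
        z * resSum 3 z lam - resSum 2 z lam := by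
      simp only [resSum, Finset.mul_sum, ← Finset.sum_sub_distrib]
      refine Finset.sum_congr rfl fun j _ => ?_
      have := sub_ne_zero_of_mem_cutPlane hz (hl j).le
      field_simp
      ring
    simp only [h1, h3]
    ring
  have h' : ∫ lam, ((z * resSum 3 z lam + (-1) * resSum 2 z lam) +
      ((α - z) * m + N + (1 - β / 2) * z * m₂ + β / 2 * z * m ^ 2) * (resSum 1 z lam - m) +
      (α - z + β / 2 * z * (2 * m)) * (resSum 1 z lam - m) ^ 2 +
      ((1 - β / 2) * z) * ((resSum 1 z lam - m) * (resSum 2 z lam - m₂)) +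
      (β / 2 * z) * (resSum 1 z lam - m) ^ 3) ∂ensemble β α N = 0 := by
    rw [← h]
    refine integral_congr_ae ?_
    filter_upwards [ensemble_ae_mem_orthant] with lam hl
    exact (e lam hl).symm
  obtain ⟨i1, e1⟩ := integral_add_const_mul (r3.const_mul z) (-1) r2
  obtain ⟨i2, e2⟩ := integral_add_const_mul i1
    ((α - z) * m + N + (1 - β / 2) * z * m₂ + β / 2 * z * m ^ 2) hY
  obtain ⟨i3, e3⟩ := integral_add_const_mul i2 (α - z + β / 2 * z * (2 * m)) (hYp 2)
  obtain ⟨i4, e4⟩ := integral_add_const_mul i3 ((1 - β / 2) * z) hYZ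
  rw [(integral_add_const_mul i4 _ (hYp 3)).2, e4, e3, e2, e1, hY0, ← hm₂, integral_const_mul] at h'
  linear_combination h'

/-- Derivatives in `z` of the mean resolvent sums. -/
lemma hasDerivAt_integral_resSum (hβ : 0 ≤ β) (hα : -1 < α) {z : ℂ} (hz : z ∈ cutPlane) (k : ℕ) :
    HasDerivAt (fun z => ∫ lam, resSum (N := N) k z lam ∂ensemble β α N)
      (-k * ∫ lam, resSum (N := N) (k + 1) z lam ∂ensemble β α N) z := by
  have := isProbabilityMeasure_ensemble (N := N) hβ hα
  have hg := gap_pos hz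
  set U : Set ℂ := {w | gap z / 2 < gap w} ∩ cutPlane with hU
  have hUn : U ∈ 𝓝 z := ((isOpen_lt continuous_const continuous_gap).inter
    isOpen_cutPlane).mem_nhds ⟨by simp only [Set.mem_ofPred_eq]; linarith, hz⟩
  have h := hasDerivAt_integral_of_dominated_loc_of_deriv_le (μ := ensemble β α N)
    (F := fun z lam => resSum (N := N) k z lam)
    (F' := fun z lam => -k * resSum (N := N) (k + 1) z lam) (x₀ := z) (s := U)
    (bound := fun _ => k * (N * (1 / (gap z / 2)) ^ (k + 1))) hUn
    (Eventually.of_forall fun w => (measurable_resSum k w).aestronglyMeasurable)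
    (integrable_resSum hβ hα hz k)
    (((measurable_resSum (k + 1) z).const_mul _).aestronglyMeasurable) ?_ (integrable_const _) ?_
  · rw [← integral_const_mul]
    exact h.2
  · filter_upwards [ensemble_ae_mem_orthant] with lam hl w hw
    rw [norm_mul, norm_neg, Complex.norm_natCast]
    have h0 := gap_pos hw.2
    have h1 : gap z / 2 ≤ gap w := le_of_lt hw.1
    gcongr
    refine (norm_resSum_le hw.2 _ hl).trans ?_
    gcongr
  · filter_upwards [ensemble_ae_mem_orthant] with lam hl w hw
    unfold resSum
    rw [Finset.mul_sum]
    refine HasDerivAt.fun_sum fun j _ => ?_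
    have h0 := sub_ne_zero_of_mem_cutPlane hw.2 (hl j).le
    have h2 := (((hasDerivAt_id w).sub_const (lam j : ℂ)).fun_inv h0).fun_pow k
    simp only [one_div]
    refine h2.congr_deriv ?_
    rcases k with _ | k
    · simp
    · simp only [Nat.add_sub_cancel, id]
      generalize w - (lam j : ℂ) = a
      push_cast
      ring

end

/-! ### Scaled loop equations and fluctuation bounds -/

section

variable {N : ℕ} {α β : ℝ}

/-- The length scale `N κ` of the spectrum. -/
def scale (β : ℝ) (N : ℕ) : ℝ := N * (β / 2)

/-- The scaled resolvent per particle, so that `W₁ = N * meanRes`. -/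
def meanRes (β α : ℝ) (N : ℕ) (s : ℂ) : ℂ :=
  (β / 2 : ℝ) * ∫ lam, resSum (N := N) 1 (scale β N * s) lam ∂ensemble β α N

/-- The derivative of `meanRes`. -/
def meanResDeriv (β α : ℝ) (N : ℕ) (s : ℂ) : ℂ :=
  -((β / 2 : ℝ) * scale β N) * ∫ lam, resSum (N := N) 2 (scale β N * s) lam ∂ensemble β α N

/-- The second derivative of `meanRes`. -/
def meanResDerivTwo (β α : ℝ) (N : ℕ) (s : ℂ) : ℂ :=
  2 * ((β / 2 : ℝ) * scale β N ^ 2) *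
    ∫ lam, resSum (N := N) 3 (scale β N * s) lam ∂ensemble β α N

/-- The deviation of the scaled `k`-th resolvent sum from its mean. -/
def devRes (β α : ℝ) (N k : ℕ) (s : ℂ) (lam : Fin N → ℝ) : ℂ :=
  resSum (N := N) k (scale β N * s) lam -
    ∫ mu, resSum (N := N) k (scale β N * s) mu ∂ensemble β α N

/-- The pseudo-variance of the scaled resolvent; squares are taken without conjugation, as in the
loop equations. -/
def varRes (β α : ℝ) (N : ℕ) (s : ℂ) : ℂ :=
  (β / 2 : ℝ) ^ 2 * ∫ lam, devRes β α N 1 s lam ^ 2 ∂ensemble β α N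

/-- The third central pseudo-moment of the scaled resolvent. -/
def cubeRes (β α : ℝ) (N : ℕ) (s : ℂ) : ℂ :=
  (β / 2 : ℝ) ^ 3 * ∫ lam, devRes β α N 1 s lam ^ 3 ∂ensemble β α N

/-- The pseudo-covariance of the scaled resolvent and of its derivative. -/
def covRes (β α : ℝ) (N : ℕ) (s : ℂ) : ℂ :=
  -((β / 2 : ℝ) ^ 2 * scale β N) *
    ∫ lam, devRes β α N 1 s lam * devRes β α N 2 s lam ∂ensemble β α N

lemma scale_pos (hβ : 0 < β) (hN : 0 < N) : 0 < scale β N := by unfold scale; positivity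

lemma scaledResolvent_eq (s : ℂ) : scaledResolvent β α N s = N * meanRes β α N s := by
  unfold scaledResolvent meanRes resolvent resSum scale
  simp only [pow_one]
  push_cast
  ring

lemma scale_mul_gap_le {c : ℝ} (hc : 0 < c) (s : ℂ) : c * gap s ≤ gap (c * s) := by
  refine (Metric.le_infDist (Set.image_nonempty.2 ⟨0, Set.mem_Ici.2 le_rfl⟩)).2 ?_
  rintro _ ⟨x, hx, rfl⟩
  have hx : 0 ≤ x := hx
  have h := gap_le s (div_nonneg hx hc.le)
  have e : (c : ℂ) * s - x = c * (s - ((x / c : ℝ) : ℂ)) := by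
    have : (c : ℂ) ≠ 0 := by exact_mod_cast hc.ne'
    push_cast
    field_simp
  rw [dist_eq_norm]
  simp only [e, norm_mul, Complex.norm_real, Real.norm_eq_abs, abs_of_pos hc]
  gcongr

lemma norm_inv_scale_sub_le {c : ℝ} (hc : 0 < c) {s : ℂ} (hs : s ∈ cutPlane) {x : ℝ} (hx : 0 ≤ x) :
    ‖1 / (c * s - x)‖ ≤ 1 / (c * gap s) := by
  have := gap_pos hs
  refine (norm_inv_sub_le (mul_mem_cutPlane hs hc) hx).trans ?_
  gcongr
  exact scale_mul_gap_le hc s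

lemma hasDerivAt_integral_resSum_scale (hβ : 0 < β) (hα : -1 < α) (hN : 0 < N) {s : ℂ}
    (hs : s ∈ cutPlane) (k : ℕ) :
    HasDerivAt (fun s => ∫ lam, resSum (N := N) k (scale β N * s) lam ∂ensemble β α N)
      (-k * scale β N *
        ∫ lam, resSum (N := N) (k + 1) (scale β N * s) lam ∂ensemble β α N) s := by
  have h := hasDerivAt_integral_resSum (N := N) hβ.le hα
    (mul_mem_cutPlane hs (scale_pos hβ hN)) k
  have h2 := h.comp s ((hasDerivAt_id s).const_mul (scale β N : ℂ))
  refine h2.congr_deriv ?_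
  ring

lemma hasDerivAt_meanRes (hβ : 0 < β) (hα : -1 < α) (hN : 0 < N) {s : ℂ} (hs : s ∈ cutPlane) :
    HasDerivAt (meanRes β α N) (meanResDeriv β α N s) s := by
  refine ((hasDerivAt_integral_resSum_scale hβ hα hN hs 1).const_mul _).congr_deriv ?_
  unfold meanResDeriv
  push_cast
  ring

lemma hasDerivAt_meanResDeriv (hβ : 0 < β) (hα : -1 < α) (hN : 0 < N) {s : ℂ}
    (hs : s ∈ cutPlane) :
    HasDerivAt (meanResDeriv β α N) (meanResDerivTwo β α N s) s := by
  refine ((hasDerivAt_integral_resSum_scale hβ hα hN hs 2).const_mul _).congr_deriv ?_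
  unfold meanResDerivTwo
  push_cast
  ring

lemma norm_integral_resSum_scale_le (hβ : 0 < β) (hα : -1 < α) (hN : 0 < N) {s : ℂ}
    (hs : s ∈ cutPlane) (k : ℕ) :
    ‖∫ lam, resSum (N := N) k (scale β N * s) lam ∂ensemble β α N‖ ≤
      N * (1 / (scale β N * gap s)) ^ k := by
  have := isProbabilityMeasure_ensemble (N := N) hβ.le hα
  have hc := scale_pos hβ hN
  have hg := gap_pos hs
  refine (norm_integral_le_of_norm_le_const (C := N * (1 / (scale β N * gap s)) ^ k) ?_).trans
    (by simp)
  filter_upwards [ensemble_ae_mem_orthant] with lam hl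
  refine (norm_resSum_le (mul_mem_cutPlane hs hc) k hl).trans ?_
  have := mul_pos hc hg
  have := gap_pos (mul_mem_cutPlane hs hc)
  gcongr
  exact scale_mul_gap_le hc s

lemma norm_meanRes_le (hβ : 0 < β) (hα : -1 < α) (hN : 0 < N) {s : ℂ} (hs : s ∈ cutPlane) :
    ‖meanRes β α N s‖ ≤ 1 / gap s := by
  have h := norm_integral_resSum_scale_le (α := α) hβ hα hN hs 1
  have hc := scale_pos hβ hN
  have hg := gap_pos hs
  rw [meanRes, norm_mul, Complex.norm_real, Real.norm_of_nonneg (by positivity)]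
  refine (mul_le_mul_of_nonneg_left h (by positivity)).trans (le_of_eq ?_)
  unfold scale at hc ⊢
  have : (N : ℝ) ≠ 0 := by positivity
  field_simp

lemma norm_meanResDeriv_le (hβ : 0 < β) (hα : -1 < α) (hN : 0 < N) {s : ℂ} (hs : s ∈ cutPlane) :
    ‖meanResDeriv β α N s‖ ≤ 1 / gap s ^ 2 := by
  have h := norm_integral_resSum_scale_le (α := α) hβ hα hN hs 2
  have hc := scale_pos hβ hN
  have hg := gap_pos hs
  rw [meanResDeriv, norm_mul, norm_neg, norm_mul, Complex.norm_real, Complex.norm_real,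
    Real.norm_of_nonneg (by positivity), Real.norm_of_nonneg hc.le]
  refine (mul_le_mul_of_nonneg_left h (by positivity)).trans (le_of_eq ?_)
  unfold scale at hc ⊢
  have : (N : ℝ) ≠ 0 := by positivity
  field_simp

/-- The first loop equation in scaled variables. -/
theorem scaled_loop_one (hβ : 0 < β) (hα : -1 < α) (hN : 0 < N) {s : ℂ} (hs : s ∈ cutPlane) :
    s * meanRes β α N s ^ 2 + s * varRes β α N s +
      (β / 2 - 1) / (β / 2 * N) * (s * meanResDeriv β α N s) + α / (β / 2 * N) * meanRes β α N s -
      s * meanRes β α N s + 1 = 0 := by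
  have hc := scale_pos hβ hN
  have h := loop_equation_one (N := N) hβ.le hα (mul_mem_cutPlane hs hc) rfl rfl
  have hN' : (N : ℂ) ≠ 0 := by exact_mod_cast hN.ne'
  have hβ' : (β : ℂ) ≠ 0 := by exact_mod_cast hβ.ne'
  unfold meanRes meanResDeriv varRes devRes
  set m := ∫ lam, resSum (N := N) 1 (scale β N * s) lam ∂ensemble β α N
  set m₂ := ∫ lam, resSum (N := N) 2 (scale β N * s) lam ∂ensemble β α N
  set v := ∫ lam, (resSum (N := N) 1 (scale β N * s) lam - m) ^ 2 ∂ensemble β α N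
  clear_value m m₂ v
  unfold scale at h ⊢
  push_cast at h ⊢
  field_simp
  linear_combination 4 * h

/-- The second loop equation in scaled variables. -/
theorem scaled_loop_two (hβ : 0 < β) (hα : -1 < α) (hN : 0 < N) {s : ℂ} (hs : s ∈ cutPlane) :
    (2 * s * meanRes β α N s - s + α / (β / 2 * N)) * varRes β α N s + s * cubeRes β α N s +
      (β / 2 - 1) / (β / 2 * N) * (s * covRes β α N s) +
      1 / (β / 2 * N ^ 2) * (meanResDeriv β α N s + s * meanResDerivTwo β α N s / 2) = 0 := by
  have hc := scale_pos hβ hN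
  have h := loop_equation_two (N := N) hβ.le hα (mul_mem_cutPlane hs hc) rfl rfl
  have hN' : (N : ℂ) ≠ 0 := by exact_mod_cast hN.ne'
  have hβ' : (β : ℂ) ≠ 0 := by exact_mod_cast hβ.ne'
  unfold meanRes meanResDeriv varRes cubeRes covRes meanResDerivTwo devRes
  set m := ∫ lam, resSum (N := N) 1 (scale β N * s) lam ∂ensemble β α N
  set m₂ := ∫ lam, resSum (N := N) 2 (scale β N * s) lam ∂ensemble β α N
  set m₃ := ∫ lam, resSum (N := N) 3 (scale β N * s) lam ∂ensemble β α N
  set v := ∫ lam, (resSum (N := N) 1 (scale β N * s) lam - m) ^ 2 ∂ensemble β α N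
  set t := ∫ lam, (resSum (N := N) 1 (scale β N * s) lam - m) ^ 3 ∂ensemble β α N
  set c := ∫ lam, (resSum (N := N) 1 (scale β N * s) lam - m) *
    (resSum (N := N) 2 (scale β N * s) lam - m₂) ∂ensemble β α N
  clear_value m m₂ m₃ v t c
  unfold scale at h ⊢
  push_cast at h ⊢
  field_simp
  linear_combination 4 * β * h

/-- The local bound for the fluctuations of the scaled resolvent; it is `x ‖s - x‖⁻⁴` bounded
through `x ≤ ‖s - x‖ + ‖s‖`. -/
def fluctBound (s : ℂ) : ℝ := 1 / gap s ^ 3 + ‖s‖ / gap s ^ 4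

lemma fluctBound_nonneg {s : ℂ} (hs : s ∈ cutPlane) : 0 ≤ fluctBound s := by
  have := gap_pos hs
  unfold fluctBound
  positivity

lemma mul_norm_inv_pow_le {c : ℝ} (hc : 0 < c) {s : ℂ} (hs : s ∈ cutPlane) {x : ℝ} (hx : 0 < x) :
    x * ‖1 / (c * s - x)‖ ^ 4 ≤ fluctBound s / c ^ 3 := by
  have hg := gap_pos hs
  have h0 : (c : ℂ) * s - x ≠ 0 := sub_ne_zero_of_mem_cutPlane (mul_mem_cutPlane hs hc) hx.le
  have h1 := norm_inv_scale_sub_le hc hs hx.le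
  have hx' : x ≤ c * ‖s‖ + ‖(c : ℂ) * s - x‖ := by
    calc x = ‖(x : ℂ)‖ := by rw [Complex.norm_real, Real.norm_of_nonneg hx.le]
      _ = ‖(c : ℂ) * s - ((c : ℂ) * s - x)‖ := by ring_nf
      _ ≤ ‖(c : ℂ) * s‖ + ‖(c : ℂ) * s - x‖ := norm_sub_le _ _
      _ = _ := by rw [norm_mul, Complex.norm_real, Real.norm_of_nonneg hc.le]
  have hp : 0 < ‖(c : ℂ) * s - x‖ := norm_pos_iff.2 h0
  set p := ‖(c : ℂ) * s - x‖
  have e : ‖1 / ((c : ℂ) * s - x)‖ = 1 / p := by rw [norm_div, norm_one]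
  rw [e] at h1 ⊢
  have hp1 : 0 < 1 / p := by positivity
  calc x * (1 / p) ^ 4 ≤ (c * ‖s‖ + p) * (1 / p) ^ 4 := by gcongr
    _ = c * ‖s‖ * (1 / p) ^ 4 + (1 / p) ^ 3 := by field_simp
    _ ≤ c * ‖s‖ * (1 / (c * gap s)) ^ 4 + (1 / (c * gap s)) ^ 3 := by gcongr
    _ = fluctBound s / c ^ 3 := by
      unfold fluctBound
      field_simp
      ring

/-- Central moments of the first resolvent sum. -/
lemma moments_devRes_one (hβ : 0 < β) (hα : -1 < α) (hN : 0 < N) {s : ℂ} (hs : s ∈ cutPlane) :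
    ∫ lam, ‖devRes β α N 1 s lam‖ ^ 2 ∂ensemble β α N ≤
      2 * (N * (fluctBound s / scale β N ^ 3)) ∧
    ∫ lam, ‖devRes β α N 1 s lam‖ ^ 4 ∂ensemble β α N ≤
      20 * (N * (fluctBound s / scale β N ^ 3)) ^ 2 := by
  have hc := scale_pos hβ hN
  have hg := gap_pos hs
  have hz := mul_mem_cutPlane hs hc
  refine moments_linearStat_complex_le hβ.le hα hN (f := fun x : ℝ => (1 / (scale β N * s - x)) ^ 1)
    (f' := fun x : ℝ => (1 : ℕ) * (1 / (scale β N * s - x)) ^ (1 + 1))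
    (C := 1 / (scale β N * gap s) + (1 / (scale β N * gap s)) ^ 2) (by fun_prop)
    (fun x hx => hasDerivAt_inv_pow hz 1 hx) (fun x hx => ?_) (fun x hx => ?_) (fun x hx => ?_)
  · have := norm_inv_scale_sub_le hc hs hx.le
    rw [norm_pow, pow_one]
    have : 0 ≤ (1 / (scale β N * gap s)) ^ 2 := by positivity
    linarith
  · have h1 := norm_inv_scale_sub_le hc hs hx.le
    have h2 : ‖1 / (scale β N * s - x)‖ ^ 2 ≤ (1 / (scale β N * gap s)) ^ 2 := by gcongr
    have : 0 ≤ 1 / (scale β N * gap s) := by positivity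
    simp only [Nat.cast_one, one_mul, norm_pow]
    linarith
  · have := mul_norm_inv_pow_le hc hs hx
    simp only [Nat.cast_one, one_mul, norm_pow, ← pow_mul]
    exact this

/-- The variance of the second resolvent sum. -/
lemma moments_devRes_two (hβ : 0 < β) (hα : -1 < α) (hN : 0 < N) {s : ℂ} (hs : s ∈ cutPlane) :
    ∫ lam, ‖devRes β α N 2 s lam‖ ^ 2 ∂ensemble β α N ≤
      2 * (N * (4 * (fluctBound s / scale β N ^ 3) * (1 / (scale β N * gap s)) ^ 2)) := by
  have hc := scale_pos hβ hN
  have hg := gap_pos hs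
  have hz := mul_mem_cutPlane hs hc
  refine (moments_linearStat_complex_le hβ.le hα hN
    (f := fun x : ℝ => (1 / (scale β N * s - x)) ^ 2)
    (f' := fun x : ℝ => (2 : ℕ) * (1 / (scale β N * s - x)) ^ (2 + 1))
    (C := 2 * (1 / (scale β N * gap s)) ^ 3 + (1 / (scale β N * gap s)) ^ 2) (by fun_prop)
    (fun x hx => hasDerivAt_inv_pow hz 2 hx) (fun x hx => ?_) (fun x hx => ?_) (fun x hx => ?_)).1
  · have h1 := norm_inv_scale_sub_le hc hs hx.le
    have h2 : ‖1 / (scale β N * s - x)‖ ^ 2 ≤ (1 / (scale β N * gap s)) ^ 2 := by gcongr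
    rw [norm_pow]
    have : 0 ≤ (1 / (scale β N * gap s)) ^ 3 := by positivity
    linarith
  · have h1 := norm_inv_scale_sub_le hc hs hx.le
    have h2 : ‖1 / (scale β N * s - x)‖ ^ 3 ≤ (1 / (scale β N * gap s)) ^ 3 := by gcongr
    have : 0 ≤ (1 / (scale β N * gap s)) ^ 2 := by positivity
    simp only [norm_mul, norm_pow, Nat.cast_ofNat, Complex.norm_ofNat]
    linarith
  · have h0 := mul_norm_inv_pow_le hc hs hx
    have h1 := norm_inv_scale_sub_le hc hs hx.le
    have h2 : ‖1 / (scale β N * s - x)‖ ^ 2 ≤ (1 / (scale β N * gap s)) ^ 2 := by gcongr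
    have e : x * ‖((2 : ℕ) : ℂ) * (1 / (scale β N * s - x)) ^ (2 + 1)‖ ^ 2 =
        4 * (x * ‖1 / (scale β N * s - x)‖ ^ 4) * ‖1 / (scale β N * s - x)‖ ^ 2 := by
      simp only [norm_mul, norm_pow, Nat.cast_ofNat, Complex.norm_ofNat]
      ring
    rw [e]
    have := fluctBound_nonneg hs
    gcongr

lemma integrable_norm_devRes_pow (hβ : 0 < β) (hα : -1 < α) (hN : 0 < N) {s : ℂ}
    (hs : s ∈ cutPlane) (k p : ℕ) :
    Integrable (fun lam => ‖devRes β α N k s lam‖ ^ p) (ensemble β α N) := by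
  have hz := mul_mem_cutPlane hs (scale_pos hβ hN)
  refine integrable_of_bdd hβ.le hα
    (((measurable_resSum k _).sub_const _).norm.pow_const p).aestronglyMeasurable
    ((N * (1 / gap (scale β N * s)) ^ k +
      ‖∫ mu, resSum (N := N) k (scale β N * s) mu ∂ensemble β α N‖) ^ p) fun lam hl => ?_
  rw [norm_pow, norm_norm]
  gcongr
  exact (norm_sub_le _ _).trans (by gcongr; exact norm_resSum_le hz k hl)

lemma norm_varRes_le (hβ : 0 < β) (hα : -1 < α) (hN : 0 < N) {s : ℂ} (hs : s ∈ cutPlane) :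
    ‖varRes β α N s‖ ≤ 2 * fluctBound s / (β / 2 * N ^ 2) := by
  have h := (moments_devRes_one hβ hα hN hs).1
  have h2 : ‖∫ lam, devRes β α N 1 s lam ^ 2 ∂ensemble β α N‖ ≤
      2 * (N * (fluctBound s / scale β N ^ 3)) := by
    refine (norm_integral_le_integral_norm _).trans (le_trans (le_of_eq ?_) h)
    simp only [norm_pow]
  rw [varRes, norm_mul, norm_pow, Complex.norm_real, Real.norm_of_nonneg (by positivity)]
  refine (mul_le_mul_of_nonneg_left h2 (by positivity)).trans (le_of_eq ?_)
  unfold scale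
  have : (N : ℝ) ≠ 0 := by positivity
  field_simp

lemma norm_cubeRes_le (hβ : 0 < β) (hα : -1 < α) (hN : 0 < N) {s : ℂ} (hs : s ∈ cutPlane) :
    ‖cubeRes β α N s‖ ≤ (fluctBound s / (β / 2) + 10 * fluctBound s ^ 2 / (β / 2) ^ 2) / N ^ 3 := by
  obtain ⟨h, h'⟩ := moments_devRes_one hβ hα hN hs
  have hN' : (0 : ℝ) < N := by positivity
  have hb := fluctBound_nonneg hs
  have i2 := integrable_norm_devRes_pow hβ hα hN hs 1 2
  have i3 := integrable_norm_devRes_pow hβ hα hN hs 1 3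
  have i4 := integrable_norm_devRes_pow hβ hα hN hs 1 4
  have hc := scale_pos hβ hN
  -- weighting `t³ ≤ (t² / u + u t⁴) / 2` with `u = scale` balances the two terms
  have h3 : ∫ lam, ‖devRes β α N 1 s lam‖ ^ 3 ∂ensemble β α N ≤
      1 / (2 * (scale β N)) * (∫ lam, ‖devRes β α N 1 s lam‖ ^ 2 ∂ensemble β α N) +
      (scale β N) / 2 * (∫ lam, ‖devRes β α N 1 s lam‖ ^ 4 ∂ensemble β α N) := by
    rw [← integral_const_mul, ← integral_const_mul,
      ← integral_add (i2.const_mul _) (i4.const_mul _)]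
    refine integral_mono i3 ((i2.const_mul _).add (i4.const_mul _)) fun lam => ?_
    set t := ‖devRes β α N 1 s lam‖
    have : 1 / (2 * scale β N) * t ^ 2 + scale β N / 2 * t ^ 4 - t ^ 3 =
        1 / (2 * scale β N) * (t - scale β N * t ^ 2) ^ 2 := by
      field_simp
      ring
    have : 0 ≤ 1 / (2 * scale β N) * (t - scale β N * t ^ 2) ^ 2 := by positivity
    linarith
  have h4 : ‖∫ lam, devRes β α N 1 s lam ^ 3 ∂ensemble β α N‖ ≤
      1 / (2 * scale β N) * (2 * (N * (fluctBound s / scale β N ^ 3))) +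
      scale β N / 2 * (20 * (N * (fluctBound s / scale β N ^ 3)) ^ 2) := by
    refine (norm_integral_le_integral_norm _).trans ?_
    simp only [norm_pow]
    refine h3.trans ?_
    gcongr
  rw [cubeRes, norm_mul, norm_pow, Complex.norm_real, Real.norm_of_nonneg (by positivity)]
  refine (mul_le_mul_of_nonneg_left h4 (by positivity)).trans (le_of_eq ?_)
  unfold scale
  field_simp
  ring

/-- The weights in the arithmetic-geometric mean inequality balance the two variances, of orders
`N⁻²` and `N⁻⁴`. -/
lemma norm_covRes_le (hβ : 0 < β) (hα : -1 < α) (hN : 0 < N) {s : ℂ} (hs : s ∈ cutPlane) :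
    ‖covRes β α N s‖ ≤ (1 + 4 / gap s ^ 2) * fluctBound s / (β / 2 * N ^ 2) := by
  have h1 := (moments_devRes_one hβ hα hN hs).1
  have h2 := moments_devRes_two hβ hα hN hs
  have hg := gap_pos hs
  have hN' : (0 : ℝ) < N := by positivity
  have hc := scale_pos hβ hN
  have i1 := integrable_norm_devRes_pow hβ hα hN hs 1 2
  have i2 := integrable_norm_devRes_pow hβ hα hN hs 2 2
  have h3 : ‖∫ lam, devRes β α N 1 s lam * devRes β α N 2 s lam ∂ensemble β α N‖ ≤
      1 / (2 * scale β N) * (∫ lam, ‖devRes β α N 1 s lam‖ ^ 2 ∂ensemble β α N) +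
      scale β N / 2 * (∫ lam, ‖devRes β α N 2 s lam‖ ^ 2 ∂ensemble β α N) := by
    rw [← integral_const_mul, ← integral_const_mul,
      ← integral_add (i1.const_mul _) (i2.const_mul _)]
    refine norm_integral_le_of_norm_le ((i1.const_mul _).add (i2.const_mul _))
      (Eventually.of_forall fun lam => ?_)
    rw [norm_mul]
    set t := ‖devRes β α N 1 s lam‖
    set u := ‖devRes β α N 2 s lam‖
    have : 1 / (2 * scale β N) * t ^ 2 + scale β N / 2 * u ^ 2 - t * u =
        1 / (2 * scale β N) * (t - scale β N * u) ^ 2 := by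
      field_simp
      ring
    have : 0 ≤ 1 / (2 * scale β N) * (t - scale β N * u) ^ 2 := by positivity
    linarith
  have h4 : ‖∫ lam, devRes β α N 1 s lam * devRes β α N 2 s lam ∂ensemble β α N‖ ≤
      1 / (2 * scale β N) * (2 * (N * (fluctBound s / scale β N ^ 3))) +
      scale β N / 2 *
        (2 * (N * (4 * (fluctBound s / scale β N ^ 3) * (1 / (scale β N * gap s)) ^ 2))) := by
    refine h3.trans ?_
    gcongr
  have e : ‖-(((β / 2 : ℝ) : ℂ) ^ 2 * scale β N)‖ = (β / 2) ^ 2 * scale β N := by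
    rw [norm_neg, norm_mul, norm_pow, Complex.norm_real, Complex.norm_real,
      Real.norm_of_nonneg hc.le, Real.norm_of_nonneg (by positivity)]
  rw [covRes, norm_mul, e]
  refine (mul_le_mul_of_nonneg_left h4 (by positivity)).trans (le_of_eq ?_)
  unfold scale
  field_simp

lemma continuousOn_fluctBound : ContinuousOn fluctBound cutPlane := by
  unfold fluctBound
  have h := continuous_gap
  refine (continuousOn_const.div (by fun_prop) fun s hs => ?_).add
    (ContinuousOn.div (by fun_prop) (by fun_prop) fun s hs => ?_)
  · exact pow_ne_zero _ (gap_pos hs).ne'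
  · exact pow_ne_zero _ (gap_pos hs).ne'

end

/-! ### The coefficients of the expansion -/

section

/-- The branch of `√(1 - 4 / s)` on the cut plane that tends to `1` at infinity. -/
def rt (s : ℂ) : ℂ := (4 - s) ^ (2⁻¹ : ℂ) / (-s) ^ (2⁻¹ : ℂ)

lemma neg_mem_slitPlane {s : ℂ} (hs : s ∈ cutPlane) : -s ∈ Complex.slitPlane := by
  rcases hs with h | h
  · right; simpa using h
  · left; simpa using h

lemma four_sub_mem_slitPlane {s : ℂ} (hs : s ∈ cutPlane) : 4 - s ∈ Complex.slitPlane := by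
  rcases hs with h | h
  · right; simpa using h
  · left
    simp only [Complex.sub_re, Complex.re_ofNat]
    linarith

lemma ne_zero_of_mem_cutPlane {s : ℂ} (hs : s ∈ cutPlane) : s ≠ 0 := by
  have := sub_ne_zero_of_mem_cutPlane hs (le_refl 0)
  simpa using this

lemma sub_four_ne_zero {s : ℂ} (hs : s ∈ cutPlane) : s - 4 ≠ 0 := by
  have := sub_ne_zero_of_mem_cutPlane hs (show (0 : ℝ) ≤ 4 by norm_num)
  simpa using this

lemma re_cpow_half_pos {z : ℂ} (hz : z ∈ Complex.slitPlane) : 0 < (z ^ (2⁻¹ : ℂ)).re := by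
  have h0 := Complex.slitPlane_ne_zero hz
  rw [Complex.cpow_def_of_ne_zero h0, Complex.exp_re]
  refine mul_pos (Real.exp_pos _) (Real.cos_pos_of_mem_Ioo ?_)
  have h1 := Complex.neg_pi_lt_arg z
  have h2 := Complex.arg_le_pi z
  have h3 := Complex.mem_slitPlane_iff_arg.1 hz
  have h4 : (Complex.log z * 2⁻¹).im = z.arg / 2 := by
    have : (2⁻¹ : ℂ) = ((2⁻¹ : ℝ) : ℂ) := by norm_num
    rw [this, Complex.im_mul_ofReal, Complex.log_im]
    ring
  rw [h4]
  have h5 := lt_of_le_of_ne h2 h3.1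
  exact ⟨by linarith, by linarith⟩

lemma cpow_half_ne_zero {z : ℂ} (hz : z ∈ Complex.slitPlane) : z ^ (2⁻¹ : ℂ) ≠ 0 := fun h => by
  have := re_cpow_half_pos hz
  rw [h] at this
  simp at this

lemma cpow_half_sq (z : ℂ) : (z ^ (2⁻¹ : ℂ)) ^ 2 = z := Complex.cpow_ofNat_inv_pow z 2

lemma rt_ne_zero {s : ℂ} (hs : s ∈ cutPlane) : rt s ≠ 0 :=
  div_ne_zero (cpow_half_ne_zero (four_sub_mem_slitPlane hs))
    (cpow_half_ne_zero (neg_mem_slitPlane hs))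

/-- The algebraic relation `r² = 1 - 4 / s`. -/
lemma mul_rt_sq {s : ℂ} (hs : s ≠ 0) : s * rt s ^ 2 = s - 4 := by
  rw [rt, div_pow, cpow_half_sq, cpow_half_sq]
  field_simp
  ring

lemma hasDerivAt_cpow_half {z : ℂ} (hz : z ∈ Complex.slitPlane) :
    HasDerivAt (fun z : ℂ => z ^ (2⁻¹ : ℂ)) (1 / (2 * z ^ (2⁻¹ : ℂ))) z := by
  refine ((hasDerivAt_id z).cpow_const hz).congr_deriv ?_
  have h0 := Complex.slitPlane_ne_zero hz
  have h1 := cpow_half_ne_zero hz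
  have h2 := cpow_half_sq z
  rw [id, Complex.cpow_sub _ _ h0, Complex.cpow_one]
  generalize z ^ (2⁻¹ : ℂ) = w at *
  rw [← h2]
  field_simp

lemma hasDerivAt_rt {s : ℂ} (hs : s ∈ cutPlane) :
    HasDerivAt rt ((1 - rt s ^ 2) / (2 * s * rt s)) s := by
  have hu := neg_mem_slitPlane hs
  have hy := four_sub_mem_slitPlane hs
  have d1 := (hasDerivAt_cpow_half hy).comp s ((hasDerivAt_id s).const_sub 4)
  have d2 := (hasDerivAt_cpow_half hu).comp s (hasDerivAt_neg s)
  have h := d1.div d2 (cpow_half_ne_zero hu)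
  refine h.congr_deriv ?_
  have h0 := ne_zero_of_mem_cutPlane hs
  have h1 := cpow_half_ne_zero hu
  have h2 := cpow_half_ne_zero hy
  have e1 : s = -((-s) ^ (2⁻¹ : ℂ)) ^ 2 := by rw [cpow_half_sq, neg_neg]
  simp only [Function.comp, rt]
  set u := (-s) ^ (2⁻¹ : ℂ)
  set y := (4 - s) ^ (2⁻¹ : ℂ)
  rw [show 2 * s = 2 * -u ^ 2 by rw [← e1]]
  field_simp
  ring

/-- The leading coefficient of the resolvent. -/
def coefZero (s : ℂ) : ℂ := (1 - rt s) / 2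

/-- The second coefficient of the resolvent, with `a = α / √κ`. -/
def coefOne (h a : ℝ) (s : ℂ) : ℂ :=
  h / 4 * (1 / s - 1 / (s - 4)) + a / 2 * (1 / (s * rt s) - 1 / s)

/-- The third coefficient of the resolvent, with `a = α / √κ`. -/
def coefTwo (h a : ℝ) (s : ℂ) : ℂ :=
  (1 + 5 * h ^ 2) * (1 / (s ^ 4 * rt s ^ 5)) + (2 * h ^ 2 + a ^ 2) * (1 / (s ^ 3 * rt s ^ 3)) +
    h * a / 2 * (1 / (s ^ 2 * rt s) - 1 / (s - 4) ^ 2)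

lemma hasDerivAt_coefZero {s : ℂ} (hs : s ∈ cutPlane) :
    HasDerivAt coefZero (-(1 - rt s ^ 2) / (4 * s * rt s)) s := by
  refine (((hasDerivAt_rt hs).const_sub 1).div_const 2).congr_deriv ?_
  have h0 := ne_zero_of_mem_cutPlane hs
  have h1 := rt_ne_zero hs
  field_simp
  norm_num

lemma hasDerivAt_deriv_coefZero {s : ℂ} (hs : s ∈ cutPlane) :
    HasDerivAt (fun s => -(1 - rt s ^ 2) / (4 * s * rt s))
      ((1 - rt s ^ 2) * (1 + 3 * rt s ^ 2) / (8 * s ^ 2 * rt s ^ 3)) s := by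
  have h0 := ne_zero_of_mem_cutPlane hs
  have h1 := rt_ne_zero hs
  have hr := hasDerivAt_rt hs
  have d := (((hr.fun_pow 2).const_sub 1).fun_neg).fun_div
    (((hasDerivAt_id s).const_mul 4).fun_mul hr)
    (mul_ne_zero (mul_ne_zero (by norm_num) h0) h1)
  refine d.congr_deriv ?_
  simp only [id]
  field_simp
  ring

lemma coefOne_eq (h a : ℝ) {s : ℂ} (hs : s ∈ cutPlane) :
    coefOne h a s = -h / (s ^ 2 * rt s ^ 2) + a / 2 * (1 / (s * rt s) - 1 / s) := by
  have h0 := ne_zero_of_mem_cutPlane hs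
  have h1 := rt_ne_zero hs
  have h2 := mul_rt_sq h0
  have h4 := sub_four_ne_zero hs
  rw [coefOne]
  congr 1
  rw [show s ^ 2 * rt s ^ 2 = s * (s - 4) by rw [← h2]; ring]
  field_simp
  ring

lemma hasDerivAt_coefOne (h a : ℝ) {s : ℂ} (hs : s ∈ cutPlane) :
    HasDerivAt (coefOne h a) (h * (1 + rt s ^ 2) / (s ^ 3 * rt s ^ 4) +
      a / 2 * (1 / s ^ 2 - (1 + rt s ^ 2) / (2 * s ^ 2 * rt s ^ 3))) s := by
  have h0 := ne_zero_of_mem_cutPlane hs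
  have h1 := rt_ne_zero hs
  have hr := hasDerivAt_rt hs
  have d1 := ((((hasDerivAt_id s).fun_pow 2).fun_mul (hr.fun_pow 2)).fun_inv
    (mul_ne_zero (pow_ne_zero 2 h0) (pow_ne_zero 2 h1))).const_mul (-h : ℂ)
  have d2 := (((hasDerivAt_id s).fun_mul hr).fun_inv (mul_ne_zero h0 h1)).fun_sub
    ((hasDerivAt_id s).fun_inv h0)
  have d := d1.fun_add (d2.const_mul (a / 2 : ℂ))
  refine (d.congr_deriv ?_).congr_of_eventuallyEq ?_
  · simp only [id]
    field_simp
    ring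
  · filter_upwards [isOpen_cutPlane.mem_nhds hs] with w hw
    rw [coefOne_eq h a hw]
    simp only [id]
    ring

/-- The first loop equation in the limit `N → ∞`. -/
lemma coefZero_eq {s : ℂ} (hs : s ∈ cutPlane) : s * coefZero s ^ 2 - s * coefZero s + 1 = 0 := by
  have h2 := mul_rt_sq (ne_zero_of_mem_cutPlane hs)
  unfold coefZero
  linear_combination h2 / 4

/-- Convergence of holomorphic functions on the cut plane that are locally bounded carries over
to the derivatives, by Cauchy's formula. -/
theorem tendsto_deriv_of_tendsto {f f' : ℕ → ℂ → ℂ} {g g' : ℂ → ℂ} {M : ℂ → ℝ}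
    (hM : ContinuousOn M cutPlane)
    (hf : ∀ᶠ n in atTop, ∀ s ∈ cutPlane, HasDerivAt (f n) (f' n s) s ∧ ‖f n s‖ ≤ M s)
    (hg : ∀ s ∈ cutPlane, HasDerivAt g (g' s) s)
    (hlim : ∀ s ∈ cutPlane, Tendsto (fun n => f n s) atTop (𝓝 (g s))) {s : ℂ}
    (hs : s ∈ cutPlane) : Tendsto (fun n => f' n s) atTop (𝓝 (g' s)) := by
  obtain ⟨R, hR, hRs⟩ := Metric.nhds_basis_closedBall.mem_iff.1 (isOpen_cutPlane.mem_nhds hs)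
  have key : ∀ {u u' : ℂ → ℂ}, (∀ s ∈ cutPlane, HasDerivAt u (u' s) s) →
      (2 * Real.pi * Complex.I : ℂ)⁻¹ • (∮ z in C(s, R), ((z - s) ^ 2)⁻¹ • u z) = u' s := by
    intro u u' hu
    rw [Complex.two_pi_I_inv_smul_circleIntegral_sub_sq_inv_smul_of_differentiable
      isOpen_cutPlane hRs (fun w hw => (hu w hw).differentiableAt.differentiableWithinAt)
      (Metric.mem_ball_self hR), (hu s hs).deriv]
  have hmem : ∀ θ, circleMap s R θ ∈ cutPlane := fun θ => hRs (by
    simpa [Metric.mem_closedBall, dist_eq_norm] using (abs_of_pos hR).le)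
  have hc : Continuous fun θ => M (circleMap s R θ) :=
    hM.comp_continuous (continuous_circleMap s R) hmem
  have hint : Tendsto (fun n => ∮ z in C(s, R), ((z - s) ^ 2)⁻¹ • f n z) atTop
      (𝓝 (∮ z in C(s, R), ((z - s) ^ 2)⁻¹ • g z)) := by
    unfold circleIntegral
    refine intervalIntegral.tendsto_integral_filter_of_dominated_convergence
      (fun θ => R * ((R ^ 2)⁻¹ * M (circleMap s R θ))) ?_ ?_
      (Continuous.intervalIntegrable (continuous_const.mul (continuous_const.mul hc)) _ _) ?_
    · filter_upwards [hf] with n hn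
      have hcn : Continuous fun θ => f n (circleMap s R θ) :=
        (show ContinuousOn (f n) cutPlane from fun w hw =>
          (hn w hw).1.continuousAt.continuousWithinAt).comp_continuous
          (continuous_circleMap s R) hmem
      refine Continuous.aestronglyMeasurable ?_
      simp only [deriv_circleMap, circleMap_sub_center]
      have h0 : ∀ θ, circleMap 0 R θ ^ 2 ≠ 0 := fun θ => pow_ne_zero 2 (circleMap_ne_center hR.ne')
      exact ((continuous_circleMap 0 R).mul continuous_const).smul
        ((((continuous_circleMap 0 R).pow 2).inv₀ h0).smul hcn)
    · filter_upwards [hf] with n hn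
      refine Eventually.of_forall fun θ _ => ?_
      simp only [deriv_circleMap, circleMap_sub_center, norm_smul, norm_mul, norm_inv, norm_pow,
        norm_circleMap_zero, Complex.norm_I, mul_one, abs_of_pos hR]
      gcongr
      exact (hn _ (hmem θ)).2
    · refine Eventually.of_forall fun θ _ => ?_
      exact ((hlim _ (hmem θ)).const_smul _).const_smul _
  have h := hint.const_smul (2 * Real.pi * Complex.I : ℂ)⁻¹
  rw [key hg] at h
  refine h.congr' ?_
  filter_upwards [hf] with n hn
  exact key fun w hw => (hn w hw).1

end

/-! ### Large `N` asymptotics of the mean resolvent -/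

section

variable {N : ℕ} {α β : ℝ}

/-- The expansion parameter `1 / (N √κ)`. -/
def ord (β : ℝ) (N : ℕ) : ℝ := 1 / (N * √(β / 2))

/-- The parameter `h = √κ - 1 / √κ`. -/
def paramH (β : ℝ) : ℝ := √(β / 2) - 1 / √(β / 2)

/-- The parameter `a = α / √κ`. -/
def paramA (β α : ℝ) : ℝ := α / √(β / 2)

lemma ord_pos (hβ : 0 < β) (hN : 0 < N) : 0 < ord β N := by unfold ord; positivity

lemma ord_ne_zero (hβ : 0 < β) (hN : 0 < N) : (ord β N : ℂ) ≠ 0 := by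
  exact_mod_cast (ord_pos hβ hN).ne'

lemma ord_sq (hβ : 0 < β) : ord β N ^ 2 = 1 / (β / 2 * N ^ 2) := by
  have : √(β / 2) ^ 2 = β / 2 := Real.sq_sqrt (by positivity)
  rw [ord, div_pow, mul_pow, this]
  ring

lemma tendsto_ord (β : ℝ) : Tendsto (fun N : ℕ => (ord β N : ℂ)) atTop (𝓝 0) := by
  have h : Tendsto (fun N : ℕ => ord β N) atTop (𝓝 0) := by
    have := (tendsto_const_div_atTop_nhds_zero_nat (1 / √(β / 2)))
    refine this.congr fun N => ?_
    unfold ord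
    rw [div_div, mul_comm]
  have h2 := (Complex.continuous_ofReal.tendsto 0).comp h
  simpa [Function.comp_def] using h2

lemma paramH_mul_ord (hβ : 0 < β) (hN : 0 < N) :
    (paramH β * ord β N : ℂ) = (β / 2 - 1) / (β / 2 * N) := by
  have h1 : √(β / 2) ^ 2 = β / 2 := Real.sq_sqrt (by positivity)
  have h0 : 0 < √(β / 2) := by positivity
  have hN' : (N : ℝ) ≠ 0 := by positivity
  have : paramH β * ord β N = (β / 2 - 1) / (β / 2 * N) := by
    unfold paramH ord
    generalize √(β / 2) = q at *
    rw [← h1]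
    field_simp
  exact_mod_cast this

lemma paramA_mul_ord (hβ : 0 < β) (hN : 0 < N) :
    (paramA β α * ord β N : ℂ) = α / (β / 2 * N) := by
  have h1 : √(β / 2) ^ 2 = β / 2 := Real.sq_sqrt (by positivity)
  have h0 : 0 < √(β / 2) := by positivity
  have hN' : (N : ℝ) ≠ 0 := by positivity
  have : paramA β α * ord β N = α / (β / 2 * N) := by
    unfold paramA ord
    generalize √(β / 2) = q at *
    rw [← h1]
    field_simp
  exact_mod_cast this

lemma loop_one (hβ : 0 < β) (hα : -1 < α) (hN : 0 < N) {s : ℂ} (hs : s ∈ cutPlane) :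
    s * meanRes β α N s ^ 2 + s * varRes β α N s +
      paramH β * ord β N * (s * meanResDeriv β α N s) + paramA β α * ord β N * meanRes β α N s -
      s * meanRes β α N s + 1 = 0 := by
  rw [paramH_mul_ord hβ hN, paramA_mul_ord hβ hN]
  exact scaled_loop_one hβ hα hN hs

lemma loop_two (hβ : 0 < β) (hα : -1 < α) (hN : 0 < N) {s : ℂ} (hs : s ∈ cutPlane) :
    (2 * s * meanRes β α N s - s + paramA β α * ord β N) * varRes β α N s + s * cubeRes β α N s +
      paramH β * ord β N * (s * covRes β α N s) +
      ord β N ^ 2 * (meanResDeriv β α N s + s * meanResDerivTwo β α N s / 2) = 0 := by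
  have h2 : (ord β N : ℂ) ^ 2 = 1 / (β / 2 * N ^ 2) := by exact_mod_cast ord_sq hβ
  rw [paramH_mul_ord hβ hN, paramA_mul_ord hβ hN, h2]
  exact scaled_loop_two hβ hα hN hs

/-- A positive lower bound, independent of `N`, for `s * (w + w₀ - 1)` on the cut plane, where `w`
is the mean resolvent and `w₀` its limit. -/
def stab (s : ℂ) : ℝ := ‖s‖ * ((-s) ^ (2⁻¹ : ℂ)).re / (2 * ‖(-s) ^ (2⁻¹ : ℂ)‖)

lemma stab_pos {s : ℂ} (hs : s ∈ cutPlane) : 0 < stab s := by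
  have h1 := re_cpow_half_pos (neg_mem_slitPlane hs)
  have h2 := norm_pos_iff.2 (cpow_half_ne_zero (neg_mem_slitPlane hs))
  have h3 := norm_pos_iff.2 (ne_zero_of_mem_cutPlane hs)
  unfold stab
  positivity

lemma continuousOn_stab : ContinuousOn stab cutPlane := by
  have h : ContinuousOn (fun s : ℂ => (-s) ^ (2⁻¹ : ℂ)) cutPlane := fun s hs =>
    ((hasDerivAt_cpow_half (neg_mem_slitPlane hs)).comp s
      (hasDerivAt_neg s)).continuousAt.continuousWithinAt
  unfold stab
  refine ContinuousOn.div (continuous_norm.continuousOn.mul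
    (Complex.continuous_re.comp_continuousOn h)) (continuousOn_const.mul h.norm) fun s hs => ?_
  have h2 := norm_pos_iff.2 (cpow_half_ne_zero (neg_mem_slitPlane hs))
  positivity

/-- The mean resolvent is a Stieltjes transform; multiplied by `√(-s)` it takes values in the
left half plane. -/
lemma re_mul_meanRes_nonpos (hβ : 0 < β) (hα : -1 < α) (hN : 0 < N) {s : ℂ} (hs : s ∈ cutPlane) :
    ((-s) ^ (2⁻¹ : ℂ) * meanRes β α N s).re ≤ 0 := by
  have hc := scale_pos hβ hN
  have hu := re_cpow_half_pos (neg_mem_slitPlane hs)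
  have hs2 : s = -((-s) ^ (2⁻¹ : ℂ)) ^ 2 := by rw [cpow_half_sq, neg_neg]
  set u := (-s) ^ (2⁻¹ : ℂ)
  have hint := integrable_resSum (N := N) hβ.le hα (mul_mem_cutPlane hs hc) 1
  have e : u * meanRes β α N s =
      ((β / 2 : ℝ) : ℂ) * ∫ lam, u * resSum (N := N) 1 (scale β N * s) lam ∂ensemble β α N := by
    rw [integral_const_mul, meanRes]
    ring
  rw [e, Complex.re_ofReal_mul]
  refine mul_nonpos_of_nonneg_of_nonpos (by positivity) ?_
  have h2 := Complex.reCLM.integral_comp_comm (hint.const_mul u)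
  simp only [Complex.reCLM_apply] at h2
  rw [← h2]
  refine integral_nonpos_of_ae ?_
  filter_upwards [ensemble_ae_mem_orthant] with lam hl
  simp only [Pi.zero_apply, resSum, pow_one, Finset.mul_sum, Complex.re_sum]
  refine Finset.sum_nonpos fun j _ => ?_
  have hd : u * (1 / (scale β N * s - lam j)) =
      u * (starRingEnd ℂ) (scale β N * s - lam j) *
        ((Complex.normSq (scale β N * s - lam j))⁻¹ : ℝ) := by
    rw [one_div, Complex.inv_def, mul_assoc]
  rw [hd, Complex.re_mul_ofReal]
  refine mul_nonpos_of_nonpos_of_nonneg ?_ (inv_nonneg.2 (Complex.normSq_nonneg _))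
  have hl := hl j
  have : (u * (starRingEnd ℂ) (scale β N * s - lam j)).re =
      -(u.re * (scale β N * (u.re ^ 2 + u.im ^ 2) + lam j)) := by
    rw [hs2]
    simp [pow_two]
    ring
  rw [this]
  have : 0 ≤ u.re * (scale β N * (u.re ^ 2 + u.im ^ 2) + lam j) := by positivity
  linarith

/-- Stability of the quadratic equation for the mean resolvent. Both `√(-s) w` and
`√(-s) (w₀ - 1) + √(-s) / 2` have non-positive real part, so `w + w₀ - 1` stays away from `0`. -/
lemma stab_le (hβ : 0 < β) (hα : -1 < α) (hN : 0 < N) {s : ℂ} (hs : s ∈ cutPlane) :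
    stab s ≤ ‖s * (meanRes β α N s + coefZero s - 1)‖ := by
  have h1 := re_mul_meanRes_nonpos hβ hα hN hs
  have hu := re_cpow_half_pos (neg_mem_slitPlane hs)
  have hy := re_cpow_half_pos (four_sub_mem_slitPlane hs)
  have hu0 := cpow_half_ne_zero (neg_mem_slitPlane hs)
  have e : (-s) ^ (2⁻¹ : ℂ) * (coefZero s - 1) =
      -(((-s) ^ (2⁻¹ : ℂ) + (4 - s) ^ (2⁻¹ : ℂ)) * ((1 / 2 : ℝ) : ℂ)) := by
    rw [coefZero, rt]
    generalize (-s) ^ (2⁻¹ : ℂ) = u at *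
    push_cast
    field_simp
    ring
  unfold stab
  set u := (-s) ^ (2⁻¹ : ℂ)
  set y := (4 - s) ^ (2⁻¹ : ℂ)
  have h2 : (u * (meanRes β α N s + coefZero s - 1)).re ≤ -u.re / 2 := by
    rw [show u * (meanRes β α N s + coefZero s - 1) =
      u * meanRes β α N s + u * (coefZero s - 1) by ring, e, Complex.add_re, Complex.neg_re,
      Complex.re_mul_ofReal, Complex.add_re]
    linarith
  have h3 : u.re / 2 ≤ ‖u‖ * ‖meanRes β α N s + coefZero s - 1‖ := by
    rw [← norm_mul]
    refine le_trans ?_ (Complex.abs_re_le_norm _)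
    refine le_trans ?_ (neg_le_abs _)
    linarith
  have hn : 0 < ‖u‖ := norm_pos_iff.2 hu0
  rw [norm_mul, mul_div_assoc]
  gcongr
  rw [div_le_iff₀ (by positivity)]
  linarith

/-- The first normalised remainder. -/
def remOne (β α : ℝ) (N : ℕ) (s : ℂ) : ℂ := (meanRes β α N s - coefZero s) / ord β N

/-- The difference of the first loop equation and its limit, factored as `(w - w₀)(w + w₀ - 1)`. -/
lemma remOne_eq (hβ : 0 < β) (hα : -1 < α) (hN : 0 < N) {s : ℂ} (hs : s ∈ cutPlane) :
    s * (meanRes β α N s + coefZero s - 1) * remOne β α N s =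
      -(s * (varRes β α N s / ord β N) + paramH β * (s * meanResDeriv β α N s) +
        paramA β α * meanRes β α N s) := by
  have h1 := loop_one hβ hα hN hs
  have h2 := coefZero_eq hs
  have h3 := ord_ne_zero hβ hN
  unfold remOne
  field_simp
  linear_combination h1 - h2

lemma norm_varRes_div_le (hβ : 0 < β) (hα : -1 < α) (hN : 0 < N) {s : ℂ} (hs : s ∈ cutPlane) :
    ‖varRes β α N s / ord β N‖ ≤ 2 * fluctBound s * ord β N := by
  have h := norm_varRes_le (α := α) hβ hα hN hs
  have h0 := ord_pos hβ hN
  rw [norm_div, Complex.norm_real, Real.norm_of_nonneg h0.le, div_le_iff₀ h0]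
  refine h.trans (le_of_eq ?_)
  have := ord_sq (N := N) hβ
  rw [show 2 * fluctBound s * ord β N * ord β N = 2 * fluctBound s * ord β N ^ 2 by ring, this]
  ring

lemma ord_le (hβ : 0 < β) (hN : 0 < N) : ord β N ≤ 1 / √(β / 2) := by
  unfold ord
  have : (1 : ℝ) ≤ N := by exact_mod_cast hN
  gcongr
  exact le_mul_of_one_le_left (by positivity) this

/-- A continuous bound for the first normalised remainder. -/
def remBound (β α : ℝ) (s : ℂ) : ℝ :=
  (‖s‖ * (2 * fluctBound s * (1 / √(β / 2))) + |paramH β| * (‖s‖ * (1 / gap s ^ 2)) +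
    |paramA β α| * (1 / gap s)) / stab s

lemma continuousOn_remBound (β α : ℝ) : ContinuousOn (remBound β α) cutPlane := by
  have h1 := continuousOn_fluctBound
  have h2 := continuousOn_stab
  have h3 : ContinuousOn (fun s => 1 / gap s) cutPlane :=
    continuousOn_const.div continuous_gap.continuousOn fun s hs => (gap_pos hs).ne'
  have h4 : ContinuousOn (fun s => 1 / gap s ^ 2) cutPlane :=
    continuousOn_const.div (continuous_gap.pow 2).continuousOn fun s hs =>
      pow_ne_zero 2 (gap_pos hs).ne'
  unfold remBound
  refine ContinuousOn.div ?_ h2 fun s hs => (stab_pos hs).ne'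
  fun_prop

lemma norm_remOne_le (hβ : 0 < β) (hα : -1 < α) (hN : 0 < N) {s : ℂ} (hs : s ∈ cutPlane) :
    ‖remOne β α N s‖ ≤ remBound β α s := by
  have h1 := stab_le hβ hα hN hs
  have h2 := congrArg norm (remOne_eq hβ hα hN hs)
  have h3 := stab_pos hs
  have hb := fluctBound_nonneg hs
  have hg := gap_pos hs
  rw [norm_mul] at h2
  rw [remBound, le_div_iff₀ h3, mul_comm]
  calc stab s * ‖remOne β α N s‖ ≤ _ := mul_le_mul_of_nonneg_right h1 (norm_nonneg _)
    _ = _ := h2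
    _ ≤ _ := by
      rw [norm_neg]
      refine (norm_add₃_le).trans ?_
      simp only [norm_mul, Complex.norm_real, Real.norm_eq_abs]
      gcongr
      · exact (norm_varRes_div_le hβ hα hN hs).trans (by gcongr; exact ord_le hβ hN)
      · exact norm_meanResDeriv_le hβ hα hN hs
      · exact norm_meanRes_le hβ hα hN hs

lemma tendsto_meanRes (hβ : 0 < β) (hα : -1 < α) {s : ℂ} (hs : s ∈ cutPlane) :
    Tendsto (fun N => meanRes β α N s) atTop (𝓝 (coefZero s)) := by
  have h : Tendsto (fun N => remOne β α N s * ord β N) atTop (𝓝 0) := by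
    have := (tendsto_ord β).zero_mul_isBoundedUnder_le (g := fun N => remOne β α N s)
      (isBoundedUnder_of_eventually_le (a := remBound β α s) ?_)
    · simpa only [mul_comm] using this
    · filter_upwards [eventually_gt_atTop 0] with N hN
      exact norm_remOne_le hβ hα hN hs
  have h2 := h.add_const (coefZero s)
  rw [zero_add] at h2
  refine h2.congr' ?_
  filter_upwards [eventually_gt_atTop 0] with N hN
  have := ord_ne_zero hβ hN
  unfold remOne
  field_simp
  ring

lemma continuousOn_one_div_gap_pow (k : ℕ) : ContinuousOn (fun s => 1 / gap s ^ k) cutPlane :=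
  continuousOn_const.div (continuous_gap.pow k).continuousOn fun _ hs =>
    pow_ne_zero k (gap_pos hs).ne'

lemma tendsto_meanResDeriv (hβ : 0 < β) (hα : -1 < α) {s : ℂ} (hs : s ∈ cutPlane) :
    Tendsto (fun N => meanResDeriv β α N s) atTop (𝓝 (-(1 - rt s ^ 2) / (4 * s * rt s))) := by
  refine tendsto_deriv_of_tendsto (continuousOn_one_div_gap_pow 1) ?_
    (fun s hs => hasDerivAt_coefZero hs) (fun s hs => tendsto_meanRes hβ hα hs) hs
  filter_upwards [eventually_gt_atTop 0] with N hN s hs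
  refine ⟨hasDerivAt_meanRes hβ hα hN hs, ?_⟩
  rw [pow_one]
  exact norm_meanRes_le hβ hα hN hs

lemma tendsto_meanResDerivTwo (hβ : 0 < β) (hα : -1 < α) {s : ℂ} (hs : s ∈ cutPlane) :
    Tendsto (fun N => meanResDerivTwo β α N s) atTop
      (𝓝 ((1 - rt s ^ 2) * (1 + 3 * rt s ^ 2) / (8 * s ^ 2 * rt s ^ 3))) := by
  refine tendsto_deriv_of_tendsto (continuousOn_one_div_gap_pow 2) ?_
    (fun s hs => hasDerivAt_deriv_coefZero hs) (fun s hs => tendsto_meanResDeriv hβ hα hs) hs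
  filter_upwards [eventually_gt_atTop 0] with N hN s hs
  exact ⟨hasDerivAt_meanResDeriv hβ hα hN hs, norm_meanResDeriv_le hβ hα hN hs⟩

lemma tendsto_zero_of_norm_le_ord {f : ℕ → ℂ} {C : ℝ}
    (h : ∀ᶠ N in atTop, ‖f N‖ ≤ C * ord β N) : Tendsto f atTop (𝓝 0) := by
  have h0 : Tendsto (fun N => C * ord β N) atTop (𝓝 0) := by
    have := ((Complex.continuous_re.tendsto 0).comp (tendsto_ord β)).const_mul C
    simpa [Function.comp_def] using this
  exact squeeze_zero_norm' h h0

/-- The rescaled pseudo-variance converges: in the second loop equation the third moment and the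
covariance are of lower order. -/
lemma tendsto_varRes (hβ : 0 < β) (hα : -1 < α) {s : ℂ} (hs : s ∈ cutPlane) :
    Tendsto (fun N => varRes β α N s / ord β N ^ 2) atTop (𝓝 (1 / (s ^ 4 * rt s ^ 4))) := by
  have h0 := ne_zero_of_mem_cutPlane hs
  have h1 := rt_ne_zero hs
  have hb := fluctBound_nonneg hs
  have hκ : (0 : ℝ) < √(β / 2) := by positivity
  have hT : Tendsto (fun N => cubeRes β α N s / ord β N ^ 2) atTop (𝓝 0) := by
    refine tendsto_zero_of_norm_le_ord (β := β)
      (C := (fluctBound s / (β / 2) + 10 * fluctBound s ^ 2 / (β / 2) ^ 2) * √(β / 2) ^ 3) ?_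
    filter_upwards [eventually_gt_atTop 0] with N hN
    have ho := ord_pos hβ hN
    have hN' : (0 : ℝ) < N := by exact_mod_cast hN
    rw [norm_div, norm_pow, Complex.norm_real, Real.norm_of_nonneg ho.le,
      div_le_iff₀ (by positivity)]
    refine (norm_cubeRes_le hβ hα hN hs).trans (le_of_eq ?_)
    unfold ord
    generalize fluctBound s / (β / 2) + 10 * fluctBound s ^ 2 / (β / 2) ^ 2 = x
    field_simp
  have hC : Tendsto (fun N => covRes β α N s / ord β N) atTop (𝓝 0) := by
    refine tendsto_zero_of_norm_le_ord (β := β) (C := (1 + 4 / gap s ^ 2) * fluctBound s) ?_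
    filter_upwards [eventually_gt_atTop 0] with N hN
    have ho := ord_pos hβ hN
    rw [norm_div, Complex.norm_real, Real.norm_of_nonneg ho.le, div_le_iff₀ ho]
    refine (norm_covRes_le hβ hα hN hs).trans (le_of_eq ?_)
    have := ord_sq (N := N) hβ
    rw [mul_assoc, ← pow_two, this]
    ring
  have hcoef : Tendsto (fun N => 2 * s * meanRes β α N s - s + paramA β α * ord β N) atTop
      (𝓝 (2 * s * coefZero s - s + paramA β α * 0)) :=
    ((((tendsto_meanRes hβ hα hs).const_mul (2 * s)).sub_const s)).add
      ((tendsto_ord β).const_mul _)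
  have hlim : 2 * s * coefZero s - s + paramA β α * 0 = -(s * rt s) := by
    unfold coefZero
    ring
  rw [hlim] at hcoef
  have hnum : Tendsto (fun N => -(s * (cubeRes β α N s / ord β N ^ 2) +
      paramH β * (s * (covRes β α N s / ord β N)) +
      (meanResDeriv β α N s + s * meanResDerivTwo β α N s / 2))) atTop
      (𝓝 (-(s * 0 + paramH β * (s * 0) + (-(1 - rt s ^ 2) / (4 * s * rt s) +
        s * ((1 - rt s ^ 2) * (1 + 3 * rt s ^ 2) / (8 * s ^ 2 * rt s ^ 3)) / 2)))) :=
    (((hT.const_mul s).add ((hC.const_mul s).const_mul _)).add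
      ((tendsto_meanResDeriv hβ hα hs).add
        (((tendsto_meanResDerivTwo hβ hα hs).const_mul s).div_const 2))).neg
  have hne : -(s * rt s) ≠ 0 := neg_ne_zero.2 (mul_ne_zero h0 h1)
  have h := hnum.div hcoef hne
  have hr := mul_rt_sq h0
  have hval : -(s * 0 + (paramH β : ℂ) * (s * 0) + (-(1 - rt s ^ 2) / (4 * s * rt s) +
        s * ((1 - rt s ^ 2) * (1 + 3 * rt s ^ 2) / (8 * s ^ 2 * rt s ^ 3)) / 2)) / -(s * rt s) =
      1 / (s ^ 4 * rt s ^ 4) := by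
    have e : 1 - rt s ^ 2 = 4 / s := by
      field_simp
      linear_combination -hr
    have e2 : rt s ^ 2 = 1 - 4 / s := by rw [← e]; ring
    rw [e]
    field_simp
    rw [e2]
    field_simp
    ring
  rw [hval] at h
  refine h.congr' ?_
  filter_upwards [eventually_gt_atTop 0, hcoef.eventually_ne hne] with N hN hcN
  have h2 := loop_two hβ hα hN hs
  have ho := ord_ne_zero hβ hN
  rw [Pi.div_apply, div_eq_iff hcN]
  field_simp
  linear_combination -2 * h2

lemma sub_one_ne_zero {s : ℂ} (hs : s ∈ cutPlane) : s * (coefZero s + coefZero s - 1) ≠ 0 := by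
  have : s * (coefZero s + coefZero s - 1) = -(s * rt s) := by
    unfold coefZero
    ring
  rw [this]
  exact neg_ne_zero.2 (mul_ne_zero (ne_zero_of_mem_cutPlane hs) (rt_ne_zero hs))

lemma tendsto_remOne (hβ : 0 < β) (hα : -1 < α) {s : ℂ} (hs : s ∈ cutPlane) :
    Tendsto (fun N => remOne β α N s) atTop (𝓝 (coefOne (paramH β) (paramA β α) s)) := by
  have h0 := ne_zero_of_mem_cutPlane hs
  have h1 := rt_ne_zero hs
  have hV : Tendsto (fun N => varRes β α N s / ord β N) atTop (𝓝 0) := by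
    refine tendsto_zero_of_norm_le_ord (β := β) (C := 2 * fluctBound s) ?_
    filter_upwards [eventually_gt_atTop 0] with N hN
    exact norm_varRes_div_le hβ hα hN hs
  have hcoef : Tendsto (fun N => s * (meanRes β α N s + coefZero s - 1)) atTop
      (𝓝 (s * (coefZero s + coefZero s - 1))) :=
    (((tendsto_meanRes hβ hα hs).add_const _).sub_const _).const_mul s
  have hnum := (((hV.const_mul s).add (((tendsto_meanResDeriv hβ hα hs).const_mul s).const_mul
    (paramH β : ℂ))).add ((tendsto_meanRes hβ hα hs).const_mul (paramA β α : ℂ))).neg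
  have h := hnum.div hcoef (sub_one_ne_zero hs)
  have hr := mul_rt_sq h0
  have hval : -(s * 0 + paramH β * (s * (-(1 - rt s ^ 2) / (4 * s * rt s))) +
      paramA β α * coefZero s) / (s * (coefZero s + coefZero s - 1)) =
      coefOne (paramH β) (paramA β α) s := by
    have e : 1 - rt s ^ 2 = 4 / s := by
      field_simp
      linear_combination -hr
    rw [coefOne_eq _ _ hs, e, show s * (coefZero s + coefZero s - 1) = -(s * rt s) by
      unfold coefZero; ring, coefZero]
    field_simp
    ring
  rw [hval] at h
  refine h.congr' ?_
  filter_upwards [eventually_gt_atTop 0, hcoef.eventually_ne (sub_one_ne_zero hs)] with N hN hcN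
  rw [Pi.div_apply, div_eq_iff hcN, mul_comm (remOne β α N s), remOne_eq hβ hα hN hs]

/-- The derivative of `remOne`. -/
def remOneDeriv (β α : ℝ) (N : ℕ) (s : ℂ) : ℂ :=
  (meanResDeriv β α N s - -(1 - rt s ^ 2) / (4 * s * rt s)) / ord β N

lemma tendsto_remOneDeriv (hβ : 0 < β) (hα : -1 < α) {s : ℂ} (hs : s ∈ cutPlane) :
    Tendsto (fun N => remOneDeriv β α N s) atTop
      (𝓝 (paramH β * (1 + rt s ^ 2) / (s ^ 3 * rt s ^ 4) +
      paramA β α / 2 * (1 / s ^ 2 - (1 + rt s ^ 2) / (2 * s ^ 2 * rt s ^ 3)))) := by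
  refine tendsto_deriv_of_tendsto (continuousOn_remBound β α) ?_
    (fun s hs => hasDerivAt_coefOne _ _ hs) (fun s hs => tendsto_remOne hβ hα hs) hs
  filter_upwards [eventually_gt_atTop 0] with N hN s hs
  exact ⟨((hasDerivAt_meanRes hβ hα hN hs).sub (hasDerivAt_coefZero hs)).div_const _,
    norm_remOne_le hβ hα hN hs⟩

/-- The second-order remainder converges, by inserting the limits of the first-order remainder, of
its derivative and of the rescaled pseudo-variance into the first loop equation. -/
lemma tendsto_remTwo (hβ : 0 < β) (hα : -1 < α) {s : ℂ} (hs : s ∈ cutPlane) :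
    Tendsto (fun N => (remOne β α N s - coefOne (paramH β) (paramA β α) s) / ord β N) atTop
      (𝓝 (coefTwo (paramH β) (paramA β α) s)) := by
  have h0 := ne_zero_of_mem_cutPlane hs
  have h1 := rt_ne_zero hs
  have hr := mul_rt_sq h0
  have hA := tendsto_remOne hβ hα hs
  have hnum := ((((hA.pow 2).const_mul s).add ((tendsto_varRes hβ hα hs).const_mul s)).add
    (((tendsto_remOneDeriv hβ hα hs).const_mul s).const_mul (paramH β : ℂ))).add
      (hA.const_mul (paramA β α : ℂ))
  have h := hnum.div_const (s * rt s)
  have e : 1 - rt s ^ 2 = 4 / s := by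
    field_simp
    linear_combination -hr
  have hr1 : 1 - rt s ^ 2 ≠ 0 := by rw [e]; exact div_ne_zero (by norm_num) h0
  have hsr : s = 4 / (1 - rt s ^ 2) := by rw [e]; field_simp
  have hw : coefOne (paramH β) (paramA β α) s = -(paramH β : ℂ) / (s ^ 2 * rt s ^ 2) +
    paramA β α / 2 * (1 / (s * rt s) - 1 / s) := coefOne_eq _ _ hs
  have hval : (s * coefOne (paramH β) (paramA β α) s ^ 2 + s * (1 / (s ^ 4 * rt s ^ 4)) +
      paramH β * (s * (paramH β * (1 + rt s ^ 2) / (s ^ 3 * rt s ^ 4) +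
      paramA β α / 2 * (1 / s ^ 2 - (1 + rt s ^ 2) / (2 * s ^ 2 * rt s ^ 3)))) +
      paramA β α * coefOne (paramH β) (paramA β α) s) / (s * rt s) =
      coefTwo (paramH β) (paramA β α) s := by
    rw [hw, coefTwo, ← hr]
    generalize rt s = r at *
    rw [hsr]
    field_simp
    ring
  rw [hval] at h
  refine h.congr' ?_
  filter_upwards [eventually_gt_atTop 0] with N hN
  have h2 := loop_one hβ hα hN hs
  have h3 := coefZero_eq hs
  have ho := ord_ne_zero hβ hN
  have hm : meanRes β α N s = coefZero s + ord β N * remOne β α N s := by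
    unfold remOne; field_simp; ring
  have hm' : meanResDeriv β α N s = -(1 - rt s ^ 2) / (4 * s * rt s) +
      ord β N * remOneDeriv β α N s := by
    unfold remOneDeriv; field_simp; ring
  have hv : varRes β α N s = varRes β α N s / ord β N ^ 2 * ord β N ^ 2 := by field_simp
  have hz : coefZero s = (1 - rt s) / 2 := rfl
  have hw1 : s * rt s * coefOne (paramH β) (paramA β α) s =
      paramH β * (s * (-(1 - rt s ^ 2) / (4 * s * rt s))) + paramA β α * coefZero s := by
    rw [hw, e, hz]
    field_simp
  rw [div_eq_div_iff (mul_ne_zero h0 h1) ho]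
  refine mul_left_cancel₀ ho ?_
  rw [hm, hm', hv] at h2
  generalize varRes β α N s / ord β N ^ 2 = v at *
  generalize coefOne (paramH β) (paramA β α) s = w₁ at *
  generalize -(1 - rt s ^ 2) / (4 * s * rt s) = w₀' at *
  linear_combination h2 - h3 + ord β N * hw1 - 2 * s * ord β N * remOne β α N s * hz

/-- The coefficients of the large `N` expansion of the resolvent, up to the second order. -/
def coef (h a : ℝ) : ℕ → ℂ → ℂ
  | 0 => coefZero
  | 1 => coefOne h a
  | 2 => coefTwo h a
  | _ => 0

/-- The resolvent has a large `N` expansion with the coefficients `coef`. -/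
theorem hasResolventExpansion_coef (hβ : 0 < β) (hα : -1 < α) :
    HasResolventExpansion β α 2 (coef (paramH β) (paramA β α)) := by
  intro s hs
  have hs : s ∈ cutPlane := hs
  have hκ : (0 : ℝ) < √(β / 2) := by positivity
  have h := (tendsto_remTwo hβ hα hs).sub_const (coefTwo (paramH β) (paramA β α) s)
  rw [sub_self] at h
  have h2 : (fun N => (remOne β α N s - coefOne (paramH β) (paramA β α) s) / ord β N -
      coefTwo (paramH β) (paramA β α) s) =o[atTop] (fun _ : ℕ => (1 : ℝ)) :=
    (isLittleO_const_iff one_ne_zero).2 h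
  have h3 := (isBigO_refl (fun N : ℕ => (N : ℝ) / (N * √(β / 2)) ^ 2) atTop).mul_isLittleO
    h2.norm_left
  simp only [mul_one] at h3
  rw [← isLittleO_norm_left] at h3 ⊢
  refine h3.congr' ?_ EventuallyEq.rfl
  filter_upwards [eventually_gt_atTop 0] with N hN
  have hN' : (N : ℂ) ≠ 0 := by exact_mod_cast hN.ne'
  have hκ' : ((√(β / 2) : ℝ) : ℂ) ≠ 0 := by exact_mod_cast hκ.ne'
  rw [norm_mul, norm_norm, ← Complex.norm_real, ← norm_mul]
  congr 1
  rw [scaledResolvent_eq]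
  simp only [Finset.sum_range_succ, Finset.sum_range_zero, zero_add, coef, remOne, ord]
  push_cast
  field_simp
  ring

lemma eq_zero_of_tendsto_div_sq {t : ℕ → ℂ} (ht : Tendsto t atTop (𝓝 0))
    (hne : ∀ᶠ n in atTop, t n ≠ 0) {x y z : ℂ}
    (h : Tendsto (fun n => (x + y * t n + z * t n ^ 2) / t n ^ 2) atTop (𝓝 0)) :
    x = 0 ∧ y = 0 ∧ z = 0 := by
  have hx : x = 0 := by
    have h1 := h.mul (ht.pow 2)
    have h2 : Tendsto (fun n => x + y * t n + z * t n ^ 2) atTop (𝓝 (x + y * 0 + z * 0 ^ 2)) :=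
      ((tendsto_const_nhds).add (ht.const_mul y)).add ((ht.pow 2).const_mul z)
    have h3 := tendsto_nhds_unique h2 (h1.congr' (by
      filter_upwards [hne] with n hn
      field_simp))
    simpa using h3
  subst hx
  have hy : y = 0 := by
    have h1 := h.mul ht
    have h2 : Tendsto (fun n => y + z * t n) atTop (𝓝 (y + z * 0)) :=
      (tendsto_const_nhds).add (ht.const_mul z)
    have h3 := tendsto_nhds_unique h2 (h1.congr' (by
      filter_upwards [hne] with n hn
      field_simp
      ring))
    simpa using h3
  subst hy
  refine ⟨rfl, rfl, ?_⟩
  refine tendsto_nhds_unique tendsto_const_nhds (h.congr' ?_)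
  filter_upwards [hne] with n hn
  field_simp
  ring

/-- The coefficients of the expansion are unique. -/
theorem HasResolventExpansion.eq (hβ : 0 < β) {W W' : ℕ → ℂ → ℂ}
    (hW : HasResolventExpansion β α 2 W) (hW' : HasResolventExpansion β α 2 W') {s : ℂ}
    (hs : s ∈ cutPlane) : W 0 s = W' 0 s ∧ W 1 s = W' 1 s ∧ W 2 s = W' 2 s := by
  have hκ : (0 : ℝ) < √(β / 2) := by positivity
  have h := (hW' s hs).sub (hW s hs)
  rw [← isLittleO_norm_right] at h
  have h2 : Tendsto (fun N => ((W 0 s - W' 0 s) + (W 1 s - W' 1 s) * ord β N +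
      (W 2 s - W' 2 s) * ord β N ^ 2) / (ord β N : ℂ) ^ 2) atTop (𝓝 0) := by
    have h3 := (isLittleO_norm_left.2 (isLittleO_norm_right.1 h)).tendsto_div_nhds_zero
    rw [tendsto_zero_iff_norm_tendsto_zero] at h3 ⊢
    refine h3.congr' ?_
    filter_upwards [eventually_gt_atTop 0] with N hN
    have hN' : (N : ℂ) ≠ 0 := by exact_mod_cast hN.ne'
    have hκ' : ((√(β / 2) : ℝ) : ℂ) ≠ 0 := by exact_mod_cast hκ.ne'
    rw [norm_div, norm_norm, ← Complex.norm_real, ← norm_div]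
    congr 1
    simp only [Finset.sum_range_succ, Finset.sum_range_zero, zero_add, ord]
    push_cast
    field_simp
    ring
  have ht := tendsto_ord β
  have hne : ∀ᶠ N in atTop, (ord β N : ℂ) ≠ 0 := by
    filter_upwards [eventually_gt_atTop 0] with N hN using ord_ne_zero hβ hN
  obtain ⟨h4, h5, h6⟩ := eq_zero_of_tendsto_div_sq ht hne h2
  exact ⟨sub_eq_zero.1 h4, sub_eq_zero.1 h5, sub_eq_zero.1 h6⟩

end

/-! ### Boundary values on the cut -/

section

/-- In the lower half plane the principal square roots of `z` and `-z` differ by `-i`. -/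
lemma cpow_half_of_im_neg {z : ℂ} (hz : z.im < 0) :
    z ^ (2⁻¹ : ℂ) = -Complex.I * (-z) ^ (2⁻¹ : ℂ) := by
  have h1 := re_cpow_half_pos (z := z) (Or.inr hz.ne)
  have h2 := re_cpow_half_pos (z := -z) (Or.inr (by simpa using hz.ne))
  have e1 := cpow_half_sq z
  have e2 := cpow_half_sq (-z)
  set a := z ^ (2⁻¹ : ℂ)
  set b := (-z) ^ (2⁻¹ : ℂ)
  have h3 : 0 < b.im := by
    have := congrArg Complex.im e2
    simp only [pow_two, Complex.mul_im, Complex.neg_im] at this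
    by_contra hb
    have : b.re * b.im ≤ 0 := mul_nonpos_of_nonneg_of_nonpos h2.le (not_lt.1 hb)
    linarith
  have h4 : (a - -Complex.I * b) * (a + -Complex.I * b) = 0 := by
    have := Complex.I_sq
    linear_combination e1 + e2 - b ^ 2 * this
  rcases mul_eq_zero.1 h4 with h | h
  · exact sub_eq_zero.1 h
  · exfalso
    have := congrArg Complex.re h
    simp at this
    linarith

lemma conj_cpow_half {z : ℂ} (hz : z ∈ Complex.slitPlane) :
    ((starRingEnd ℂ) z) ^ (2⁻¹ : ℂ) = (starRingEnd ℂ) (z ^ (2⁻¹ : ℂ)) := by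
  have := Complex.conj_cpow z (2⁻¹ : ℂ) (Complex.mem_slitPlane_iff_arg.1 hz).1
  rw [this, map_inv₀, map_ofNat]

lemma rt_conj {s : ℂ} (hs : s ∈ cutPlane) : rt ((starRingEnd ℂ) s) = (starRingEnd ℂ) (rt s) := by
  have e1 : 4 - (starRingEnd ℂ) s = (starRingEnd ℂ) (4 - s) := by rw [map_sub, map_ofNat]
  have e2 : -(starRingEnd ℂ) s = (starRingEnd ℂ) (-s) := by simp
  rw [rt, rt, e1, e2, conj_cpow_half (four_sub_mem_slitPlane hs),
    conj_cpow_half (neg_mem_slitPlane hs), map_div₀]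

lemma add_mem_cutPlane {x ε : ℝ} (hε : 0 < ε) : (x : ℂ) + Complex.I * ε ∈ cutPlane :=
  Or.inl (by simpa using hε.ne')

lemma sub_mem_cutPlane {x ε : ℝ} (hε : 0 < ε) : (x : ℂ) - Complex.I * ε ∈ cutPlane :=
  Or.inl (by simpa using hε.ne')

lemma tendsto_add_I_mul (x : ℝ) :
    Tendsto (fun ε : ℝ => (x : ℂ) + Complex.I * ε) (𝓝[>] 0) (𝓝 x) := by
  have : Continuous fun ε : ℝ => (x : ℂ) + Complex.I * ε := by fun_prop
  have h := (this.tendsto 0).mono_left (nhdsWithin_le_nhds (s := Set.Ioi 0))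
  simpa using h

lemma tendsto_sub_I_mul (x : ℝ) :
    Tendsto (fun ε : ℝ => (x : ℂ) - Complex.I * ε) (𝓝[>] 0) (𝓝 x) := by
  have : Continuous fun ε : ℝ => (x : ℂ) - Complex.I * ε := by fun_prop
  have h := (this.tendsto 0).mono_left (nhdsWithin_le_nhds (s := Set.Ioi 0))
  simpa using h

lemma ofReal_cpow_half {x : ℝ} (hx : 0 ≤ x) : (x : ℂ) ^ (2⁻¹ : ℂ) = (√x : ℝ) := by
  rw [Real.sqrt_eq_rpow, Complex.ofReal_cpow hx]
  norm_num

/-- The function `√(4 / x - 1)`. -/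
def edgeRoot (x : ℝ) : ℝ := √(4 / x - 1)

lemma edgeRoot_eq {x : ℝ} (hx : x ∈ Set.Ioo (0 : ℝ) 4) : edgeRoot x = √(4 - x) / √x := by
  rw [edgeRoot, ← Real.sqrt_div (by linarith [hx.2])]
  congr 1
  have := hx.1.ne'
  field_simp

lemma edgeRoot_pos {x : ℝ} (hx : x ∈ Set.Ioo (0 : ℝ) 4) : 0 < edgeRoot x := by
  rw [edgeRoot_eq hx]
  exact div_pos (Real.sqrt_pos.2 (by linarith [hx.2])) (Real.sqrt_pos.2 hx.1)

/-- The boundary values of `rt` on the real axis. They are purely imaginary on `(0, 4)` and agree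
elsewhere. -/
theorem exists_tendsto_rt {x : ℝ} (h0 : x ≠ 0) (h4 : x ≠ 4) : ∃ v : ℂ, v ≠ 0 ∧
    Tendsto (fun ε : ℝ => rt (x + Complex.I * ε)) (𝓝[>] 0) (𝓝 v) ∧
    Tendsto (fun ε : ℝ => rt (x - Complex.I * ε)) (𝓝[>] 0) (𝓝 ((starRingEnd ℂ) v)) ∧
    (x ∈ Set.Ioo (0 : ℝ) 4 → v = Complex.I * edgeRoot x) ∧
    (x ∉ Set.Ioo (0 : ℝ) 4 → (starRingEnd ℂ) v = v) := by
  have main : ∀ v : ℂ, Tendsto (fun ε : ℝ => rt (x + Complex.I * ε)) (𝓝[>] 0) (𝓝 v) →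
      v ≠ 0 ∧ Tendsto (fun ε : ℝ => rt (x - Complex.I * ε)) (𝓝[>] 0) (𝓝 ((starRingEnd ℂ) v)) := by
    intro v hv
    refine ⟨?_, ?_⟩
    · rintro rfl
      have h1 := (tendsto_add_I_mul x).mul (hv.pow 2)
      have h2 := tendsto_nhds_unique ((tendsto_add_I_mul x).sub_const 4) (h1.congr' (by
        filter_upwards [self_mem_nhdsWithin] with ε hε
        exact mul_rt_sq (ne_zero_of_mem_cutPlane (add_mem_cutPlane hε))))
      have h3 : (x : ℂ) = 4 := by simpa [sub_eq_zero] using h2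
      exact h4 (by exact_mod_cast h3)
    · refine ((Complex.continuous_conj.tendsto v).comp hv).congr' ?_
      filter_upwards [self_mem_nhdsWithin] with ε hε
      rw [Function.comp, ← rt_conj (add_mem_cutPlane hε)]
      congr 1
      simp [sub_eq_add_neg]
  have hne : ∀ y : ℝ, 0 < y → (y : ℂ) ∈ Complex.slitPlane := fun y hy => Or.inl (by simpa using hy)
  have hcont : ∀ z ∈ Complex.slitPlane, ContinuousAt (fun z : ℂ => z ^ (2⁻¹ : ℂ)) z := fun z hz =>
    (hasDerivAt_cpow_half hz).continuousAt
  have up : ∀ {ε : ℝ}, 0 < ε → (-((x : ℂ) + Complex.I * ε)).im < 0 := fun hε => by simpa using hε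
  have up4 : ∀ {ε : ℝ}, 0 < ε → (4 - ((x : ℂ) + Complex.I * ε)).im < 0 := fun hε => by
    simpa using hε
  rcases lt_trichotomy x 0 with hx | hx | hx
  · have hx' : (x : ℂ) ∈ cutPlane := Or.inr (by simpa using hx)
    have hv := ((hasDerivAt_rt hx').continuousAt.tendsto).comp (tendsto_add_I_mul x)
    refine ⟨rt x, (main _ hv).1, hv, (main _ hv).2, fun h => absurd h.1 (not_lt.2 hx.le), ?_⟩
    intro _
    rw [← rt_conj hx', Complex.conj_ofReal]
  · exact absurd hx h0
  · rcases lt_or_gt_of_ne h4 with hx4 | hx4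
    · have hv : Tendsto (fun ε : ℝ => rt (x + Complex.I * ε)) (𝓝[>] 0)
          (𝓝 (Complex.I * edgeRoot x)) := by
        have c1 := (hcont _ (hne x hx)).tendsto.comp (tendsto_add_I_mul x)
        have c2 := (hcont _ (hne (4 - x) (by linarith))).tendsto.comp
          (f := fun ε : ℝ => 4 - ((x : ℂ) + Complex.I * ε))
          (by push_cast; exact (tendsto_add_I_mul x).const_sub 4)
        have hs : ((√x : ℝ) : ℂ) ≠ 0 := by exact_mod_cast (Real.sqrt_pos.2 hx).ne'
        rw [ofReal_cpow_half hx.le] at c1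
        rw [ofReal_cpow_half (by linarith)] at c2
        have h := (c2.div c1 hs).const_mul Complex.I
        have e : Complex.I * ((√(4 - x) : ℝ) / (√x : ℝ)) = Complex.I * edgeRoot x := by
          rw [edgeRoot_eq ⟨hx, hx4⟩]
          push_cast
          rfl
        rw [e] at h
        refine h.congr' ?_
        filter_upwards [self_mem_nhdsWithin] with ε hε
        rw [rt, cpow_half_of_im_neg (up hε), neg_neg, Pi.div_apply,
          Function.comp_apply, Function.comp_apply]
        have := cpow_half_ne_zero (z := (x : ℂ) + Complex.I * ε)
          (Or.inr (by simpa using (ne_of_gt hε)))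
        have hI := Complex.I_ne_zero
        generalize ((x : ℂ) + Complex.I * ε) ^ (2⁻¹ : ℂ) = b at *
        generalize (4 - ((x : ℂ) + Complex.I * ε)) ^ (2⁻¹ : ℂ) = a
        rw [eq_div_iff (mul_ne_zero (neg_ne_zero.2 hI) this)]
        field_simp
        linear_combination -a * Complex.I_sq
      exact ⟨_, (main _ hv).1, hv, (main _ hv).2, fun _ => rfl, fun h => absurd ⟨hx, hx4⟩ h⟩
    · have hv : Tendsto (fun ε : ℝ => rt (x + Complex.I * ε)) (𝓝[>] 0)
          (𝓝 ((√(x - 4) / √x : ℝ) : ℂ)) := by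
        have c1 := (hcont _ (hne x hx)).tendsto.comp (tendsto_add_I_mul x)
        have c2 := (hcont _ (hne (x - 4) (by linarith))).tendsto.comp
          (f := fun ε : ℝ => (x : ℂ) + Complex.I * ε - 4)
          (by push_cast; exact (tendsto_add_I_mul x).sub_const 4)
        have hs : ((√x : ℝ) : ℂ) ≠ 0 := by exact_mod_cast (Real.sqrt_pos.2 hx).ne'
        rw [ofReal_cpow_half hx.le] at c1
        rw [ofReal_cpow_half (by linarith)] at c2
        have h := c2.div c1 hs
        push_cast
        refine h.congr' ?_
        filter_upwards [self_mem_nhdsWithin] with ε hε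
        rw [rt, cpow_half_of_im_neg (up hε), cpow_half_of_im_neg (up4 hε), neg_neg, neg_sub,
          Pi.div_apply]
        have hI := Complex.I_ne_zero
        simp only [Function.comp]
        field_simp
      exact ⟨_, (main _ hv).1, hv, (main _ hv).2, fun h => absurd h.2 (not_lt.2 hx4.le),
        fun _ => Complex.conj_ofReal _⟩

end

/-! ### Inverse Stieltjes transforms as distributions -/

section

lemma intervalIntegrable_abs_rpow {r : ℝ} (hr : -1 < r) (a b : ℝ) :
    IntervalIntegrable (fun x : ℝ => |x| ^ r) volume a b := by
  have key : ∀ b : ℝ, 0 ≤ b → IntervalIntegrable (fun x : ℝ => |x| ^ r) volume 0 b := fun b hb => by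
    refine (intervalIntegral.intervalIntegrable_rpow' hr (a := 0) (b := b)).congr ?_
    intro x hx
    rw [Set.uIoc_of_le hb] at hx
    simp only
    rw [abs_of_pos hx.1]
  have key2 : ∀ b : ℝ, IntervalIntegrable (fun x : ℝ => |x| ^ r) volume 0 b := fun b => by
    rcases le_total 0 b with hb | hb
    · exact key b hb
    · have h := (IntervalIntegrable.iff_comp_neg (by simp)).1 (key (-b) (by linarith))
      simpa using h
  exact (key2 a).symm.trans (key2 b)

/-- The majorant for boundary values that are integrable at the edges. -/
def edgeBound (x : ℝ) : ℝ := |x| ^ (-(1 / 2) : ℝ) + |x - 4| ^ (-(1 / 2) : ℝ)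

lemma intervalIntegrable_edgeBound (a b : ℝ) : IntervalIntegrable edgeBound volume a b := by
  refine (intervalIntegrable_abs_rpow (by norm_num) a b).add ?_
  have h := (intervalIntegrable_abs_rpow (r := -(1 / 2)) (by norm_num) (a - 4)
    (b - 4)).comp_sub_right 4
  simpa using h

lemma edgeBound_nonneg (x : ℝ) : 0 ≤ edgeBound x := by unfold edgeBound; positivity

/-- A function on the cut plane whose growth at the real axis is dominated, locally uniformly,
by `edgeBound`. -/
def EdgeBdd (F : ℂ → ℂ) : Prop :=
  ∀ R : ℝ, ∃ C : ℝ, ∀ x ε : ℝ, x ≠ 0 → x ≠ 4 → |x| ≤ R → ε ≠ 0 → |ε| ≤ 1 →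
    ‖F (x + Complex.I * ε)‖ ≤ C * edgeBound x

lemma abs_le_norm_add_I (x ε : ℝ) : |x| ≤ ‖(x : ℂ) + Complex.I * ε‖ := by
  simpa using Complex.abs_re_le_norm ((x : ℂ) + Complex.I * ε)

lemma norm_add_I_le (x ε : ℝ) : ‖(x : ℂ) + Complex.I * ε‖ ≤ |x| + |ε| := by
  refine (norm_add_le _ _).trans ?_
  simp [Complex.norm_real]

lemma norm_cpow_half_sq (z : ℂ) : ‖z ^ (2⁻¹ : ℂ)‖ ^ 2 = ‖z‖ := by
  rw [← norm_pow, cpow_half_sq]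

lemma le_rpow_of_sq_mul_le {t y B : ℝ} (hy : 0 < y) (hB : 0 ≤ B)
    (h : t ^ 2 * y ≤ B ^ 2) : t ≤ B * y ^ (-(1 / 2) : ℝ) := by
  have e : (y ^ (-(1 / 2) : ℝ)) ^ 2 * y = 1 := by
    rw [← Real.rpow_natCast, ← Real.rpow_mul hy.le]
    norm_num
    rw [Real.rpow_neg_one, inv_mul_cancel₀ hy.ne']
  refine le_of_sq_le_sq ?_ (by positivity)
  have : (t ^ 2) * y ≤ (B * y ^ (-(1 / 2) : ℝ)) ^ 2 * y := by
    calc t ^ 2 * y ≤ B ^ 2 := h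
      _ = (B * y ^ (-(1 / 2) : ℝ)) ^ 2 * y := by rw [mul_pow, mul_assoc, e, mul_one]
  exact le_of_mul_le_mul_right this hy

lemma norm_rt_sq {s : ℂ} : ‖rt s‖ ^ 2 = ‖4 - s‖ / ‖s‖ := by
  rw [rt, norm_div, div_pow, norm_cpow_half_sq, norm_cpow_half_sq, norm_neg]

lemma edgeBdd_rt : EdgeBdd rt := by
  intro R
  refine ⟨√(|R| + 5), fun x ε h0 h4 hx hε hε1 => ?_⟩
  have h1 : ‖rt (x + Complex.I * ε)‖ ≤ √(|R| + 5) * |x| ^ (-(1 / 2) : ℝ) := by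
    have hx0 : 0 < |x| := abs_pos.2 h0
    refine le_rpow_of_sq_mul_le hx0 (Real.sqrt_nonneg _) ?_
    have h2 := abs_le_norm_add_I x ε
    have h3 : ‖4 - ((x : ℂ) + Complex.I * ε)‖ ≤ |R| + 5 := by
      refine (norm_sub_le _ _).trans ?_
      have := norm_add_I_le x ε
      have := le_abs_self R
      norm_num
      linarith
    rw [norm_rt_sq, Real.sq_sqrt (by positivity), div_mul_eq_mul_div,
      div_le_iff₀ (hx0.trans_le h2)]
    gcongr
  refine h1.trans ?_
  gcongr
  unfold edgeBound
  have : 0 ≤ |x - 4| ^ (-(1 / 2) : ℝ) := by positivity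
  linarith

lemma abs_sub_four_le (x ε : ℝ) : |x - 4| ≤ ‖4 - ((x : ℂ) + Complex.I * ε)‖ := by
  have := Complex.abs_re_le_norm (4 - ((x : ℂ) + Complex.I * ε))
  rw [abs_sub_comm]
  simpa using this

lemma edgeBdd_inv_rt : EdgeBdd fun s => 1 / rt s := by
  intro R
  refine ⟨√(|R| + 1), fun x ε h0 h4 hx hε hε1 => ?_⟩
  have h1 : ‖1 / rt (x + Complex.I * ε)‖ ≤ √(|R| + 1) * |x - 4| ^ (-(1 / 2) : ℝ) := by
    have hx0 : 0 < |x - 4| := abs_pos.2 (sub_ne_zero.2 h4)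
    refine le_rpow_of_sq_mul_le hx0 (Real.sqrt_nonneg _) ?_
    have h2 := abs_sub_four_le x ε
    have h3 : ‖(x : ℂ) + Complex.I * ε‖ ≤ |R| + 1 := by
      have := norm_add_I_le x ε
      have := le_abs_self R
      linarith
    rw [norm_div, norm_one, div_pow, one_pow, norm_rt_sq, one_div_div,
      Real.sq_sqrt (by positivity), div_mul_eq_mul_div, div_le_iff₀ (hx0.trans_le h2)]
    gcongr
  refine h1.trans ?_
  gcongr
  unfold edgeBound
  have : 0 ≤ |x| ^ (-(1 / 2) : ℝ) := by positivity
  linarith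

lemma edgeBdd_inv_mul_rt : EdgeBdd fun s => 1 / (s * rt s) := by
  intro R
  refine ⟨1, fun x ε h0 h4 hx hε hε1 => ?_⟩
  have hx0 : 0 < |x| := abs_pos.2 h0
  have hx4 : 0 < |x - 4| := abs_pos.2 (sub_ne_zero.2 h4)
  have h2 := abs_le_norm_add_I x ε
  have h3 := abs_sub_four_le x ε
  have hp := hx0.trans_le h2
  have hp4 := hx4.trans_le h3
  have hsq : ‖1 / (((x : ℂ) + Complex.I * ε) * rt (x + Complex.I * ε))‖ ^ 2 =
      1 / (‖(x : ℂ) + Complex.I * ε‖ * ‖4 - ((x : ℂ) + Complex.I * ε)‖) := by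
    rw [norm_div, norm_one, norm_mul, div_pow, one_pow, mul_pow, norm_rt_sq]
    field_simp
  rw [one_mul, edgeBound]
  rcases le_total 1 |x - 4| with h | h
  · have h1 := le_rpow_of_sq_mul_le (B := 1) hx0 zero_le_one (by
      rw [hsq, div_mul_eq_mul_div, div_le_iff₀ (by positivity)]
      nlinarith)
    have : 0 ≤ |x - 4| ^ (-(1 / 2) : ℝ) := by positivity
    linarith
  · have h5 : 1 ≤ |x| := by
      have := abs_le.1 h
      rw [abs_of_nonneg] <;> linarith
    have h1 := le_rpow_of_sq_mul_le (B := 1) hx4 zero_le_one (by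
      rw [hsq, div_mul_eq_mul_div, div_le_iff₀ (by positivity)]
      nlinarith)
    have : 0 ≤ |x| ^ (-(1 / 2) : ℝ) := by positivity
    linarith

lemma EdgeBdd.pow_mul {F : ℂ → ℂ} (hF : EdgeBdd F) (k : ℕ) : EdgeBdd fun s => s ^ k * F s := by
  intro R
  obtain ⟨C, hC⟩ := hF R
  refine ⟨(|R| + 1) ^ k * C, fun x ε h0 h4 hx hε hε1 => ?_⟩
  rw [norm_mul, norm_pow, mul_assoc]
  have h3 : ‖(x : ℂ) + Complex.I * ε‖ ≤ |R| + 1 := by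
    have := norm_add_I_le x ε
    have := le_abs_self R
    linarith
  gcongr
  exact hC x ε h0 h4 hx hε hε1

lemma continuous_jump {F : ℂ → ℂ} (hF : ContinuousOn F cutPlane) {ε : ℝ} (hε : 0 < ε) :
    Continuous (jump F ε) := by
  unfold jump
  refine ((hF.comp_continuous (by fun_prop) fun x => sub_mem_cutPlane hε).sub
    (hF.comp_continuous (by fun_prop) fun x => add_mem_cutPlane hε)).div_const _

/-- A smooth complex-valued function with compact support. -/
structure IsTestFunction (φ : ℝ → ℂ) : Prop where
  smooth : ContDiff ℝ ∞ φ
  supp : HasCompactSupport φ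

lemma IsTestFunction.deriv {φ : ℝ → ℂ} (h : IsTestFunction φ) : IsTestFunction (deriv φ) :=
  ⟨(contDiff_infty_iff_deriv.1 h.smooth).2, h.supp.deriv⟩

lemma IsTestFunction.continuous {φ : ℝ → ℂ} (h : IsTestFunction φ) : Continuous φ :=
  h.smooth.continuous

lemma IsTestFunction.hasDerivAt {φ : ℝ → ℂ} (h : IsTestFunction φ) (x : ℝ) :
    HasDerivAt φ (_root_.deriv φ x) x :=
  ((h.smooth.differentiable (by simp)) x).hasDerivAt

lemma IsTestFunction.exists_bound {φ : ℝ → ℂ} (h : IsTestFunction φ) :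
    ∃ C : ℝ, 0 ≤ C ∧ ∀ x, ‖φ x‖ ≤ C := by
  obtain ⟨C, hC⟩ := h.continuous.bounded_above_of_compact_support h.supp
  exact ⟨C, (norm_nonneg _).trans (hC 0), hC⟩

lemma integrable_jump_mul {F : ℂ → ℂ} (hF : ContinuousOn F cutPlane) {φ : ℝ → ℂ}
    (hφ : IsTestFunction φ) {ε : ℝ} (hε : 0 < ε) : Integrable fun x => jump F ε x * φ x :=
  ((continuous_jump hF hε).mul hφ.continuous).integrable_of_hasCompactSupport hφ.supp.mul_left

/-- The inverse Stieltjes transform of `F` exists in the sense of distributions, and is `T`.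
Continuity of `F` off the cut makes the pairings with test functions integrable. -/
structure HasJump (F : ℂ → ℂ) (T : (ℝ → ℂ) → ℂ) : Prop where
  cont : ContinuousOn F cutPlane
  lim : ∀ φ, IsTestFunction φ → Tendsto (jumpPairing F φ) (𝓝[>] 0) (𝓝 (T φ))

lemma HasJump.add {F G : ℂ → ℂ} {T U : (ℝ → ℂ) → ℂ} (hF : HasJump F T) (hG : HasJump G U) :
    HasJump (fun s => F s + G s) fun φ => T φ + U φ where
  cont := hF.cont.add hG.cont
  lim φ hφ := by
    refine ((hF.lim φ hφ).add (hG.lim φ hφ)).congr' ?_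
    filter_upwards [self_mem_nhdsWithin] with ε hε
    unfold jumpPairing
    rw [← integral_add (integrable_jump_mul hF.cont hφ hε) (integrable_jump_mul hG.cont hφ hε)]
    refine integral_congr_ae (Eventually.of_forall fun x => ?_)
    simp only [jump]
    ring

lemma HasJump.const_mul {F : ℂ → ℂ} {T : (ℝ → ℂ) → ℂ} (hF : HasJump F T) (c : ℂ) :
    HasJump (fun s => c * F s) fun φ => c * T φ where
  cont := continuousOn_const.mul hF.cont
  lim φ hφ := by
    refine ((hF.lim φ hφ).const_mul c).congr fun ε => ?_
    unfold jumpPairing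
    rw [← integral_const_mul]
    refine integral_congr_ae (Eventually.of_forall fun x => ?_)
    simp only [jump]
    ring

lemma jump_congr {F G : ℂ → ℂ} (h : Set.EqOn F G cutPlane) {ε : ℝ} (hε : 0 < ε) (x : ℝ) :
    jump F ε x = jump G ε x := by
  unfold jump
  rw [h (sub_mem_cutPlane hε), h (add_mem_cutPlane hε)]

lemma HasJump.congr {F G : ℂ → ℂ} {T U : (ℝ → ℂ) → ℂ} (hF : HasJump F T)
    (h : Set.EqOn G F cutPlane) (hT : ∀ φ, IsTestFunction φ → U φ = T φ) : HasJump G U where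
  cont := hF.cont.congr h
  lim φ hφ := by
    rw [hT φ hφ]
    refine (hF.lim φ hφ).congr' ?_
    filter_upwards [self_mem_nhdsWithin] with ε hε
    unfold jumpPairing
    simp only [jump_congr h hε]

/-- The inverse Stieltjes transform commutes with differentiation. -/
theorem HasJump.deriv {F F' : ℂ → ℂ} {T : (ℝ → ℂ) → ℂ} (hF : HasJump F T)
    (hd : ∀ s ∈ cutPlane, HasDerivAt F (F' s) s) (hc : ContinuousOn F' cutPlane) :
    HasJump F' fun φ => -T (_root_.deriv φ) where
  cont := hc
  lim φ hφ := by
    refine (hF.lim _ hφ.deriv).neg.congr' ?_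
    filter_upwards [self_mem_nhdsWithin] with ε hε
    have hj : ∀ x : ℝ, HasDerivAt (jump F ε) (jump F' ε x) x := by
      intro x
      have h1 : HasDerivAt (fun x : ℝ => F ((x : ℂ) - Complex.I * ε))
          (F' ((x : ℂ) - Complex.I * ε)) x := by
        have := (hd _ (sub_mem_cutPlane (x := x) hε)).comp_of_eq (x : ℂ)
          ((hasDerivAt_id (x : ℂ)).sub_const (Complex.I * ε)) rfl
        simpa using this.comp_ofReal
      have h2 : HasDerivAt (fun x : ℝ => F ((x : ℂ) + Complex.I * ε))
          (F' ((x : ℂ) + Complex.I * ε)) x := by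
        have := (hd _ (add_mem_cutPlane (x := x) hε)).comp_of_eq (x : ℂ)
          ((hasDerivAt_id (x : ℂ)).add_const (Complex.I * ε)) rfl
        simpa using this.comp_ofReal
      exact (h1.sub h2).div_const _
    have h := integral_mul_deriv_eq_deriv_mul_of_integrable (u := jump F ε) (v := φ)
      (u' := jump F' ε) (v' := _root_.deriv φ) (fun x _ => hj x) (fun x _ => hφ.hasDerivAt x)
      (integrable_jump_mul hF.cont hφ.deriv hε) (integrable_jump_mul hc hφ hε)
      (integrable_jump_mul hF.cont hφ hε)
    unfold jumpPairing
    rw [h, neg_neg]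

/-- Boundary values dominated by `edgeBound` converge as distributions to the pointwise limit. -/
theorem hasJump_of_edgeBdd {F : ℂ → ℂ} (hF : ContinuousOn F cutPlane) (hb : EdgeBdd F) {j : ℝ → ℂ}
    (hj : ∀ x : ℝ, x ≠ 0 → x ≠ 4 → Tendsto (fun ε => jump F ε x) (𝓝[>] 0) (𝓝 (j x))) :
    (∀ φ, IsTestFunction φ → Integrable fun x => j x * φ x) ∧
      HasJump F fun φ => ∫ x, j x * φ x := by
  have key : ∀ φ, IsTestFunction φ → (Integrable fun x => j x * φ x) ∧
      Tendsto (jumpPairing F φ) (𝓝[>] 0) (𝓝 (∫ x, j x * φ x)) := by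
    intro φ hφ
    obtain ⟨R, hR, hRφ⟩ := hφ.supp.exists_pos_le_norm
    obtain ⟨K, hK, hKφ⟩ := hφ.exists_bound
    obtain ⟨C, hC⟩ := hb R
    set bound : ℝ → ℝ := (Set.Ioc (-R) R).indicator fun x => |C| * edgeBound x * K with hbound
    have hbi : Integrable bound := by
      rw [hbound, integrable_indicator_iff measurableSet_Ioc]
      have := ((intervalIntegrable_edgeBound (-R) R).const_mul |C|).mul_const K
      rwa [intervalIntegrable_iff_integrableOn_Ioc_of_le (by linarith)] at this
    have hae : ∀ᵐ x : ℝ, x ≠ 0 ∧ x ≠ 4 := by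
      filter_upwards [compl_mem_ae_iff.2 (measure_singleton (μ := volume) (0 : ℝ)),
        compl_mem_ae_iff.2 (measure_singleton (μ := volume) (4 : ℝ))] with x h1 h2
      exact ⟨h1, h2⟩
    have hle : ∀ x : ℝ, x ≠ 0 → x ≠ 4 → ∀ ε ∈ Set.Ioc (0 : ℝ) 1,
        ‖jump F ε x * φ x‖ ≤ bound x := by
      intro x h0 h4 ε hε
      by_cases hx : |x| < R
      · have hmem : x ∈ Set.Ioc (-R) R := ⟨(abs_lt.1 hx).1, (abs_lt.1 hx).2.le⟩
        rw [hbound, Set.indicator_of_mem hmem, norm_mul]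
        have e1 := hC x ε h0 h4 hx.le hε.1.ne' (by rw [abs_of_pos hε.1]; exact hε.2)
        have e2 := hC x (-ε) h0 h4 hx.le (neg_ne_zero.2 hε.1.ne')
          (by rw [abs_neg, abs_of_pos hε.1]; exact hε.2)
        have e3 : ‖jump F ε x‖ ≤ |C| * edgeBound x := by
          have hCb : C * edgeBound x ≤ |C| * edgeBound x :=
            mul_le_mul_of_nonneg_right (le_abs_self C) (edgeBound_nonneg x)
          have e2' : ‖F (x - Complex.I * ε)‖ ≤ C * edgeBound x := by
            simpa [sub_eq_add_neg] using e2
          have hpi : ‖(2 * Real.pi * Complex.I : ℂ)‖ = 2 * Real.pi := by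
            simp [abs_of_pos Real.pi_pos]
          have := Real.pi_gt_three
          rw [jump, norm_div, hpi, div_le_iff₀ (by positivity)]
          refine (norm_sub_le _ _).trans ?_
          have h5 : 0 ≤ |C| * edgeBound x := mul_nonneg (abs_nonneg _) (edgeBound_nonneg x)
          nlinarith
        have := edgeBound_nonneg x
        gcongr
        exact hKφ x
      · rw [hRφ x (by rw [Real.norm_eq_abs]; exact not_lt.1 hx), mul_zero, norm_zero]
        exact Set.indicator_nonneg (fun x _ => by have := edgeBound_nonneg x; positivity) x
    have hIoc : Set.Ioc (0 : ℝ) 1 ∈ 𝓝[>] (0 : ℝ) := Ioc_mem_nhdsGT one_pos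
    have hlim : ∀ᵐ x : ℝ, Tendsto (fun ε => jump F ε x * φ x) (𝓝[>] 0) (𝓝 (j x * φ x)) := by
      filter_upwards [hae] with x hx
      exact (hj x hx.1 hx.2).mul_const _
    have hle' : ∀ᶠ ε in 𝓝[>] (0 : ℝ), ∀ᵐ x : ℝ, ‖jump F ε x * φ x‖ ≤ bound x := by
      filter_upwards [hIoc] with ε hε
      filter_upwards [hae] with x hx
      exact hle x hx.1 hx.2 ε hε
    have hm : ∀ᶠ ε in 𝓝[>] (0 : ℝ), AEStronglyMeasurable (fun x => jump F ε x * φ x) volume := by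
      filter_upwards [self_mem_nhdsWithin] with ε hε
      exact (integrable_jump_mul hF hφ hε).aestronglyMeasurable
    refine ⟨?_, tendsto_integral_filter_of_dominated_convergence bound hm hle' hbi hlim⟩
    have ht : Tendsto (fun n : ℕ => 1 / ((n : ℝ) + 1)) atTop (𝓝[>] 0) :=
      tendsto_nhdsWithin_iff.2 ⟨tendsto_one_div_add_atTop_nhds_zero_nat,
        Eventually.of_forall fun n => by simp only [Set.mem_Ioi]; positivity⟩
    refine hbi.mono' (aestronglyMeasurable_of_tendsto_ae atTop
      (f := fun (n : ℕ) x => jump F (1 / ((n : ℝ) + 1)) x * φ x) (fun n =>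
        (integrable_jump_mul hF hφ (by positivity)).aestronglyMeasurable) ?_) ?_
    · filter_upwards [hlim] with x hx using hx.comp ht
    · filter_upwards [hlim, hae] with x hx hx0
      refine le_of_tendsto hx.norm ?_
      filter_upwards [hIoc] with ε hε using hle x hx0.1 hx0.2 ε hε
  exact ⟨fun φ hφ => (key φ hφ).1, ⟨hF, fun φ hφ => (key φ hφ).2⟩⟩

/-- The inverse Stieltjes transform of `1 / (s - c)` is the Dirac mass at `c`. -/
theorem hasJump_inv_sub {c : ℝ} (hc : 0 ≤ c) : HasJump (fun s => 1 / (s - c)) fun φ => φ c where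
  cont := continuousOn_const.div (by fun_prop) fun _ hs => sub_ne_zero_of_mem_cutPlane hs hc
  lim φ hφ := by
    obtain ⟨K, hK, hKφ⟩ := hφ.exists_bound
    have hpi : (Real.pi : ℂ) ≠ 0 := by exact_mod_cast Real.pi_ne_zero
    -- the substitution `x = c + ε t` turns the jump into the Cauchy density
    have e : ∀ ε : ℝ, 0 < ε → jumpPairing (fun s => 1 / (s - c)) φ ε =
        ∫ t : ℝ, ((Real.pi⁻¹ * (1 + t ^ 2)⁻¹ : ℝ) : ℂ) * φ (ε * t + c) := by
      intro ε hε
      set g : ℝ → ℂ := fun x => jump (fun s => 1 / (s - c)) ε x * φ x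
      have h1 : jumpPairing (fun s => 1 / (s - c)) φ ε = ε • ∫ t : ℝ, g (ε * t + c) := by
        have h2 := Measure.integral_comp_mul_left (fun x => g (x + c)) ε
        rw [integral_add_right_eq_self g c] at h2
        rw [h2, smul_smul, abs_of_pos (inv_pos.2 hε), mul_inv_cancel₀ hε.ne', one_smul]
        rfl
      rw [h1, ← integral_smul]
      refine integral_congr_ae (Eventually.of_forall fun t => ?_)
      simp only [g, jump, Complex.real_smul]
      rw [← mul_assoc]
      congr 1
      have hε' : (ε : ℂ) ≠ 0 := by exact_mod_cast hε.ne'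
      have hI := Complex.I_ne_zero
      have h3 : (t : ℂ) - Complex.I ≠ 0 := fun h => by
        have := congrArg Complex.im h
        simp at this
      have h4 : (t : ℂ) + Complex.I ≠ 0 := fun h => by
        have := congrArg Complex.im h
        simp at this
      have h5 : (1 : ℂ) + t ^ 2 = (t - Complex.I) * (t + Complex.I) := by
        linear_combination Complex.I_sq
      push_cast
      rw [h5, show (ε : ℂ) * t + c - Complex.I * ε - c = ε * (t - Complex.I) by ring,
        show (ε : ℂ) * t + c + Complex.I * ε - c = ε * (t + Complex.I) by ring]
      field_simp
      ring
    have hlim : Tendsto (fun ε : ℝ => ∫ t : ℝ, ((Real.pi⁻¹ * (1 + t ^ 2)⁻¹ : ℝ) : ℂ) *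
        φ (ε * t + c)) (𝓝[>] 0) (𝓝 (∫ t : ℝ, ((Real.pi⁻¹ * (1 + t ^ 2)⁻¹ : ℝ) : ℂ) * φ c)) := by
      refine tendsto_integral_filter_of_dominated_convergence
        (fun t => Real.pi⁻¹ * (1 + t ^ 2)⁻¹ * K) ?_ ?_
        ((integrable_inv_one_add_sq.const_mul _).mul_const K) ?_
      · refine Eventually.of_forall fun ε => ?_
        have hφc := hφ.continuous
        have : Continuous fun t : ℝ => (1 + t ^ 2)⁻¹ :=
          Continuous.inv₀ (by fun_prop) fun t => by positivity
        exact Continuous.aestronglyMeasurable (by fun_prop)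
      · refine Eventually.of_forall fun ε => Eventually.of_forall fun t => ?_
        have := Real.pi_pos
        rw [norm_mul, Complex.norm_real, Real.norm_of_nonneg (by positivity)]
        gcongr
        exact hKφ _
      · refine Eventually.of_forall fun t => Tendsto.const_mul _ ?_
        have hφc := hφ.continuous
        have : Continuous fun ε : ℝ => φ (ε * t + c) := by fun_prop
        have h := (this.tendsto 0).mono_left (nhdsWithin_le_nhds (s := Set.Ioi 0))
        simpa using h
    have hval : ∫ t : ℝ, ((Real.pi⁻¹ * (1 + t ^ 2)⁻¹ : ℝ) : ℂ) * φ c = φ c := by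
      rw [integral_mul_const, integral_complex_ofReal, integral_const_mul,
        integral_univ_inv_one_add_sq, inv_mul_cancel₀ Real.pi_ne_zero]
      simp
    rw [hval] at hlim
    refine hlim.congr' ?_
    filter_upwards [self_mem_nhdsWithin] with ε hε using (e ε hε).symm

end

/-! ### Jumps of the algebraic functions in the coefficients -/

section

lemma tendsto_jump {F : ℂ → ℂ} {x : ℝ} {u v : ℂ}
    (hu : Tendsto (fun ε : ℝ => F (x - Complex.I * ε)) (𝓝[>] 0) (𝓝 u))
    (hv : Tendsto (fun ε : ℝ => F (x + Complex.I * ε)) (𝓝[>] 0) (𝓝 v)) :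
    Tendsto (fun ε => jump F ε x) (𝓝[>] 0) (𝓝 ((u - v) / (2 * Real.pi * Complex.I))) :=
  (hu.sub hv).div_const _

/-- A rational function of `s` and `rt s` has a pointwise jump, obtained from the boundary values
of `rt`. -/
lemma tendsto_jump_of_rt {F : ℂ → ℂ} (g : ℂ → ℂ → ℂ) (hF : ∀ s ∈ cutPlane, F s = g s (rt s))
    (hg : ∀ s r : ℂ, s ≠ 0 → s ≠ 4 → r ≠ 0 → ContinuousAt (fun p : ℂ × ℂ => g p.1 p.2) (s, r))
    {x : ℝ} (h0 : x ≠ 0) (h4 : x ≠ 4) :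
    Tendsto (fun ε => jump F ε x) (𝓝[>] 0)
      (𝓝 ((Set.Ioo (0 : ℝ) 4).indicator (fun x => (g x (-(Complex.I * edgeRoot x)) -
        g x (Complex.I * edgeRoot x)) / (2 * Real.pi * Complex.I)) x)) := by
  obtain ⟨v, hv0, hup, hlow, hin, hout⟩ := exists_tendsto_rt h0 h4
  have hx0 : (x : ℂ) ≠ 0 := by exact_mod_cast h0
  have hx4 : (x : ℂ) ≠ 4 := by exact_mod_cast h4
  have hc0 : (starRingEnd ℂ) v ≠ 0 := by simpa using hv0
  have e1 : Tendsto (fun ε : ℝ => F (x + Complex.I * ε)) (𝓝[>] 0) (𝓝 (g x v)) := by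
    refine ((hg x v hx0 hx4 hv0).tendsto.comp ((tendsto_add_I_mul x).prodMk_nhds hup)).congr' ?_
    filter_upwards [self_mem_nhdsWithin] with ε hε
    exact (hF _ (add_mem_cutPlane hε)).symm
  have e2 : Tendsto (fun ε : ℝ => F (x - Complex.I * ε)) (𝓝[>] 0)
      (𝓝 (g x ((starRingEnd ℂ) v))) := by
    refine ((hg x _ hx0 hx4 hc0).tendsto.comp ((tendsto_sub_I_mul x).prodMk_nhds hlow)).congr' ?_
    filter_upwards [self_mem_nhdsWithin] with ε hε
    exact (hF _ (sub_mem_cutPlane hε)).symm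
  have h := tendsto_jump e2 e1
  by_cases hx : x ∈ Set.Ioo (0 : ℝ) 4
  · rw [Set.indicator_of_mem hx]
    rw [hin hx] at h
    simpa using h
  · rw [Set.indicator_of_notMem hx]
    rw [hout hx, sub_self, zero_div] at h
    exact h

/-- The function `x ^ k / (π √(4 / x - 1))` on `(0, 4)`, and `0` elsewhere. -/
def edgePow (k : ℕ) : ℝ → ℝ :=
  (Set.Ioo (0 : ℝ) 4).indicator fun x => x ^ k / (Real.pi * edgeRoot x)

/-- Half-integer powers of `4 / x - 1` as integer powers of `edgeRoot`. -/
lemma edge_half {x : ℝ} (k : ℕ) (hx : x ∈ Set.Ioo (0 : ℝ) 4) (m : ℕ) :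
    edge k (-(m / 2)) x = 1 / (Real.pi * x ^ k * edgeRoot x ^ m) := by
  rw [edge, Set.indicator_of_mem hx, edgeRoot, Real.sqrt_eq_rpow]
  have hpos : 0 ≤ 4 / x - 1 := by
    have := hx.1
    rw [sub_nonneg, le_div_iff₀ this]
    linarith [hx.2]
  rw [← Real.rpow_natCast ((4 / x - 1) ^ (1 / 2 : ℝ)) m, ← Real.rpow_mul hpos, Real.rpow_neg hpos,
    show (1 / 2 * (m : ℝ)) = m / 2 by ring]
  have := Real.pi_pos
  have := hx.1
  field_simp

lemma continuousOn_rt : ContinuousOn rt cutPlane := fun _ hs =>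
  (hasDerivAt_rt hs).continuousAt.continuousWithinAt

lemma tendsto_jump_rt {x : ℝ} (h0 : x ≠ 0) (h4 : x ≠ 4) :
    Tendsto (fun ε => jump rt ε x) (𝓝[>] 0) (𝓝 (-2 * (mpDensity x : ℂ))) := by
  have h := tendsto_jump_of_rt (F := rt) (fun _ r => r) (fun _ _ => rfl)
    (fun _ _ _ _ _ => continuousAt_snd) h0 h4
  convert h using 2
  by_cases hx : x ∈ Set.Ioo (0 : ℝ) 4
  · have hpi : (Real.pi : ℂ) ≠ 0 := by exact_mod_cast Real.pi_ne_zero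
    have hI := Complex.I_ne_zero
    rw [Set.indicator_of_mem hx, mpDensity, Set.indicator_of_mem hx, ← edgeRoot]
    push_cast
    field_simp
    ring
  · rw [Set.indicator_of_notMem hx, mpDensity, Set.indicator_of_notMem hx]
    simp

lemma tendsto_jump_pow_mul_inv_rt (k : ℕ) {x : ℝ} (h0 : x ≠ 0) (h4 : x ≠ 4) :
    Tendsto (fun ε => jump (fun s => s ^ k * (1 / rt s)) ε x) (𝓝[>] 0) (𝓝 (edgePow k x : ℂ)) := by
  have h := tendsto_jump_of_rt (F := fun s => s ^ k * (1 / rt s)) (fun s r => s ^ k * (1 / r))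
    (fun _ _ => rfl) (fun s r hs _ hr => (continuousAt_fst.pow k).mul
      (continuousAt_const.div continuousAt_snd hr)) h0 h4
  convert h using 2
  by_cases hx : x ∈ Set.Ioo (0 : ℝ) 4
  · have hpi : (Real.pi : ℂ) ≠ 0 := by exact_mod_cast Real.pi_ne_zero
    have hI := Complex.I_ne_zero
    have hq : (edgeRoot x : ℂ) ≠ 0 := by exact_mod_cast (edgeRoot_pos hx).ne'
    rw [Set.indicator_of_mem hx, edgePow, Set.indicator_of_mem hx]
    push_cast
    field_simp
    linear_combination 2 * x ^ k * Complex.I_sq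
  · rw [Set.indicator_of_notMem hx, edgePow, Set.indicator_of_notMem hx]
    simp

lemma tendsto_jump_inv_mul_rt {x : ℝ} (h0 : x ≠ 0) (h4 : x ≠ 4) :
    Tendsto (fun ε => jump (fun s => 1 / (s * rt s)) ε x) (𝓝[>] 0)
      (𝓝 (edge 1 (-(1 / 2)) x : ℂ)) := by
  have h := tendsto_jump_of_rt (F := fun s => 1 / (s * rt s)) (fun s r => 1 / (s * r))
    (fun _ _ => rfl) (fun s r hs _ hr => continuousAt_const.div
      (continuousAt_fst.mul continuousAt_snd) (mul_ne_zero hs hr)) h0 h4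
  convert h using 2
  by_cases hx : x ∈ Set.Ioo (0 : ℝ) 4
  · have hpi : (Real.pi : ℂ) ≠ 0 := by exact_mod_cast Real.pi_ne_zero
    have hI := Complex.I_ne_zero
    have hx0 : (x : ℂ) ≠ 0 := by exact_mod_cast h0
    have hq : (edgeRoot x : ℂ) ≠ 0 := by exact_mod_cast (edgeRoot_pos hx).ne'
    have e := edge_half 1 hx 1
    rw [Nat.cast_one] at e
    rw [Set.indicator_of_mem hx, e]
    push_cast
    field_simp
    linear_combination 2 * Complex.I_sq
  · rw [Set.indicator_of_notMem hx, edge, Set.indicator_of_notMem hx]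
    simp

lemma hasJump_const (c : ℂ) : HasJump (fun _ => c) fun _ => 0 where
  cont := continuousOn_const
  lim φ _ := by
    have : jumpPairing (fun _ => c) φ = fun _ => 0 := by
      funext ε
      simp [jumpPairing, jump]
    rw [this]
    exact tendsto_const_nhds

lemma hasJump_rt : (∀ φ, IsTestFunction φ → Integrable fun x => -2 * (mpDensity x : ℂ) * φ x) ∧
    HasJump rt fun φ => ∫ x, -2 * (mpDensity x : ℂ) * φ x :=
  hasJump_of_edgeBdd continuousOn_rt edgeBdd_rt fun _ h0 h4 => tendsto_jump_rt h0 h4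

lemma hasJump_pow_mul_inv_rt (k : ℕ) :
    (∀ φ, IsTestFunction φ → Integrable fun x => (edgePow k x : ℂ) * φ x) ∧
    HasJump (fun s => s ^ k * (1 / rt s)) fun φ => ∫ x, (edgePow k x : ℂ) * φ x :=
  hasJump_of_edgeBdd ((continuousOn_pow k).mul
    (continuousOn_const.div continuousOn_rt fun _ hs => rt_ne_zero hs)) (edgeBdd_inv_rt.pow_mul k)
    fun _ h0 h4 => tendsto_jump_pow_mul_inv_rt k h0 h4

lemma hasJump_inv_mul_rt :
    (∀ φ, IsTestFunction φ → Integrable fun x => (edge 1 (-(1 / 2)) x : ℂ) * φ x) ∧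
    HasJump (fun s => 1 / (s * rt s)) fun φ => ∫ x, (edge 1 (-(1 / 2)) x : ℂ) * φ x :=
  hasJump_of_edgeBdd (continuousOn_const.div (continuousOn_id.mul continuousOn_rt) fun _ hs =>
    mul_ne_zero (ne_zero_of_mem_cutPlane hs) (rt_ne_zero hs)) edgeBdd_inv_mul_rt
    fun _ h0 h4 => tendsto_jump_inv_mul_rt h0 h4

/-- The regularised distribution `x⁻² (4 / x - 1) ^ (-1/2) / π`: its density is the derivative of
`-mpDensity`. -/
def edgeDistOne (φ : ℝ → ℂ) : ℂ := ∫ x, (mpDensity x : ℂ) * deriv φ x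

/-- The regularised distribution `x⁻³ (4 / x - 1) ^ (-3/2) / π`: its density is the derivative of
an integrable combination of `edgeRoot` and its reciprocal. -/
def edgeDistThree (φ : ℝ → ℂ) : ℂ :=
  4⁻¹ * (∫ x, (mpDensity x : ℂ) * deriv φ x) - 8⁻¹ * ∫ x, (edgePow 0 x : ℂ) * deriv φ x

/-- The regularised distribution `x⁻⁴ (4 / x - 1) ^ (-5/2) / π`: its density is the derivative of
a combination of `edgeRoot` and its first and third inverse powers, and the third inverse power is
again a derivative up to an integrable function. -/
def edgeDistFive (φ : ℝ → ℂ) : ℂ :=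
  16⁻¹ * (∫ x, (mpDensity x : ℂ) * deriv φ x) - 16⁻¹ * (∫ x, (edgePow 0 x : ℂ) * deriv φ x) +
    96⁻¹ * (∫ x, (edgePow 1 x : ℂ) * deriv φ x) +
    192⁻¹ * ∫ x, (edgePow 2 x : ℂ) * deriv (deriv φ) x

lemma continuousOn_rational {p : ℂ → ℂ} (hp : ContinuousOn p cutPlane) (k m : ℕ) :
    ContinuousOn (fun s => p s / (s ^ k * rt s ^ m)) cutPlane :=
  hp.div ((continuousOn_pow k).mul (continuousOn_rt.pow m)) fun _ hs =>
    mul_ne_zero (pow_ne_zero _ (ne_zero_of_mem_cutPlane hs)) (pow_ne_zero _ (rt_ne_zero hs))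

lemma one_sub_rt_sq {s : ℂ} (hs : s ∈ cutPlane) : 1 - rt s ^ 2 = 4 / s := by
  have h0 := ne_zero_of_mem_cutPlane hs
  have hr := mul_rt_sq h0
  field_simp
  linear_combination -hr

lemma hasJump_edgeDistOne : HasJump (fun s => 1 / (s ^ 2 * rt s ^ 1)) edgeDistOne := by
  have h := (hasJump_rt.2.const_mul 2⁻¹).deriv (F' := fun s => 1 / (s ^ 2 * rt s ^ 1))
    (fun s hs => ?_) (continuousOn_rational continuousOn_const 2 1)
  · refine h.congr (fun s _ => rfl) fun φ hφ => ?_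
    simp only [mul_assoc, integral_const_mul, edgeDistOne]
    ring
  · refine ((hasDerivAt_rt hs).const_mul 2⁻¹).congr_deriv ?_
    have h0 := ne_zero_of_mem_cutPlane hs
    have h1 := rt_ne_zero hs
    rw [one_sub_rt_sq hs]
    field_simp
    norm_num

lemma hasDerivAt_inv_rt {s : ℂ} (hs : s ∈ cutPlane) :
    HasDerivAt (fun s => 1 / rt s) (-(2 / (s ^ 2 * rt s ^ 3))) s := by
  have h0 := ne_zero_of_mem_cutPlane hs
  have h1 := rt_ne_zero hs
  simp only [one_div]
  refine ((hasDerivAt_rt hs).fun_inv h1).congr_deriv ?_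
  rw [one_sub_rt_sq hs]
  field_simp
  norm_num

lemma hasJump_edgeDistThree :
    HasJump (fun s => 1 / (s ^ 3 * rt s ^ 3)) fun φ => -edgeDistThree φ := by
  have h := (((hasJump_rt.2.add ((hasJump_pow_mul_inv_rt 0).2)).const_mul (-8⁻¹))).deriv
    (F' := fun s => 1 / (s ^ 3 * rt s ^ 3))
    (fun s hs => ?_) (continuousOn_rational continuousOn_const 3 3)
  · refine h.congr (fun s _ => rfl) fun φ hφ => ?_
    simp only [mul_assoc, integral_const_mul, edgeDistThree]
    ring
  · simp only [pow_zero, one_mul]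
    refine (((hasDerivAt_rt hs).fun_add (hasDerivAt_inv_rt hs)).const_mul (-8⁻¹)).congr_deriv ?_
    have h0 := ne_zero_of_mem_cutPlane hs
    have h1 := rt_ne_zero hs
    have h2 := mul_rt_sq h0
    rw [one_sub_rt_sq hs]
    field_simp
    linear_combination -4 * h2

lemma hasJump_edgeDistFive : HasJump (fun s => 1 / (s ^ 4 * rt s ^ 5)) edgeDistFive := by
  -- `r⁻³` is recovered from `(s² / r)' = 2 s / r - 2 r⁻³`
  have h2 := ((hasJump_pow_mul_inv_rt 2).2).deriv
    (F' := fun s => (2 * s * rt s ^ 2 - 2) / (s ^ 0 * rt s ^ 3)) (fun s hs => ?_)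
    (continuousOn_rational (by have := continuousOn_rt; fun_prop) 0 3)
  · have h := ((((hasJump_rt.2.add ((hasJump_pow_mul_inv_rt 0).2.const_mul 2)).add
      ((hasJump_pow_mul_inv_rt 1).2.const_mul (-3⁻¹))).const_mul 32⁻¹).add
      (h2.const_mul 192⁻¹)).deriv (F' := fun s => 1 / (s ^ 4 * rt s ^ 5)) (fun s hs => ?_)
      (continuousOn_rational continuousOn_const 4 5)
    · refine h.congr (fun s _ => rfl) fun φ hφ => ?_
      simp only [mul_assoc, integral_const_mul, edgeDistFive]
      ring
    · have h0 := ne_zero_of_mem_cutPlane hs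
      have h1 := rt_ne_zero hs
      have hr := one_sub_rt_sq hs
      have d1 := (((hasDerivAt_rt hs).fun_add ((hasDerivAt_inv_rt hs).const_mul 2)).fun_add
        (((hasDerivAt_inv_rt hs).fun_pow 3).const_mul (-3⁻¹))).const_mul 32⁻¹
      refine (d1.congr_deriv ?_).congr_of_eventuallyEq ?_
      · rw [hr]
        simp only [Nat.add_one_sub_one, div_pow, one_pow]
        field_simp
        push_cast
        linear_combination (-12 * (s * (1 - rt s ^ 2) + 4)) * mul_rt_sq h0
      · filter_upwards [isOpen_cutPlane.mem_nhds hs] with w hw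
        have := rt_ne_zero hw
        field_simp
        ring
  · have h0 := ne_zero_of_mem_cutPlane hs
    have h1 := rt_ne_zero hs
    refine (((hasDerivAt_id s).fun_pow 2).fun_mul (hasDerivAt_inv_rt hs)).congr_deriv ?_
    simp only [id]
    field_simp
    ring

end

/-! ### Hadamard finite parts -/

section

/-- The constant term of the truncated integral of `f` over `(0, 4)` is `I`, when only the powers
`η ^ (-1/2)` and `η ^ (-3/2)` diverge. -/
structure HasFinPart (f : ℝ → ℂ) (I : ℂ) : Prop where
  int : ∀ η : ℝ, 0 < η → η ≤ 4 - η → IntervalIntegrable f volume η (4 - η)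
  lim : ∃ c d : ℂ, Tendsto (fun η : ℝ => (∫ x in η..(4 - η), f x) -
    (c * ((η ^ (-(1 / 2) : ℝ) : ℝ) : ℂ) + d * ((η ^ (-(3 / 2) : ℝ) : ℝ) : ℂ))) (𝓝[>] 0) (𝓝 I)

lemma uIcc_subset_Ioo {η : ℝ} (h : 0 < η) (h2 : η ≤ 4 - η) :
    Set.uIcc η (4 - η) ⊆ Set.Ioo (0 : ℝ) 4 := by
  rw [Set.uIcc_of_le h2]
  intro x hx
  exact ⟨h.trans_le hx.1, hx.2.trans_lt (by linarith)⟩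

lemma eventually_le_two : ∀ᶠ η in 𝓝[>] (0 : ℝ), 0 < η ∧ η ≤ 4 - η ∧ η < 1 := by
  filter_upwards [Ioo_mem_nhdsGT (show (0 : ℝ) < 1 by norm_num)] with η hη
  exact ⟨hη.1, by linarith [hη.2], hη.2⟩

lemma HasFinPart.isFinitePart {f : ℝ → ℂ} {I : ℂ} (h : HasFinPart f I) :
    IsFinitePart f 0 4 I := by
  refine ⟨fun η h0 h1 => ?_, ?_⟩
  · rw [zero_add] at h1 ⊢
    exact h.int η h0 h1
  · obtain ⟨c, d, hl⟩ := h.lim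
    refine ⟨{1 / 2, 3 / 2}, fun r => if r = 1 / 2 then c else d, 0, ?_, ?_⟩
    · intro r hr
      simp only [Finset.mem_insert, Finset.mem_singleton] at hr
      rcases hr with rfl | rfl <;> norm_num
    · refine hl.congr fun η => ?_
      rw [Finset.sum_pair (by norm_num)]
      simp only [if_true, zero_add, zero_mul, sub_zero]
      rw [if_neg (by norm_num)]

lemma HasFinPart.congr {f g : ℝ → ℂ} {I J : ℂ} (h : HasFinPart f I)
    (hfg : Set.EqOn g f (Set.Ioo 0 4)) (hIJ : J = I) : HasFinPart g J where
  int η h0 h1 := by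
    refine (h.int η h0 h1).congr fun x hx => ?_
    exact (hfg (uIcc_subset_Ioo h0 h1 (Set.uIoc_subset_uIcc hx))).symm
  lim := by
    obtain ⟨c, d, hl⟩ := h.lim
    refine ⟨c, d, ?_⟩
    rw [hIJ]
    refine hl.congr' ?_
    filter_upwards [eventually_le_two] with η hη
    congr 1
    exact intervalIntegral.integral_congr fun x hx => (hfg (uIcc_subset_Ioo hη.1 hη.2.1 hx)).symm

lemma HasFinPart.add {f g : ℝ → ℂ} {I J : ℂ} (hf : HasFinPart f I) (hg : HasFinPart g J) :
    HasFinPart (fun x => f x + g x) (I + J) where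
  int η h0 h1 := (hf.int η h0 h1).add (hg.int η h0 h1)
  lim := by
    obtain ⟨c, d, hl⟩ := hf.lim
    obtain ⟨c', d', hl'⟩ := hg.lim
    refine ⟨c + c', d + d', (hl.add hl').congr' ?_⟩
    filter_upwards [eventually_le_two] with η hη
    rw [intervalIntegral.integral_add (hf.int η hη.1 hη.2.1) (hg.int η hη.1 hη.2.1)]
    ring

lemma HasFinPart.const_mul {f : ℝ → ℂ} {I : ℂ} (hf : HasFinPart f I) (a : ℂ) :
    HasFinPart (fun x => a * f x) (a * I) where
  int η h0 h1 := (hf.int η h0 h1).const_mul a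
  lim := by
    obtain ⟨c, d, hl⟩ := hf.lim
    refine ⟨a * c, a * d, (hl.const_mul a).congr fun η => ?_⟩
    rw [intervalIntegral.integral_const_mul]
    ring

lemma hasFinPart_of_integrable {f : ℝ → ℂ} (hf : Integrable f)
    (h0 : ∀ x, x ∉ Set.Ioo (0 : ℝ) 4 → f x = 0) : HasFinPart f (∫ x, f x) where
  int η _ _ := hf.intervalIntegrable
  lim := by
    refine ⟨0, 0, ?_⟩
    have hi : ∀ a b : ℝ, IntervalIntegrable f volume a b := fun a b => hf.intervalIntegrable
    have hc := intervalIntegral.continuous_primitive hi 0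
    have hv : ∫ x, f x = ∫ x in (0 : ℝ)..4, f x := by
      rw [intervalIntegral.integral_of_le (by norm_num), integral_Ioc_eq_integral_Ioo,
        setIntegral_eq_integral_of_forall_compl_eq_zero h0]
    have h1 : Continuous fun η : ℝ => (∫ x in (0 : ℝ)..(4 - η), f x) - ∫ x in (0 : ℝ)..η, f x :=
      (hc.comp (by fun_prop : Continuous fun η : ℝ => 4 - η)).sub hc
    have h2 := (h1.tendsto 0).mono_left (nhdsWithin_le_nhds (s := Set.Ioi 0))
    simp only [sub_zero, intervalIntegral.integral_same] at h2
    rw [hv]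
    refine h2.congr fun η => ?_
    rw [intervalIntegral.integral_interval_sub_left (hi _ _) (hi _ _)]
    ring

lemma exists_taylor_bound {ψ : ℝ → ℂ} (h : ContDiffOn ℝ 2 ψ (Set.Icc 0 1)) :
    ∃ (a : ℂ) (C : ℝ), ∀ η ∈ Set.Icc (0 : ℝ) 1, ‖ψ η - (ψ 0 + a * η)‖ ≤ C * η ^ 2 := by
  obtain ⟨C, hC⟩ := exists_taylor_mean_remainder_bound (n := 1) zero_le_one (by exact_mod_cast h)
  refine ⟨derivWithin ψ (Set.Icc 0 1) 0, C, fun η hη => ?_⟩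
  have := hC η hη
  rw [taylorWithinEval_succ, taylor_within_zero_eval] at this
  simp only [sub_zero] at this
  refine le_trans (le_of_eq ?_) (this.trans (le_of_eq (by norm_num)))
  congr 1
  simp
  ring

/-- Edge behaviour `η ^ (-3 / 2) * ψ η` at both end points of `(0, 4)`, with `ψ` twice continuously
differentiable. -/
def EdgeExp (G : ℝ → ℝ) : Prop :=
  ∃ ψ₀ ψ₄ : ℝ → ℝ, ContDiffOn ℝ 2 ψ₀ (Set.Icc 0 1) ∧ ContDiffOn ℝ 2 ψ₄ (Set.Icc 0 1) ∧
    ∀ η ∈ Set.Ioo (0 : ℝ) 1, G η = η ^ (-(3 / 2) : ℝ) * ψ₀ η ∧ G (4 - η) = η ^ (-(3 / 2) : ℝ) * ψ₄ η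

lemma EdgeExp.add {F G : ℝ → ℝ} (hF : EdgeExp F) (hG : EdgeExp G) :
    EdgeExp fun x => F x + G x := by
  obtain ⟨ψ₀, ψ₄, h1, h2, h3⟩ := hF
  obtain ⟨χ₀, χ₄, k1, k2, k3⟩ := hG
  refine ⟨fun η => ψ₀ η + χ₀ η, fun η => ψ₄ η + χ₄ η, h1.add k1, h2.add k2, fun η hη => ?_⟩
  simp only [(h3 η hη).1, (h3 η hη).2, (k3 η hη).1, (k3 η hη).2]
  constructor <;> ring

lemma EdgeExp.pow_mul {F : ℝ → ℝ} (hF : EdgeExp F) (k : ℕ) : EdgeExp fun x => x ^ k * F x := by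
  obtain ⟨ψ₀, ψ₄, h1, h2, h3⟩ := hF
  refine ⟨fun η => η ^ k * ψ₀ η, fun η => (4 - η) ^ k * ψ₄ η,
    ContDiffOn.mul (by fun_prop) h1, ContDiffOn.mul (by fun_prop) h2, fun η hη => ?_⟩
  simp only [(h3 η hη).1, (h3 η hη).2]
  constructor <;> ring

lemma EdgeExp.const_mul {F : ℝ → ℝ} (hF : EdgeExp F) (c : ℝ) : EdgeExp fun x => c * F x := by
  obtain ⟨ψ₀, ψ₄, h1, h2, h3⟩ := hF
  refine ⟨fun η => c * ψ₀ η, fun η => c * ψ₄ η, contDiffOn_const.mul h1, contDiffOn_const.mul h2,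
    fun η hη => ?_⟩
  simp only [(h3 η hη).1, (h3 η hη).2]
  constructor <;> ring

lemma rpow_neg_three_halves {η : ℝ} (h : 0 < η) : η ^ (-(3 / 2) : ℝ) = 1 / √η ^ 3 := by
  rw [Real.sqrt_eq_rpow, ← Real.rpow_natCast, ← Real.rpow_mul h.le, Real.rpow_neg h.le, one_div]
  norm_num

lemma rpow_neg_half {η : ℝ} (h : 0 < η) : η ^ (-(1 / 2) : ℝ) = η * η ^ (-(3 / 2) : ℝ) := by
  rw [← Real.rpow_one_add' h.le (by norm_num)]
  norm_num

lemma contDiffOn_sqrt_four_sub : ContDiffOn ℝ 2 (fun η : ℝ => √(4 - η)) (Set.Icc 0 1) :=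
  ContDiffOn.sqrt (by fun_prop) fun x hx => by
    have := hx.2
    linarith

lemma sqrt_four_sub_pos {η : ℝ} (h : η ∈ Set.Icc (0 : ℝ) 1) : 0 < √(4 - η) :=
  Real.sqrt_pos.2 (by linarith [h.2])

lemma edgeRoot_four_sub {η : ℝ} (h : η ∈ Set.Ioo (0 : ℝ) 1) :
    edgeRoot η = √(4 - η) / √η ∧ edgeRoot (4 - η) = √η / √(4 - η) := by
  refine ⟨edgeRoot_eq ⟨h.1, by linarith [h.2]⟩, ?_⟩
  rw [edgeRoot_eq ⟨by linarith [h.2], by linarith [h.1]⟩, sub_sub_cancel]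

lemma edgeExp_edgeRoot : EdgeExp edgeRoot := by
  have hc := contDiffOn_sqrt_four_sub
  refine ⟨fun η => η * √(4 - η), fun η => η ^ 2 / √(4 - η), contDiffOn_id.mul hc,
    ContDiffOn.div (by fun_prop) hc fun η hη => (sqrt_four_sub_pos hη).ne', fun η hη => ?_⟩
  have h1 := Real.sqrt_pos.2 hη.1
  have h2 := sqrt_four_sub_pos (Set.Ioo_subset_Icc_self hη)
  have h3 := Real.sq_sqrt hη.1.le
  simp only [(edgeRoot_four_sub hη).1, (edgeRoot_four_sub hη).2, rpow_neg_three_halves hη.1]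
  generalize √(4 - η) = y at *
  generalize √η = t at *
  subst h3
  constructor <;> field_simp

lemma edgeExp_inv_edgeRoot : EdgeExp fun x => 1 / edgeRoot x := by
  have hc := contDiffOn_sqrt_four_sub
  refine ⟨fun η => η ^ 2 / √(4 - η), fun η => η * √(4 - η),
    ContDiffOn.div (by fun_prop) hc fun η hη => (sqrt_four_sub_pos hη).ne', contDiffOn_id.mul hc,
    fun η hη => ?_⟩
  have h1 := Real.sqrt_pos.2 hη.1
  have h2 := sqrt_four_sub_pos (Set.Ioo_subset_Icc_self hη)
  have h3 := Real.sq_sqrt hη.1.le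
  simp only [(edgeRoot_four_sub hη).1, (edgeRoot_four_sub hη).2, rpow_neg_three_halves hη.1]
  generalize √(4 - η) = y at *
  generalize √η = t at *
  subst h3
  constructor <;> field_simp

lemma edgeExp_inv_edgeRoot_cube : EdgeExp fun x => 1 / edgeRoot x ^ 3 := by
  have hc := contDiffOn_sqrt_four_sub
  refine ⟨fun η => η ^ 3 / √(4 - η) ^ 3, fun η => √(4 - η) ^ 3,
    ContDiffOn.div (by fun_prop) (hc.pow 3) fun η hη => (pow_pos (sqrt_four_sub_pos hη) 3).ne',
    hc.pow 3, fun η hη => ?_⟩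
  have h1 := Real.sqrt_pos.2 hη.1
  have h2 := sqrt_four_sub_pos (Set.Ioo_subset_Icc_self hη)
  have h3 := Real.sq_sqrt hη.1.le
  simp only [(edgeRoot_four_sub hη).1, (edgeRoot_four_sub hη).2, rpow_neg_three_halves hη.1]
  generalize √(4 - η) = y at *
  generalize √η = t at *
  subst h3
  constructor <;> field_simp

lemma tendsto_edge_term {ψ : ℝ → ℂ} (h : ContDiffOn ℝ 2 ψ (Set.Icc 0 1)) :
    ∃ c d : ℂ, Tendsto (fun η : ℝ => ((η ^ (-(3 / 2) : ℝ) : ℝ) : ℂ) * ψ η -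
      (c * ((η ^ (-(1 / 2) : ℝ) : ℝ) : ℂ) + d * ((η ^ (-(3 / 2) : ℝ) : ℝ) : ℂ)))
      (𝓝[>] 0) (𝓝 0) := by
  obtain ⟨a, C, hC⟩ := exists_taylor_bound h
  refine ⟨a, ψ 0, ?_⟩
  have hlim : Tendsto (fun η : ℝ => C * √η) (𝓝[>] 0) (𝓝 0) := by
    have : Continuous fun η : ℝ => C * √η := by fun_prop
    have h := (this.tendsto 0).mono_left (nhdsWithin_le_nhds (s := Set.Ioi 0))
    simpa using h
  refine squeeze_zero_norm' ?_ hlim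
  filter_upwards [eventually_le_two] with η hη
  have h1 := hC η ⟨hη.1.le, hη.2.2.le⟩
  have hp := Real.sqrt_pos.2 hη.1
  have e : ((η ^ (-(3 / 2) : ℝ) : ℝ) : ℂ) * ψ η -
      (a * ((η ^ (-(1 / 2) : ℝ) : ℝ) : ℂ) + ψ 0 * ((η ^ (-(3 / 2) : ℝ) : ℝ) : ℂ)) =
      ((η ^ (-(3 / 2) : ℝ) : ℝ) : ℂ) * (ψ η - (ψ 0 + a * η)) := by
    rw [rpow_neg_half hη.1]
    push_cast
    ring
  rw [e, norm_mul, Complex.norm_real, Real.norm_of_nonneg (by have := hη.1; positivity)]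
  have hpos : 0 ≤ η ^ (-(3 / 2) : ℝ) := Real.rpow_nonneg hη.1.le _
  refine (mul_le_mul_of_nonneg_left h1 hpos).trans (le_of_eq ?_)
  rw [rpow_neg_three_halves hη.1]
  have h3 := Real.sq_sqrt hη.1.le
  generalize √η = t at *
  subst h3
  field_simp

/-- Integration by parts for finite parts: the boundary terms expand in half-integer powers of `η`,
so they contribute no constant term. -/
theorem HasFinPart.by_parts {G g : ℝ → ℝ} (hG : EdgeExp G)
    (hd : ∀ x ∈ Set.Ioo (0 : ℝ) 4, HasDerivAt G (g x) x) (hg : ContinuousOn g (Set.Ioo 0 4))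
    {φ : ℝ → ℂ} (hφ : IsTestFunction φ) {I : ℂ}
    (h : HasFinPart (fun x => (G x : ℂ) * deriv φ x) I) :
    HasFinPart (fun x => (g x : ℂ) * φ x) (-I) where
  int η h0 h1 := ContinuousOn.intervalIntegrable
    (((Complex.continuous_ofReal.comp_continuousOn hg).mono (uIcc_subset_Ioo h0 h1)).mul
      hφ.continuous.continuousOn)
  lim := by
    obtain ⟨ψ₀, ψ₄, k1, k2, k3⟩ := hG
    obtain ⟨c, d, hl⟩ := h.lim
    have hs2 : ContDiff ℝ 2 φ := by exact_mod_cast contDiff_infty.1 hφ.smooth 2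
    have c1 : ContDiffOn ℝ 2 (fun η : ℝ => (ψ₀ η : ℂ) * φ η) (Set.Icc 0 1) :=
      (Complex.ofRealCLM.contDiff.comp_contDiffOn k1).mul hs2.contDiffOn
    have c2 : ContDiffOn ℝ 2 (fun η : ℝ => (ψ₄ η : ℂ) * φ (4 - η)) (Set.Icc 0 1) :=
      (Complex.ofRealCLM.contDiff.comp_contDiffOn k2).mul
        (hs2.comp (contDiff_const.sub contDiff_id)).contDiffOn
    obtain ⟨c', d', hl'⟩ := tendsto_edge_term c1
    obtain ⟨c'', d'', hl''⟩ := tendsto_edge_term c2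
    refine ⟨c'' - c' - c, d'' - d' - d, ?_⟩
    have hlim := (hl''.sub hl').sub hl
    rw [sub_zero, zero_sub] at hlim
    refine hlim.congr' ?_
    filter_upwards [eventually_le_two] with η hη
    have hsub := uIcc_subset_Ioo hη.1 hη.2.1
    have hgi : IntervalIntegrable (fun x => (g x : ℂ)) volume η (4 - η) :=
      ContinuousOn.intervalIntegrable
        ((Complex.continuous_ofReal.comp_continuousOn hg).mono hsub)
    have ibp := intervalIntegral.integral_mul_deriv_eq_deriv_mul (a := η) (b := 4 - η)
      (u := fun x => (G x : ℂ)) (v := φ) (u' := fun x => (g x : ℂ)) (v' := deriv φ)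
      (fun x hx => (hd x (hsub hx)).ofReal_comp) (fun x _ => hφ.hasDerivAt x) hgi
      (hφ.deriv.continuous.intervalIntegrable _ _)
    rw [ibp, (k3 η ⟨hη.1, hη.2.2⟩).1, (k3 η ⟨hη.1, hη.2.2⟩).2]
    push_cast
    ring

lemma hasDerivAt_edgeRoot {x : ℝ} (hx : x ∈ Set.Ioo (0 : ℝ) 4) :
    HasDerivAt edgeRoot (-(2 / (x ^ 2 * edgeRoot x))) x := by
  have h0 := hx.1.ne'
  have hq := edgeRoot_pos hx
  have hne : 4 / x - 1 ≠ 0 := fun h => by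
    rw [edgeRoot, h, Real.sqrt_zero] at hq
    exact lt_irrefl _ hq
  have h := ((((hasDerivAt_id x).fun_inv h0).const_mul 4).sub_const 1).sqrt
    (by simpa [div_eq_mul_inv] using hne)
  refine (h.congr_deriv ?_).congr_of_eventuallyEq (Eventually.of_forall fun y => ?_)
  · have e : √(4 * (id x)⁻¹ - 1) = edgeRoot x := by rw [edgeRoot]; congr 1
    rw [e, id]
    field_simp
    norm_num
  · rw [edgeRoot]; congr 1

lemma edgeRoot_sq {x : ℝ} (hx : x ∈ Set.Ioo (0 : ℝ) 4) : x * (1 + edgeRoot x ^ 2) = 4 := by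
  have h0 := hx.1
  rw [edgeRoot, Real.sq_sqrt]
  · field_simp
    ring
  · rw [sub_nonneg, le_div_iff₀ h0]
    linarith [hx.2]

lemma continuousOn_edgeRoot : ContinuousOn edgeRoot (Set.Ioo 0 4) := fun _ hx =>
  (hasDerivAt_edgeRoot hx).continuousAt.continuousWithinAt

lemma continuousOn_edge_rational (k m : ℕ) :
    ContinuousOn (fun x => 1 / (Real.pi * x ^ k * edgeRoot x ^ m)) (Set.Ioo 0 4) := by
  have := continuousOn_edgeRoot
  refine continuousOn_const.div (by fun_prop) fun x hx => ?_
  have h1 := edgeRoot_pos hx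
  have h2 := hx.1
  have := Real.pi_pos
  positivity

lemma hasFinPart_mpDensity {φ : ℝ → ℂ} (hφ : IsTestFunction φ) :
    HasFinPart (fun x => (mpDensity x : ℂ) * φ x) (∫ x, (mpDensity x : ℂ) * φ x) := by
  refine hasFinPart_of_integrable ?_ fun x hx => ?_
  · refine ((hasJump_rt.1 φ hφ).const_mul (-2⁻¹)).congr (Eventually.of_forall fun x => ?_)
    simp only
    ring
  · rw [mpDensity, Set.indicator_of_notMem hx]
    simp

lemma hasFinPart_edgePow (k : ℕ) {φ : ℝ → ℂ} (hφ : IsTestFunction φ) :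
    HasFinPart (fun x => (edgePow k x : ℂ) * φ x) (∫ x, (edgePow k x : ℂ) * φ x) := by
  refine hasFinPart_of_integrable ((hasJump_pow_mul_inv_rt k).1 φ hφ) fun x hx => ?_
  rw [edgePow, Set.indicator_of_notMem hx]
  simp

lemma mpDensity_of_mem {x : ℝ} (hx : x ∈ Set.Ioo (0 : ℝ) 4) :
    mpDensity x = 1 / (2 * Real.pi) * edgeRoot x := by
  rw [mpDensity, Set.indicator_of_mem hx, edgeRoot]

lemma edgePow_of_mem (k : ℕ) {x : ℝ} (hx : x ∈ Set.Ioo (0 : ℝ) 4) :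
    edgePow k x = x ^ k / (Real.pi * edgeRoot x) := by
  rw [edgePow, Set.indicator_of_mem hx]

lemma hasFinPart_edgeDistOne {φ : ℝ → ℂ} (hφ : IsTestFunction φ) :
    HasFinPart (fun x => (edge 2 (-(1 / 2)) x : ℂ) * φ x) (edgeDistOne φ) := by
  have h := ((hasFinPart_mpDensity hφ.deriv).const_mul (-1)).congr
    (g := fun x => ((-1 / (2 * Real.pi) * edgeRoot x : ℝ) : ℂ) * deriv φ x) (fun x hx => ?_) rfl
  · refine (h.by_parts (g := fun x => 1 / (Real.pi * x ^ 2 * edgeRoot x ^ 1))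
      (edgeExp_edgeRoot.const_mul _) (fun x hx => ?_) (continuousOn_edge_rational 2 1) hφ).congr
      (fun x hx => ?_) ?_
    · refine ((hasDerivAt_edgeRoot hx).const_mul _).congr_deriv ?_
      have := edgeRoot_pos hx
      have := hx.1
      have := Real.pi_pos
      field_simp
    · have e := edge_half 2 hx 1
      rw [Nat.cast_one] at e
      simp only [e]
    · rw [edgeDistOne]
      ring
  · simp only [mpDensity_of_mem hx]
    push_cast
    ring

lemma hasFinPart_edgeDistThree {φ : ℝ → ℂ} (hφ : IsTestFunction φ) :
    HasFinPart (fun x => (edge 3 (-(3 / 2)) x : ℂ) * φ x) (edgeDistThree φ) := by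
  have h := (((hasFinPart_mpDensity hφ.deriv).const_mul (-4⁻¹)).add
    ((hasFinPart_edgePow 0 hφ.deriv).const_mul 8⁻¹)).congr
    (g := fun x => ((-1 / (8 * Real.pi) * edgeRoot x + 1 / (8 * Real.pi) * (1 / edgeRoot x) : ℝ) : ℂ)
      * deriv φ x) (fun x hx => ?_) rfl
  · refine (h.by_parts (g := fun x => 1 / (Real.pi * x ^ 3 * edgeRoot x ^ 3))
      ((edgeExp_edgeRoot.const_mul _).add (edgeExp_inv_edgeRoot.const_mul _))
      (fun x hx => ?_) (continuousOn_edge_rational 3 3) hφ).congr (fun x hx => ?_) ?_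
    · have hq := edgeRoot_pos hx
      have hd := hasDerivAt_edgeRoot hx
      simp only [one_div]
      refine ((hd.const_mul _).add ((hd.fun_inv hq.ne').const_mul _)).congr_deriv ?_
      have := hx.1
      have := Real.pi_pos
      have hs := edgeRoot_sq hx
      field_simp
      linear_combination 2 * hs
    · have e := edge_half 3 hx 3
      rw [Nat.cast_ofNat] at e
      simp only [e]
    · rw [edgeDistThree]
      ring
  · simp only [mpDensity_of_mem hx, edgePow_of_mem 0 hx]
    push_cast
    ring

lemma hasFinPart_inv_cube {φ : ℝ → ℂ} (hφ : IsTestFunction φ) :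
    HasFinPart (fun x => ((1 / (Real.pi * edgeRoot x ^ 3) : ℝ) : ℂ) * φ x)
      (-(2⁻¹ * ∫ x, (edgePow 2 x : ℂ) * deriv φ x) - ∫ x, (edgePow 1 x : ℂ) * φ x) := by
  have h := ((hasFinPart_edgePow 2 hφ.deriv).const_mul 2⁻¹).congr
    (g := fun x => ((1 / (2 * Real.pi) * (x ^ 2 * (1 / edgeRoot x)) : ℝ) : ℂ) * deriv φ x)
    (fun x hx => ?_) rfl
  · have h2 := h.by_parts (g := fun x => x * (1 / (Real.pi * x ^ 0 * edgeRoot x ^ 1)) +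
      1 / (Real.pi * x ^ 0 * edgeRoot x ^ 3))
      ((edgeExp_inv_edgeRoot.pow_mul 2).const_mul _) (fun x hx => ?_)
      ((continuousOn_id.mul (continuousOn_edge_rational 0 1)).add (continuousOn_edge_rational 0 3))
      hφ
    · refine (h2.add ((hasFinPart_edgePow 1 hφ).const_mul (-1))).congr (fun x hx => ?_) ?_
      · simp only [edgePow_of_mem 1 hx]
        push_cast
        ring
      · ring
    · have hq := edgeRoot_pos hx
      have hd := hasDerivAt_edgeRoot hx
      simp only [one_div]
      refine ((((hasDerivAt_id x).fun_pow 2).fun_mul (hd.fun_inv hq.ne')).const_mul _).congr_deriv ?_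
      have := hx.1
      have := Real.pi_pos
      simp only [id]
      field_simp
      norm_num
      ring
  · simp only [edgePow_of_mem 2 hx]
    push_cast
    ring

lemma hasFinPart_edgeDistFive {φ : ℝ → ℂ} (hφ : IsTestFunction φ) :
    HasFinPart (fun x => (edge 4 (-(5 / 2)) x : ℂ) * φ x) (edgeDistFive φ) := by
  have h := (((hasFinPart_mpDensity hφ.deriv).const_mul (-16⁻¹)).add
    (((hasFinPart_edgePow 0 hφ.deriv).const_mul 16⁻¹).add
      ((hasFinPart_inv_cube hφ.deriv).const_mul 96⁻¹))).congr
    (g := fun x => ((-1 / (32 * Real.pi) * edgeRoot x + (1 / (16 * Real.pi) * (1 / edgeRoot x) +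
      1 / (96 * Real.pi) * (1 / edgeRoot x ^ 3)) : ℝ) : ℂ) * deriv φ x) (fun x hx => ?_) rfl
  · refine (h.by_parts (g := fun x => 1 / (Real.pi * x ^ 4 * edgeRoot x ^ 5))
      ((edgeExp_edgeRoot.const_mul _).add ((edgeExp_inv_edgeRoot.const_mul _).add
        (edgeExp_inv_edgeRoot_cube.const_mul _)))
      (fun x hx => ?_) (continuousOn_edge_rational 4 5) hφ).congr (fun x hx => ?_) ?_
    · have hq := edgeRoot_pos hx
      have hd := hasDerivAt_edgeRoot hx
      simp only [one_div]
      refine ((hd.const_mul _).add (((hd.fun_inv hq.ne').const_mul _).add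
        (((hd.fun_pow 3).fun_inv (pow_pos hq 3).ne').const_mul _))).congr_deriv ?_
      have := hx.1
      have := Real.pi_pos
      have hs := edgeRoot_sq hx
      simp only [Nat.add_one_sub_one]
      push_cast
      field_simp
      linear_combination 3072 * (x * (1 + edgeRoot x ^ 2) + 4) * hs
    · have e := edge_half 4 hx 5
      rw [Nat.cast_ofNat] at e
      simp only [e]
    · rw [edgeDistFive]
      ring
  · simp only [mpDensity_of_mem hx, edgePow_of_mem 0 hx]
    push_cast
    ring

end

/-! ### The densities -/

section

lemma hasJump_coefZero : HasJump coefZero fun φ => ∫ x, (mpDensity x : ℂ) * φ x := by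
  refine ((hasJump_const 2⁻¹).add (hasJump_rt.2.const_mul (-2⁻¹))).congr (fun s _ => ?_)
    fun φ _ => ?_
  · simp only [coefZero]
    ring
  · simp only [mul_assoc, integral_const_mul]
    ring

lemma hasJump_coefOne (h a : ℝ) : HasJump (coefOne h a) fun φ => (h / 4 : ℂ) * (φ 0 - φ 4) +
    (a / 2 : ℂ) * ((∫ x, (edge 1 (-(1 / 2)) x : ℂ) * φ x) - φ 0) := by
  have d0 := hasJump_inv_sub (le_refl 0)
  have d4 := hasJump_inv_sub (show (0 : ℝ) ≤ 4 by norm_num)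
  refine (((d0.add (d4.const_mul (-1))).const_mul (h / 4)).add
    ((hasJump_inv_mul_rt.2.add (d0.const_mul (-1))).const_mul (a / 2))).congr (fun s _ => ?_)
    fun φ _ => ?_
  · simp only [coefOne, Complex.ofReal_zero, sub_zero, Complex.ofReal_ofNat]
    ring
  · ring

lemma hasJump_coefTwo (h a : ℝ) : HasJump (coefTwo h a) fun φ =>
    edgeDistFive φ - (a : ℂ) ^ 2 * edgeDistThree φ +
      (h : ℂ) ^ 2 * (5 * edgeDistFive φ - 2 * edgeDistThree φ) +
      (h * a / 2 : ℂ) * (edgeDistOne φ - deriv φ 4) := by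
  have d4 := hasJump_inv_sub (show (0 : ℝ) ≤ 4 by norm_num)
  have d4' := d4.deriv (F' := fun s => -1 / (s - 4) ^ 2) (fun s hs => ?_)
    (continuousOn_const.div (by fun_prop) fun s hs => pow_ne_zero 2 (sub_four_ne_zero hs))
  · refine (((hasJump_edgeDistFive.const_mul (1 + 5 * h ^ 2)).add
      (hasJump_edgeDistThree.const_mul (2 * h ^ 2 + a ^ 2))).add
      ((hasJump_edgeDistOne.add d4').const_mul (h * a / 2))).congr (fun s _ => ?_) fun φ _ => ?_
    · simp only [coefTwo, pow_one]
      ring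
    · ring
  · have h0 := sub_four_ne_zero hs
    simp only [one_div, Complex.ofReal_ofNat]
    exact ((hasDerivAt_id s).sub_const 4).fun_inv h0

lemma tendsto_jump_coefZero {x : ℝ} (h0 : x ≠ 0) (h4 : x ≠ 4) :
    Tendsto (fun ε => jump coefZero ε x) (𝓝[>] 0) (𝓝 (mpDensity x : ℂ)) := by
  have h := tendsto_jump_of_rt (F := coefZero) (fun _ r => (1 - r) / 2) (fun _ _ => rfl)
    (fun _ _ _ _ _ => by fun_prop) h0 h4
  convert h using 2
  by_cases hx : x ∈ Set.Ioo (0 : ℝ) 4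
  · have hpi : (Real.pi : ℂ) ≠ 0 := by exact_mod_cast Real.pi_ne_zero
    have hI := Complex.I_ne_zero
    rw [Set.indicator_of_mem hx, mpDensity_of_mem hx]
    push_cast
    field_simp
    ring
  · rw [Set.indicator_of_notMem hx, mpDensity, Set.indicator_of_notMem hx]
    simp

lemma tendsto_jump_coefOne (h a : ℝ) {x : ℝ} (h0 : x ≠ 0) (h4 : x ≠ 4) :
    Tendsto (fun ε => jump (coefOne h a) ε x) (𝓝[>] 0)
      (𝓝 (a / 2 * (edge 1 (-(1 / 2)) x : ℂ))) := by
  have hl := tendsto_jump_of_rt (F := coefOne h a)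
    (fun s r => h / 4 * (1 / s - 1 / (s - 4)) + a / 2 * (1 / (s * r) - 1 / s)) (fun _ _ => rfl)
    (fun s r hs hs4 hr => by
      have := sub_ne_zero.2 hs4
      have := mul_ne_zero hs hr
      fun_prop (disch := assumption)) h0 h4
  convert hl using 2
  by_cases hx : x ∈ Set.Ioo (0 : ℝ) 4
  · have hpi : (Real.pi : ℂ) ≠ 0 := by exact_mod_cast Real.pi_ne_zero
    have hI := Complex.I_ne_zero
    have hx0 : (x : ℂ) ≠ 0 := by exact_mod_cast h0
    have hx4 : (x : ℂ) - 4 ≠ 0 := sub_ne_zero.2 (by exact_mod_cast h4)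
    have hq : (edgeRoot x : ℂ) ≠ 0 := by exact_mod_cast (edgeRoot_pos hx).ne'
    have e := edge_half 1 hx 1
    rw [Nat.cast_one] at e
    rw [Set.indicator_of_mem hx, e]
    push_cast
    field_simp
    ring_nf
    simp only [Complex.I_sq]
    ring
  · rw [Set.indicator_of_notMem hx, edge, Set.indicator_of_notMem hx]
    simp

lemma tendsto_jump_coefTwo (h a : ℝ) {x : ℝ} (h0 : x ≠ 0) (h4 : x ≠ 4) :
    Tendsto (fun ε => jump (coefTwo h a) ε x) (𝓝[>] 0)
      (𝓝 (edge 4 (-(5 / 2)) x - (a : ℂ) ^ 2 * edge 3 (-(3 / 2)) x +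
        (h : ℂ) ^ 2 * (5 * edge 4 (-(5 / 2)) x - 2 * edge 3 (-(3 / 2)) x) +
        h * a / 2 * edge 2 (-(1 / 2)) x)) := by
  have hl := tendsto_jump_of_rt (F := coefTwo h a)
    (fun s r => (1 + 5 * h ^ 2) * (1 / (s ^ 4 * r ^ 5)) +
      (2 * h ^ 2 + a ^ 2) * (1 / (s ^ 3 * r ^ 3)) +
      h * a / 2 * (1 / (s ^ 2 * r) - 1 / (s - 4) ^ 2)) (fun _ _ => rfl)
    (fun s r hs hs4 hr => by
      have := pow_ne_zero 2 (sub_ne_zero.2 hs4)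
      have := mul_ne_zero (pow_ne_zero 4 hs) (pow_ne_zero 5 hr)
      have := mul_ne_zero (pow_ne_zero 3 hs) (pow_ne_zero 3 hr)
      have := mul_ne_zero (pow_ne_zero 2 hs) hr
      fun_prop (disch := assumption)) h0 h4
  convert hl using 2
  by_cases hx : x ∈ Set.Ioo (0 : ℝ) 4
  · have hpi : (Real.pi : ℂ) ≠ 0 := by exact_mod_cast Real.pi_ne_zero
    have hx0 : (x : ℂ) ≠ 0 := by exact_mod_cast h0
    have hq : (edgeRoot x : ℂ) ≠ 0 := by exact_mod_cast (edgeRoot_pos hx).ne'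
    have e1 := edge_half 2 hx 1
    have e3 := edge_half 3 hx 3
    have e5 := edge_half 4 hx 5
    rw [Nat.cast_one] at e1
    rw [Nat.cast_ofNat] at e3 e5
    have v5 : (Complex.I * edgeRoot x) ^ 5 = Complex.I * edgeRoot x ^ 5 := by
      linear_combination Complex.I * edgeRoot x ^ 5 * (Complex.I ^ 2 - 1) * Complex.I_sq
    have v3 : (Complex.I * edgeRoot x) ^ 3 = -(Complex.I * edgeRoot x ^ 3) := by
      linear_combination Complex.I * edgeRoot x ^ 3 * Complex.I_sq
    have v5' : (-(Complex.I * edgeRoot x)) ^ 5 = -(Complex.I * edgeRoot x ^ 5) := by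
      rw [← v5]; ring
    have v3' : (-(Complex.I * edgeRoot x)) ^ 3 = Complex.I * edgeRoot x ^ 3 := by
      rw [← neg_eq_iff_eq_neg.2 v3]; ring
    rw [Set.indicator_of_mem hx, e1, e3, e5, v5, v3, v5', v3']
    push_cast
    generalize 1 / ((x : ℂ) - 4) ^ 2 = d
    have hI0 := Complex.I_ne_zero
    field_simp
    linear_combination (4 + 20 * h ^ 2 - (4 * a ^ 2 + 8 * h ^ 2) * x * edgeRoot x ^ 2 +
      2 * a * h * x ^ 2 * edgeRoot x ^ 4 : ℂ) * Complex.I_sq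
  · simp only [Set.indicator_of_notMem hx, edge]
    simp

end

end LaguerreBeta

end

theorem proposition3p6 (β α₁ κ h : ℝ) (hβ : 0 < β) (hα : -1 < α₁)
    (hκ : κ = β / 2) (hh : h = √κ - 1 / √κ) :
    (∃ W : ℕ → ℂ → ℂ, LaguerreBeta.HasResolventExpansion β α₁ 2 W) ∧
    ∀ W : ℕ → ℂ → ℂ, LaguerreBeta.HasResolventExpansion β α₁ 2 W →
      -- the limits as distributions on the real line
      (∀ φ : ℝ → ℂ, ContDiff ℝ ∞ φ → HasCompactSupport φ →
        (Integrable (fun x : ℝ => (LaguerreBeta.mpDensity x : ℂ) * φ x) ∧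
          Tendsto (LaguerreBeta.jumpPairing (W 0) φ) (𝓝[>] 0)
            (𝓝 (∫ x : ℝ, (LaguerreBeta.mpDensity x : ℂ) * φ x))) ∧
        (Integrable (fun x : ℝ => (LaguerreBeta.edge 1 (-(1 / 2)) x : ℂ) * φ x) ∧
          Tendsto (LaguerreBeta.jumpPairing (W 1) φ) (𝓝[>] 0)
            (𝓝 ((h / 4 : ℝ) * (φ 0 - φ 4)
              + (α₁ / (2 * √κ) : ℝ) *
                ((∫ x : ℝ, (LaguerreBeta.edge 1 (-(1 / 2)) x : ℂ) * φ x) - φ 0)))) ∧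
        ∃ I₁ I₂ I₃ : ℂ,
          LaguerreBeta.IsFinitePart
            (fun x => (LaguerreBeta.edge 4 (-(5 / 2)) x : ℂ) * φ x) 0 4 I₁ ∧
          LaguerreBeta.IsFinitePart
            (fun x => (LaguerreBeta.edge 3 (-(3 / 2)) x : ℂ) * φ x) 0 4 I₂ ∧
          LaguerreBeta.IsFinitePart
            (fun x => (LaguerreBeta.edge 2 (-(1 / 2)) x : ℂ) * φ x) 0 4 I₃ ∧
          Tendsto (LaguerreBeta.jumpPairing (W 2) φ) (𝓝[>] 0)
            (𝓝 (I₁ - (α₁ ^ 2 / κ : ℝ) * I₂ + (h ^ 2 : ℝ) * (5 * I₁ - 2 * I₂)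
              + (h * α₁ / (2 * √κ) : ℝ) * (I₃ - deriv φ 4)))) ∧
      -- the pointwise limits away from the two edges
      ∀ x : ℝ, x ≠ 0 → x ≠ 4 →
        Tendsto (fun ε => LaguerreBeta.jump (W 0) ε x) (𝓝[>] 0)
          (𝓝 ((LaguerreBeta.mpDensity x : ℝ) : ℂ)) ∧
        Tendsto (fun ε => LaguerreBeta.jump (W 1) ε x) (𝓝[>] 0)
          (𝓝 ((α₁ / (2 * √κ) * LaguerreBeta.edge 1 (-(1 / 2)) x : ℝ) : ℂ)) ∧
        Tendsto (fun ε => LaguerreBeta.jump (W 2) ε x) (𝓝[>] 0)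
          (𝓝 ((LaguerreBeta.edge 4 (-(5 / 2)) x - α₁ ^ 2 / κ * LaguerreBeta.edge 3 (-(3 / 2)) x
              + h ^ 2 * (5 * LaguerreBeta.edge 4 (-(5 / 2)) x
                - 2 * LaguerreBeta.edge 3 (-(3 / 2)) x)
              + h * α₁ / (2 * √κ) * LaguerreBeta.edge 2 (-(1 / 2)) x : ℝ) : ℂ)) := by
  have hκ0 : 0 ≤ κ := by rw [hκ]; positivity
  have hex := LaguerreBeta.hasResolventExpansion_coef hβ hα
  have hh' : LaguerreBeta.paramH β = h := by rw [hh, hκ, LaguerreBeta.paramH]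
  have ha' : LaguerreBeta.paramA β α₁ = α₁ / √κ := by rw [hκ, LaguerreBeta.paramA]
  rw [hh', ha'] at hex
  set a := α₁ / √κ with ha
  have e1 : α₁ / (2 * √κ) = a / 2 := by rw [ha, div_div, mul_comm 2]
  have e2 : α₁ ^ 2 / κ = a ^ 2 := by rw [ha, div_pow, Real.sq_sqrt hκ0]
  have e3 : h * α₁ / (2 * √κ) = h * a / 2 := by rw [mul_div_assoc, e1, mul_div_assoc]
  refine ⟨⟨_, hex⟩, fun W hW => ?_⟩
  have h0 : Set.EqOn (W 0) LaguerreBeta.coefZero LaguerreBeta.cutPlane := fun s hs =>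
    (hW.eq hβ hex hs).1
  have h1 : Set.EqOn (W 1) (LaguerreBeta.coefOne h a) LaguerreBeta.cutPlane := fun s hs =>
    (hW.eq hβ hex hs).2.1
  have h2 : Set.EqOn (W 2) (LaguerreBeta.coefTwo h a) LaguerreBeta.cutPlane := fun s hs =>
    (hW.eq hβ hex hs).2.2
  rw [e1, e2, e3]
  refine ⟨fun φ hφ hφc => ?_, fun x hx0 hx4 => ?_⟩
  · have hφ' : LaguerreBeta.IsTestFunction φ := ⟨hφ, hφc⟩
    refine ⟨⟨?_, ?_⟩, ⟨LaguerreBeta.hasJump_inv_mul_rt.1 φ hφ', ?_⟩, LaguerreBeta.edgeDistFive φ,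
      LaguerreBeta.edgeDistThree φ, LaguerreBeta.edgeDistOne φ,
      (LaguerreBeta.hasFinPart_edgeDistFive hφ').isFinitePart,
      (LaguerreBeta.hasFinPart_edgeDistThree hφ').isFinitePart,
      (LaguerreBeta.hasFinPart_edgeDistOne hφ').isFinitePart, ?_⟩
    · refine ((LaguerreBeta.hasJump_rt.1 φ hφ').const_mul (-2⁻¹)).congr
        (Eventually.of_forall fun x => ?_)
      simp only
      ring
    · exact (LaguerreBeta.hasJump_coefZero.congr h0 fun _ _ => rfl).lim φ hφ'
    · push_cast
      exact ((LaguerreBeta.hasJump_coefOne h a).congr h1 fun _ _ => rfl).lim φ hφ'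
    · push_cast
      exact ((LaguerreBeta.hasJump_coefTwo h a).congr h2 fun _ _ => rfl).lim φ hφ'
  · have hj : ∀ {F G : ℂ → ℂ}, Set.EqOn F G LaguerreBeta.cutPlane →
        (fun ε => LaguerreBeta.jump G ε x) =ᶠ[𝓝[>] 0] fun ε => LaguerreBeta.jump F ε x := by
      intro F G hFG
      filter_upwards [self_mem_nhdsWithin] with ε hε
      exact (LaguerreBeta.jump_congr hFG hε x).symm
    push_cast
    exact ⟨(LaguerreBeta.tendsto_jump_coefZero hx0 hx4).congr' (hj h0),
      (LaguerreBeta.tendsto_jump_coefOne h a hx0 hx4).congr' (hj h1),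
      (LaguerreBeta.tendsto_jump_coefTwo h a hx0 hx4).congr' (hj h2)⟩
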